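/- Let $G$ be a finitely generated, free, non-elementary Fuchsian group with parabolic elements, acting on the upper half-plane $(\mathbb H,d)$, freely generated by hyperbolic elements $h_1,\dots,h_u$ and parabolic elements $\gamma_1,\dots,\gamma_v$ ($v\ge 1$, $u+v>1$), where $\gamma_1,\dots,\gamma_v$ represent all cusps of $G$, that is, every parabolic element of $G$ is conjugate in $G$ to an element of some $\langle\gamma_j\rangle$. Let $G_0=\{h_i^{\pm1},\gamma_j^{\pm1}\}$, let $F$ be the Dirichlet fundamental domain of $G$ centred at $i$, and assume that $G_0$ labels the sides of $F$: for $g\in G\setminus\{1\}$, the tiles $F$ and $gF$ share a side (meet in more than one point) if and only if $g\in G_0$. For $x$ in the radial limit set $L_r(G)$, let $\omega_1\omega_2\cdots$ with $\omega_k\in G_0$ be the infinite word for which the hyperbolic ray from $i$ to $x$ successively traverses the tiles $F,\ \omega_1F,\ \omega_1\omega_2F,\dots$. Decompose this word into blocks $B_1(x),B_2(x),\dots$, where each hyperbolic letter is a block of length $1$ and each maximal run of $n$ equal consecutive parabolic letters is a block of length $n$. Put $a_k=|B_k|-1$, and $\log^+ a=\log a$ for $a>0$, $\log^+0=0$. Let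 $\mathcal G_n=\{B_1(x)\cdots B_n(x): x\in L_r(G)\}$, and for $t,\beta\in\mathbb R$ let $$P(t,\beta)=\lim_{n\to\infty}\frac1n\log\sum_{B_1\cdots B_n\in\mathcal G_n}\exp\Big(-t\,d\big(B_1\cdots B_n(i),i\big)-2\beta\sum_{k=1}^n\log^+(a_k)\Big),$$ with values in the extended reals. Then there is a (necessarily unique) function $t:\mathbb R\to\mathbb R$, the cusp-winding free energy function, such that for every $\beta\in\mathbb R$ the number $t(\beta)$ is the unique solution $s$ of $P(s,\beta)=0$. For every $\epsilon\in(0,1/2)$ there is $\beta_0\in\mathbb R$ such that for all $\beta<\beta_0$ $$\frac12-\beta<t(\beta)<\frac12-\beta+\frac{\epsilon}{2}.$$ In particular $t(\beta)-\left(\frac12-\beta\right)\to0$ as $\beta\to-\infty$. -/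

import Mathlib

open Set Filter Topology
open scoped NNReal ENNReal Pointwise MatrixGroups UpperHalfPlane

noncomputable section

namespace CuspWinding

/-- The (closed) Dirichlet fundamental domain of `G` centred at `i`. -/
def dirichletDomain (G : Subgroup SL(2, ℝ)) : Set ℍ :=
  {z | ∀ g ∈ G, dist z UpperHalfPlane.I ≤ dist z (g • UpperHalfPlane.I)}

/-- Letters of the symmetric generating set: `(Sum.inl i, _)` stands for the hyperbolic generator
`h i` or its inverse, `(Sum.inr j, _)` for the parabolic generator `γ j` or its inverse; the flag
is `true` for the generator and `false` for the inverse. -/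
abbrev Letter (u v : ℕ) : Type := (Fin u ⊕ Fin v) × Bool

/-- The element of `SL(2, ℝ)` denoted by a letter. -/
def Letter.val {u v : ℕ} (h : Fin u → SL(2, ℝ)) (γ : Fin v → SL(2, ℝ)) (l : Letter u v) :
    SL(2, ℝ) :=
  if l.2 then Sum.elim h γ l.1 else (Sum.elim h γ l.1)⁻¹

/-- The letter stands for a parabolic generator (or its inverse). -/
def Letter.IsParabolic {u v : ℕ} (l : Letter u v) : Prop := ∃ j : Fin v, l.1 = Sum.inr j

/-- `G` is a finitely generated, free, non-elementary Fuchsian group with parabolic elements,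
written as the free product of the hyperbolic cyclic groups `⟨h i⟩` and the parabolic cyclic groups
`⟨γ j⟩`, where the latter represent all cusps, and where the sides of the tiles of the
Dirichlet tessellation are labelled by the symmetric set of generators.

A free Fuchsian group in `PSL(2, ℝ)` lifts isomorphically to `SL(2, ℝ)`, so that nothing is lost
in working with subgroups of `SL(2, ℝ)`; a subgroup of `SL(2, ℝ)` that is free does not contain
`-1`, hence acts faithfully. -/
structure IsFreeFuchsianGroup {u v : ℕ} (G : Subgroup SL(2, ℝ))
    (h : Fin u → SL(2, ℝ)) (γ : Fin v → SL(2, ℝ)) : Prop where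
  discrete : IsDiscrete (G : Set SL(2, ℝ))
  hyperbolic : ∀ i, (h i).val.IsHyperbolic
  parabolic : ∀ j, (γ j).val.IsParabolic
  /-- there are no relations between the generators -/
  free : Function.Injective (FreeGroup.lift (Sum.elim h γ))
  generates : (FreeGroup.lift (Sum.elim h γ)).range = G
  one_le_cusps : 1 ≤ v
  nonelementary : 1 < u + v
  /-- every parabolic element is conjugate in `G` into one of the groups `⟨γ j⟩` -/
  cusps : ∀ g ∈ G, g.val.IsParabolic →
    ∃ j, ∃ k ∈ G, k⁻¹ * g * k ∈ Subgroup.zpowers (γ j)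
  /-- a tile `g F ≠ F` shares a side with the tile `F` (that is, more than one point) if and only
  if `g` is one of the generators or their inverses -/
  sides : ∀ g ∈ G, g ≠ 1 →
    ((dirichletDomain G ∩ g • dirichletDomain G).Nontrivial ↔
      ∃ l : Letter u v, l.val h γ = g)

/-- A unit speed geodesic ray starting at `i`. A boundary point `x` of `ℍ` is represented by the
unique such ray that goes from `i` towards `x`. -/
structure IsRay (r : ℝ≥0 → ℍ) : Prop where
  isometry : Isometry r
  start : r 0 = UpperHalfPlane.I

/-- The ray `r` ends in a point of the radial limit set of `G`: it returns infinitely often to a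
bounded neighbourhood of the orbit of `i`. -/
def IsRadial (G : Subgroup SL(2, ℝ)) (r : ℝ≥0 → ℍ) : Prop :=
  IsRay r ∧ ∃ R : ℝ, ∃ᶠ s in atTop, ∃ g ∈ G, dist (r s) (g • UpperHalfPlane.I) ≤ R

/-- The product `ω 0 * ω 1 * ⋯ * ω (n - 1)` in `SL(2, ℝ)`. -/
def prefixProd {u v : ℕ} (h : Fin u → SL(2, ℝ)) (γ : Fin v → SL(2, ℝ)) (ω : ℕ → Letter u v)
    (n : ℕ) : SL(2, ℝ) :=
  (List.ofFn fun k : Fin n => (ω k).val h γ).prod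

/-- `ω` is the infinite word of the ray `r`: the ray successively traverses the tiles `F`,
`ω₀ F`, `ω₀ ω₁ F`, …, where `s n` is the time at which it enters the `n`-th tile. The side at
which it leaves `ω₀ ⋯ ω_{n-1} F` for `ω₀ ⋯ ω_n F` is the one that is labelled by `ω_n`. -/
def IsExpansion {u v : ℕ} (G : Subgroup SL(2, ℝ)) (h : Fin u → SL(2, ℝ)) (γ : Fin v → SL(2, ℝ))
    (r : ℝ≥0 → ℍ) (ω : ℕ → Letter u v) : Prop :=
  ∃ s : ℕ → ℝ≥0, s 0 = 0 ∧ StrictMono s ∧ Tendsto s atTop atTop ∧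
    ∀ n, MapsTo r (Icc (s n) (s (n + 1))) (prefixProd h γ ω n • dirichletDomain G)

/-- A block: a letter together with the number of its repetitions. -/
abbrev Block (u v : ℕ) : Type := Letter u v × ℕ

/-- `B` is the sequence of blocks of the infinite word `ω`: each hyperbolic letter is a block of
length one, and each maximal run of one and the same parabolic letter is a block. Here `e k` is the
position in `ω` at which the `k`-th block begins. -/
def IsBlockSequence {u v : ℕ} (ω : ℕ → Letter u v) (B : ℕ → Block u v) : Prop :=
  ∃ e : ℕ → ℕ, e 0 = 0 ∧ ∀ k,
    1 ≤ (B k).2 ∧ e (k + 1) = e k + (B k).2 ∧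
    (∀ j, e k ≤ j → j < e (k + 1) → ω j = (B k).1) ∧
    (¬ (B k).1.IsParabolic → (B k).2 = 1) ∧
    ((B k).1.IsParabolic → ω (e (k + 1)) ≠ (B k).1)

/-- The set of all `(B₁(x), …, Bₙ(x))`, for `x` in the radial limit set. -/
def blockWords {u v : ℕ} (G : Subgroup SL(2, ℝ)) (h : Fin u → SL(2, ℝ)) (γ : Fin v → SL(2, ℝ))
    (n : ℕ) : Set (Fin n → Block u v) :=
  {b | ∃ r ω B, IsRadial G r ∧ IsExpansion G h γ r ω ∧ IsBlockSequence ω B ∧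
    b = fun k : Fin n => B (k : ℕ)}

/-- The group element `B₁ ⋯ Bₙ`. -/
def blockProd {u v n : ℕ} (h : Fin u → SL(2, ℝ)) (γ : Fin v → SL(2, ℝ))
    (b : Fin n → Block u v) : SL(2, ℝ) :=
  (List.ofFn fun k => (b k).1.val h γ ^ (b k).2).prod

/-- The cusp winding number `a = |B| - 1` of a block. -/
def winding {u v : ℕ} (B : Block u v) : ℕ := B.2 - 1

/-- `Zₙ(t, β) = log ∑ exp (-t d(B₁ ⋯ Bₙ(i), i) - 2 β ∑ₖ log⁺ aₖ)`, with values in `(-∞, ∞]`. -/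
def logPartition {u v : ℕ} (G : Subgroup SL(2, ℝ)) (h : Fin u → SL(2, ℝ))
    (γ : Fin v → SL(2, ℝ)) (t β : ℝ) (n : ℕ) : EReal :=
  ENNReal.log (∑' b : blockWords G h γ n, ENNReal.ofReal (Real.exp
    (-t * dist (blockProd h γ b.1 • UpperHalfPlane.I) UpperHalfPlane.I
      - 2 * β * ∑ k, Real.posLog (winding (b.1 k) : ℝ))))

/-- The cusp-winding pressure at `(t, β)` exists as a limit and equals `p`. -/
def HasPressure {u v : ℕ} (G : Subgroup SL(2, ℝ)) (h : Fin u → SL(2, ℝ))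
    (γ : Fin v → SL(2, ℝ)) (t β : ℝ) (p : EReal) : Prop :=
  Tendsto (fun n : ℕ => logPartition G h γ t β n / ((n : ℝ) : EReal)) atTop (𝓝 p)

/-- `t` is the cusp-winding free energy function: for every `β`, the number `t β` is the unique
solution `s` of `P(s, β) = 0`. -/
def IsFreeEnergy {u v : ℕ} (G : Subgroup SL(2, ℝ)) (h : Fin u → SL(2, ℝ))
    (γ : Fin v → SL(2, ℝ)) (t : ℝ → ℝ) : Prop :=
  ∀ β s : ℝ, HasPressure G h γ s β 0 ↔ s = t β

end CuspWinding

end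

noncomputable section

namespace CuspWinding

open Real (cosh exp)
open UpperHalfPlane (I)

/-! ### Coordinates of the action -/

/-! Write `d(w)` for the displacement of `i` by a block word `w`, `W(w)` for the sum of `2 log⁺ a`
over its blocks and `|w|` for the number of blocks. By `mem_blockWords_iff` the words coming from
radial limit points are exactly the combinatorially admissible ones, and on these three estimates
carry everything: (a) `d(ww') = d(w) + d(w') + O(1)` (`exists_disp_append_ge`); (b) a parabolic
block of length `N` has `d = 2 log N + O(1)` (`exists_abs_disp_pow_le`); (c) `d(w) ≥ W(w) + δ|w| -
C` with `δ > 0` (`exists_linear_le_disp`).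

By (b) the partition function of one block is comparable to `∑ N^(-2(t+β))`. With (a), the pressure
is infinite for `t + β ≤ 1/2` and finite for `t + β > 1/2`; it is positive just to the right of the
critical value, because the series diverges there. By (c) it decreases in `t` at rate at least `δ`,
and it is convex, hence continuous. So it has exactly one zero `t(β)`, and `t(β) > 1/2 - β`. For the
upper bound follow the line `t = 1/2 - β + η`: the exponent `-t d - β W` equals `-(1/2 + η) d + β (d
- W)`, so (c) bounds the pressure by `P(1/2 + η, 0) + βδ` for `β < 0`. This is negative once `β` is
sufficiently negative, and then `t(β) < 1/2 - β + η`.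

For (a): `2 cosh d(gi, i)` is the squared norm of `g`, and the squared norm of `g⁻¹g'` is a bilinear
pairing of `g gᵀ` and `g' g'ᵀ`. After normalising traces, compactness bounds the pairing below
unless two cylinders share a limit point. A pigeonhole argument shows that such a point is fixed by
a parabolic element; it is then the cusp of a generator, and the two first letters are parabolic and
mutually inverse (`Touch.isParabolic`). The decomposition into blocks excludes exactly this
configuration. The argument needs ping-pong with disjoint half planes: the Dirichlet domain is cut
out by its labelled sides (`mem_dirichletDomain_of_letters`) and has no vertices because `G` is free
(`not_mem_three_tiles`).

For (c): put a cusp at infinity, with translation length `|τ|`. The half planes of all letters over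
other generators lie in the half disc of radius `|τ|/2`, so a geodesic passing a block of length `N`
travels from one half disc to another one `N` periods away. This costs at least `log (2 (N-1)²)` if
`N ≥ 2`. The surplus `log 2` gives the linear gain for words with many long blocks; on long
stretches of blocks of length one the gain comes from discreteness. -/

lemma denomSq_pos (g : SL(2, ℝ)) (z : ℍ) :
    0 < (g 1 0 * z.re + g 1 1) ^ 2 + (g 1 0 * z.im) ^ 2 := by
  have hdet := Matrix.det_fin_two g.val
  rw [g.2] at hdet
  have hz := z.im_pos
  by_contra hcon
  have h1 : (g 1 0 * z.re + g 1 1) ^ 2 = 0 := by nlinarith [sq_nonneg (g 1 0 * z.re + g 1 1), sq_nonneg (g 1 0 * z.im)]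
  have h2 : (g 1 0 * z.im) ^ 2 = 0 := by nlinarith [sq_nonneg (g 1 0 * z.re + g 1 1), sq_nonneg (g 1 0 * z.im)]
  have h3 : g 1 0 = 0 := by
    rcases mul_eq_zero.mp (pow_eq_zero_iff two_ne_zero |>.mp h2) with h | h
    · exact h
    · exact absurd h hz.ne'
  have h4 : g 1 1 = 0 := by simpa [h3] using h1
  change (1 : ℝ) = g 0 0 * g 1 1 - g 0 1 * g 1 0 at hdet
  rw [h3, h4] at hdet
  simp at hdet

lemma smul_re (g : SL(2, ℝ)) (z : ℍ) :
    (g • z).re = ((g 0 0 * z.re + g 0 1) * (g 1 0 * z.re + g 1 1) + g 0 0 * g 1 0 * z.im ^ 2) /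
      ((g 1 0 * z.re + g 1 1) ^ 2 + (g 1 0 * z.im) ^ 2) := by
  have h := UpperHalfPlane.coe_specialLinearGroup_apply g z
  have h2 := congrArg Complex.re h
  simp only [Complex.div_re, Complex.normSq_apply] at h2
  simp at h2
  rw [h2]
  have := denomSq_pos g z
  rw [← add_div]
  congr 1 <;> ring

lemma smul_im (g : SL(2, ℝ)) (z : ℍ) :
    (g • z).im = z.im / ((g 1 0 * z.re + g 1 1) ^ 2 + (g 1 0 * z.im) ^ 2) := by
  have hdet := Matrix.det_fin_two g.val
  rw [g.2] at hdet
  change (1 : ℝ) = g 0 0 * g 1 1 - g 0 1 * g 1 0 at hdet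
  have h := UpperHalfPlane.coe_specialLinearGroup_apply g z
  have h2 := congrArg Complex.im h
  simp only [Complex.div_im, Complex.normSq_apply] at h2
  simp at h2
  rw [h2]
  have := denomSq_pos g z
  rw [← sub_div]
  congr 1
  · linear_combination -z.im * hdet
  · ring

/-- The squared Frobenius norm. -/
def normSq (g : SL(2, ℝ)) : ℝ := g 0 0 ^ 2 + g 0 1 ^ 2 + g 1 0 ^ 2 + g 1 1 ^ 2

/-- Through this identity every estimate on displacements becomes one on 2×2 matrices. -/
lemma cosh_dist_smul_I (g : SL(2, ℝ)) : cosh (dist (g • I) I) = normSq g / 2 := by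
  have hdet := Matrix.det_fin_two g.val
  rw [g.2] at hdet
  change (1 : ℝ) = g 0 0 * g 1 1 - g 0 1 * g 1 0 at hdet
  have h := denomSq_pos g I
  rw [UpperHalfPlane.cosh_dist', smul_re, smul_im]
  simp only [UpperHalfPlane.I_re, UpperHalfPlane.I_im, mul_zero, zero_add, mul_one, sub_zero,
    one_pow] at h ⊢
  rw [normSq]
  set D := g 1 1 ^ 2 + g 1 0 ^ 2 with hD
  have : (g 0 1 * g 1 1 + g 0 0 * g 1 0) ^ 2 = (g 0 0 ^ 2 + g 0 1 ^ 2) * D - 1 := by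
    rw [hD]
    have : (g 0 0 * g 1 1 - g 0 1 * g 1 0) ^ 2 = 1 := by rw [← hdet]; norm_num
    linear_combination -this
  field_simp
  rw [this, hD]
  ring

lemma dist_smul_smul_I (g h : SL(2, ℝ)) : dist (g • I) (h • I) = dist ((h⁻¹ * g) • I) I := by
  rw [mul_smul, ← dist_smul h⁻¹ (g • I) (h • I), inv_smul_smul]

lemma normSq_inv (g : SL(2, ℝ)) : normSq g⁻¹ = normSq g := by
  have h1 := cosh_dist_smul_I g
  have h2 := cosh_dist_smul_I g⁻¹
  have := dist_smul_smul_I g 1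
  have h3 : dist (g⁻¹ • I) I = dist (g • I) I := by
    rw [← dist_smul g, smul_inv_smul, dist_comm]
  rw [h3] at h2
  linarith

lemma one_le_normSq_half (g : SL(2, ℝ)) : 2 ≤ normSq g := by
  have := cosh_dist_smul_I g
  have h1 := Real.one_le_cosh (dist (g • I) I)
  linarith

/-! ### Geodesics -/

/-- The point `eˢ i`. -/
def vert (s : ℝ) : ℍ := ⟨⟨0, exp s⟩, Real.exp_pos s⟩

@[simp] lemma vert_re (s : ℝ) : (vert s).re = 0 := rfl
@[simp] lemma vert_im (s : ℝ) : (vert s).im = exp s := rfl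
@[simp] lemma vert_zero : vert 0 = I := by
  apply UpperHalfPlane.ext
  apply Complex.ext <;> simp [vert]

/-- The unit speed geodesic which is the image under `k` of the imaginary axis. -/
def geo (k : SL(2, ℝ)) (s : ℝ) : ℍ := k • vert s

lemma dist_vert (s t : ℝ) : dist (vert s) (vert t) = |s - t| := by
  rw [UpperHalfPlane.dist_of_re_eq (by simp)]
  simp [Real.dist_eq]

lemma dist_geo (k : SL(2, ℝ)) (s t : ℝ) : dist (geo k s) (geo k t) = |s - t| := by
  rw [geo, geo, dist_smul, dist_vert]

lemma smul_geo (g k : SL(2, ℝ)) (s : ℝ) : g • geo k s = geo (g * k) s := by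
  rw [geo, geo, mul_smul]

lemma geo_zero (k : SL(2, ℝ)) : geo k 0 = k • I := by simp [geo]

lemma continuous_vert : Continuous vert := by
  rw [Metric.continuous_iff]
  intro b ε hε
  refine ⟨ε, hε, fun a ha => ?_⟩
  rwa [dist_vert, ← Real.dist_eq]

lemma continuous_geo (k : SL(2, ℝ)) : Continuous (geo k) :=
  continuous_vert.const_smul k

lemma continuous_geo_left (s : ℝ) : Continuous fun k => geo k s :=
  continuous_id.smul continuous_const

lemma cosh_dist_vert (s : ℝ) (o : ℍ) :
    cosh (dist (vert s) o) =
      exp s * (1 / (2 * o.im)) + exp (-s) * ((o.re ^ 2 + o.im ^ 2) / (2 * o.im)) := by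
  rw [UpperHalfPlane.cosh_dist', Real.exp_neg]
  have := o.im_pos
  have := Real.exp_pos s
  simp
  field_simp
  ring

/-- The hyperbolic cosine of the distance to a point is a combination of `exp s`, `exp (-s)`
along a geodesic. -/
lemma cosh_dist_geo (k : SL(2, ℝ)) (o : ℍ) :
    ∃ a b : ℝ, ∀ s, cosh (dist (geo k s) o) = a * exp s + b * exp (-s) := by
  refine ⟨1 / (2 * (k⁻¹ • o).im), ((k⁻¹ • o).re ^ 2 + (k⁻¹ • o).im ^ 2) / (2 * (k⁻¹ • o).im),
    fun s => ?_⟩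
  rw [geo, ← dist_smul k⁻¹, inv_smul_smul, cosh_dist_vert s (k⁻¹ • o)]
  ring

/-- The defining function of the half plane of points closer to `o` than to `o'`, negative there. -/
def gap (o o' z : ℍ) : ℝ := cosh (dist z o) - cosh (dist z o')

lemma gap_nonneg_iff {o o' z : ℍ} : 0 ≤ gap o o' z ↔ dist z o' ≤ dist z o := by
  rw [gap, sub_nonneg, Real.cosh_le_cosh, abs_of_nonneg dist_nonneg, abs_of_nonneg dist_nonneg]

lemma gap_pos_iff {o o' z : ℍ} : 0 < gap o o' z ↔ dist z o' < dist z o := by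
  rw [gap, sub_pos, Real.cosh_lt_cosh, abs_of_nonneg dist_nonneg, abs_of_nonneg dist_nonneg]

lemma gap_swap (o o' z : ℍ) : gap o' o z = - gap o o' z := by simp [gap]

lemma gap_nonpos_iff {o o' z : ℍ} : gap o o' z ≤ 0 ↔ dist z o ≤ dist z o' := by
  rw [← gap_nonneg_iff, gap_swap]; simp

lemma gap_neg_iff {o o' z : ℍ} : gap o o' z < 0 ↔ dist z o < dist z o' := by
  rw [← gap_pos_iff, gap_swap]; simp

lemma gap_eq_zero_iff {o o' z : ℍ} : gap o o' z = 0 ↔ dist z o = dist z o' := by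
  rw [le_antisymm_iff, gap_nonneg_iff, gap_nonpos_iff, le_antisymm_iff]

lemma gap_smul (g : SL(2, ℝ)) (o o' z : ℍ) : gap (g • o) (g • o') (g • z) = gap o o' z := by
  simp [gap, dist_smul]

lemma continuous_gap (o o' : ℍ) : Continuous (gap o o') := by
  unfold gap
  exact (Real.continuous_cosh.comp (continuous_id.dist continuous_const)).sub
    (Real.continuous_cosh.comp (continuous_id.dist continuous_const))

/-- `gap` is, up to a positive factor, an affine function of `exp (2 s)` along a geodesic. -/
lemma gap_geo (k : SL(2, ℝ)) (o o' : ℍ) :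
    ∃ a b : ℝ, ∀ s, gap o o' (geo k s) = exp (-s) * (a * exp (2 * s) + b) := by
  obtain ⟨a, b, h⟩ := cosh_dist_geo k o
  obtain ⟨a', b', h'⟩ := cosh_dist_geo k o'
  refine ⟨a - a', b - b', fun s => ?_⟩
  rw [gap, h, h', two_mul, Real.exp_add, Real.exp_neg]
  have := Real.exp_pos s
  field_simp
  ring

/-- Half planes are geodesically convex: by `gap_geo` the sign of `gap` along a geodesic is that of
an affine function of `exp (2 s)`. -/
lemma gap_geo_between (k : SL(2, ℝ)) (o o' : ℍ) {s t m : ℝ} (hs : s ≤ m) (ht : m ≤ t)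
    (h1 : 0 ≤ gap o o' (geo k s)) (h2 : 0 ≤ gap o o' (geo k t)) : 0 ≤ gap o o' (geo k m) := by
  obtain ⟨a, b, h⟩ := gap_geo k o o'
  rw [h] at *
  have e1 := Real.exp_le_exp.mpr (show 2 * s ≤ 2 * m by linarith)
  have e2 := Real.exp_le_exp.mpr (show 2 * m ≤ 2 * t by linarith)
  have h1' := nonneg_of_mul_nonneg_right h1 (Real.exp_pos _)
  have h2' := nonneg_of_mul_nonneg_right h2 (Real.exp_pos _)
  refine mul_nonneg (Real.exp_pos _).le ?_
  rcases le_total 0 a with ha | ha <;> nlinarith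

lemma gap_geo_between_pos (k : SL(2, ℝ)) (o o' : ℍ) {s t m : ℝ} (hs : s ≤ m) (ht : m < t)
    (h1 : 0 < gap o o' (geo k s)) (h2 : 0 ≤ gap o o' (geo k t)) : 0 < gap o o' (geo k m) := by
  obtain ⟨a, b, h⟩ := gap_geo k o o'
  rw [h] at *
  have e1 := Real.exp_le_exp.mpr (show 2 * s ≤ 2 * m by linarith)
  have e2 := Real.exp_lt_exp.mpr (show 2 * m < 2 * t by linarith)
  have h1' := pos_of_mul_pos_right h1 (Real.exp_pos _).le
  have h2' := nonneg_of_mul_nonneg_right h2 (Real.exp_pos _)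
  refine mul_pos (Real.exp_pos _) ?_
  rcases le_total 0 a with ha | ha
  · nlinarith
  · rcases ha.lt_or_eq with ha | rfl
    · nlinarith
    · simpa using h1'

/-- Two zeros on a geodesic: the geodesic is the bisector. -/
lemma gap_geo_eq_zero (k : SL(2, ℝ)) (o o' : ℍ) {s t : ℝ} (hst : s ≠ t)
    (h1 : gap o o' (geo k s) = 0) (h2 : gap o o' (geo k t) = 0) (m : ℝ) :
    gap o o' (geo k m) = 0 := by
  obtain ⟨a, b, h⟩ := gap_geo k o o'
  rw [h] at *
  have h1' := (mul_eq_zero.mp h1).resolve_left (Real.exp_pos _).ne'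
  have h2' := (mul_eq_zero.mp h2).resolve_left (Real.exp_pos _).ne'
  have hne : exp (2 * s) - exp (2 * t) ≠ 0 := by
    rw [sub_ne_zero]
    intro h
    exact hst (by have := Real.exp_injective h; linarith)
  have ha : a = 0 := by
    have : a * (exp (2 * s) - exp (2 * t)) = 0 := by linarith
    exact (mul_eq_zero.mp this).resolve_right hne
  have hb : b = 0 := by simpa [ha] using h1'
  simp [ha, hb]

/-- Crossing a zero: the sign changes. -/
lemma gap_geo_neg_of_pos (k : SL(2, ℝ)) (o o' : ℍ) {s m t : ℝ} (hs : s < m) (ht : m < t)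
    (h1 : 0 < gap o o' (geo k s)) (h2 : gap o o' (geo k m) = 0) : gap o o' (geo k t) < 0 := by
  by_contra! hcon
  exact (gap_geo_between_pos k o o' hs.le ht h1 hcon).ne' h2

lemma gap_geo_neg_of_pos' (k : SL(2, ℝ)) (o o' : ℍ) {s m t : ℝ} (hs : m < s) (ht : t < m)
    (h1 : 0 < gap o o' (geo k s)) (h2 : gap o o' (geo k m) = 0) : gap o o' (geo k t) < 0 := by
  obtain ⟨a, b, h⟩ := gap_geo k o o'
  rw [h] at *
  have h1' := pos_of_mul_pos_right h1 (Real.exp_pos _).le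
  have h2' := (mul_eq_zero.mp h2).resolve_left (Real.exp_pos _).ne'
  have e1 := Real.exp_lt_exp.mpr (show 2 * m < 2 * s by linarith)
  have e2 := Real.exp_lt_exp.mpr (show 2 * t < 2 * m by linarith)
  have ha : 0 < a := by
    by_contra! ha
    nlinarith
  have : a * exp (2 * t) + b < 0 := by nlinarith
  exact mul_neg_of_pos_of_neg (Real.exp_pos _) this

/-! ### Rotations -/

/-- The rotation about `i`. -/
def rot (θ : ℝ) : SL(2, ℝ) :=
  ⟨!![Real.cos θ, Real.sin θ; -Real.sin θ, Real.cos θ], by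
    rw [Matrix.det_fin_two]
    have := Real.cos_sq_add_sin_sq θ
    simp
    nlinarith⟩

lemma rot_entries (θ : ℝ) : (rot θ) 0 0 = Real.cos θ ∧ (rot θ) 0 1 = Real.sin θ ∧
    (rot θ) 1 0 = -Real.sin θ ∧ (rot θ) 1 1 = Real.cos θ := by
  simp [rot]

lemma rot_smul_I (θ : ℝ) : rot θ • I = I := by
  obtain ⟨h1, h2, h3, h4⟩ := rot_entries θ
  have := Real.cos_sq_add_sin_sq θ
  apply UpperHalfPlane.ext
  · apply Complex.ext
    · change (rot θ • I).re = I.re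
      rw [smul_re, h1, h2, h3, h4]; simp; ring
    · change (rot θ • I).im = I.im
      rw [smul_im, h3, h4]; simp [this]

lemma continuous_rot : Continuous rot := by
  refine Continuous.subtype_mk ?_ _
  refine continuous_matrix fun i j => ?_
  fin_cases i <;> fin_cases j <;> simp <;> fun_prop

lemma rot_mul (a b : ℝ) : rot a * rot b = rot (a + b) := by
  ext i j
  rw [Matrix.SpecialLinearGroup.coe_mul]
  fin_cases i <;> fin_cases j <;>
    simp [rot, Real.cos_add, Real.sin_add] <;> ring

lemma rot_inv (a : ℝ) : (rot a)⁻¹ = rot (-a) := by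
  rw [inv_eq_iff_mul_eq_one, rot_mul]
  ext i j
  fin_cases i <;> fin_cases j <;> simp [rot]

lemma rot_pi_div_two_smul_vert (s : ℝ) : rot (Real.pi / 2) • vert s = vert (-s) := by
  obtain ⟨h1, h2, h3, h4⟩ := rot_entries (Real.pi / 2)
  rw [Real.cos_pi_div_two] at h1 h4
  rw [Real.sin_pi_div_two] at h2 h3
  apply UpperHalfPlane.ext
  apply Complex.ext
  · change (rot (Real.pi / 2) • vert s).re = _
    rw [smul_re, h1, h2, h3, h4]; simp
  · change (rot (Real.pi / 2) • vert s).im = (vert (-s)).im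
    rw [smul_im, h3, h4]
    have := Real.exp_pos s
    simp [Real.exp_neg]
    field_simp

/-- The rotation with `θ = π/2` is `w ↦ -1/w`, which flips the sign of the real part; the
intermediate value theorem does the rest. -/
lemma exists_rot_re_eq_zero (w : ℍ) : ∃ θ, (rot θ • w).re = 0 := by
  have hc : Continuous fun θ : ℝ => (rot θ • w).re :=
    UpperHalfPlane.continuous_re.comp (continuous_rot.smul continuous_const)
  have hre : ∀ θ, (rot θ • w).re * ((-Real.sin θ * w.re + Real.cos θ) ^ 2 +
      (-Real.sin θ * w.im) ^ 2) = Real.cos θ * Real.sin θ * (1 - w.re ^ 2 - w.im ^ 2) +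
      (Real.cos θ ^ 2 - Real.sin θ ^ 2) * w.re := by
    intro θ
    obtain ⟨h1, h2, h3, h4⟩ := rot_entries θ
    have := denomSq_pos (rot θ) w
    rw [smul_re, h1, h2, h3, h4]
    rw [h3, h4] at this
    rw [div_mul_cancel₀ _ this.ne']
    ring
  have h0 := hre 0
  have h1 := hre (Real.pi / 2)
  have hw := w.im_pos
  simp at h0 h1
  have hp : 0 < w.re ^ 2 + w.im ^ 2 := by positivity
  rcases le_total 0 w.re with hr | hr
  · have : (0 : ℝ) ∈ Icc ((rot (Real.pi / 2) • w).re) ((rot 0 • w).re) := by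
      constructor
      · by_contra! h; nlinarith
      · rw [h0]; exact hr
    obtain ⟨θ, -, h⟩ := intermediate_value_Icc' Real.pi_div_two_pos.le hc.continuousOn this
    exact ⟨θ, h⟩
  · have : (0 : ℝ) ∈ Icc ((rot 0 • w).re) ((rot (Real.pi / 2) • w).re) := by
      constructor
      · rw [h0]; exact hr
      · by_contra! h; nlinarith
    obtain ⟨θ, -, h⟩ := intermediate_value_Icc Real.pi_div_two_pos.le hc.continuousOn this
    exact ⟨θ, h⟩

/-- Every point lies on a geodesic ray from `i`. -/
lemma exists_rot_geo (w : ℍ) : ∃ θ, geo (rot θ) (dist I w) = w := by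
  obtain ⟨θ, hθ⟩ := exists_rot_re_eq_zero w
  set w' := rot θ • w with hw'
  have h1 : vert (Real.log w'.im) = w' := by
    apply UpperHalfPlane.ext
    apply Complex.ext
    · exact hθ.symm
    · exact Real.exp_log w'.im_pos
  have h2 : dist I w = |Real.log w'.im| := by
    rw [← dist_smul (rot θ), rot_smul_I, ← hw', ← h1, ← vert_zero, dist_vert]
    simp
  rcases le_total 0 (Real.log w'.im) with h | h
  · refine ⟨-θ, ?_⟩
    rw [geo, h2, abs_of_nonneg h, h1, hw', ← rot_inv, inv_smul_smul]
  · refine ⟨-θ + Real.pi / 2, ?_⟩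
    rw [geo, h2, abs_of_nonpos h, ← rot_mul, mul_smul, rot_pi_div_two_smul_vert, neg_neg, h1, hw',
      ← rot_inv, inv_smul_smul]

/-- Any two points are joined by a geodesic. -/
lemma exists_geo (z w : ℍ) : ∃ k, geo k 0 = z ∧ geo k (dist z w) = w := by
  obtain ⟨θ, h⟩ := exists_rot_geo (z.toSL2R⁻¹ • w)
  have hz : dist I (z.toSL2R⁻¹ • w) = dist z w := by
    rw [← dist_smul z.toSL2R, smul_inv_smul, UpperHalfPlane.toSL2R_smul_I]
  refine ⟨z.toSL2R * rot θ, ?_, ?_⟩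
  · rw [geo_zero, mul_smul, rot_smul_I, UpperHalfPlane.toSL2R_smul_I]
  · rw [hz] at h
    rw [← smul_geo, h, smul_inv_smul]

/-- A segment from a point outside of a half plane to a point of the half plane crosses the
boundary. -/
lemma exists_crossing {o o' z w : ℍ} (hz : 0 ≤ gap o o' z) (hw : gap o o' w ≤ 0) :
    ∃ m, gap o o' m = 0 ∧ dist z w = dist z m + dist m w := by
  obtain ⟨k, hk0, hk1⟩ := exists_geo z w
  have hc := (continuous_gap o o').comp (continuous_geo k)
  have hmem : (0 : ℝ) ∈ Icc ((gap o o' ∘ geo k) (dist z w)) ((gap o o' ∘ geo k) 0) := by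
    simp only [Function.comp, hk0, hk1]; exact ⟨hw, hz⟩
  obtain ⟨s, hs, h⟩ := intermediate_value_Icc' dist_nonneg hc.continuousOn hmem
  refine ⟨geo k s, h, ?_⟩
  have e1 : dist z (geo k s) = s := by
    conv_lhs => rw [← hk0]
    rw [dist_geo, zero_sub, abs_neg, abs_of_nonneg hs.1]
  have e2 : dist (geo k s) w = dist z w - s := by
    conv_lhs => rw [← hk1]
    rw [dist_geo, abs_of_nonpos (by linarith [hs.2])]
    ring
  rw [e1, e2]
  ring

/-- Circles about two distinct points of the imaginary axis that both pass through `vert s` touch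
there. Subtracting the two equations cancels `a.re ^ 2 + a.im ^ 2` and determines `a.im`. -/
lemma eq_vert_of_cosh_dist {a : ℍ} {s τ : ℝ} (hτ : τ ≠ 0) (h1 : cosh (dist a I) = cosh s)
    (h2 : cosh (dist a (vert τ)) = cosh (s - τ)) : a = vert s := by
  rw [dist_comm, ← vert_zero, cosh_dist_vert, Real.cosh_eq] at h1
  rw [dist_comm, cosh_dist_vert, Real.cosh_eq] at h2
  have ha := a.im_pos
  have hs := Real.exp_pos s
  have ht := Real.exp_pos τ
  rw [neg_sub, Real.exp_sub, Real.exp_sub, Real.exp_neg] at h2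
  rw [Real.exp_neg s] at h1
  simp only [Real.exp_zero, neg_zero, one_mul] at h1
  set S := exp s
  set T := exp τ
  have hT : T ^ 2 - 1 ≠ 0 := by
    intro h
    have : T = 1 := by nlinarith
    exact hτ (by simpa [T] using this)
  have e1 : S * (1 + a.re ^ 2 + a.im ^ 2) = a.im * (S ^ 2 + 1) := by
    field_simp at h1
    linarith
  have e2 : S * (T ^ 2 + a.re ^ 2 + a.im ^ 2) = a.im * (S ^ 2 + T ^ 2) := by
    field_simp at h2
    linarith
  have e3 : (a.im - S) * (T ^ 2 - 1) = 0 := by linarith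
  have e4 : a.im = S := by
    have := (mul_eq_zero.mp e3).resolve_right hT
    linarith
  have e5 : a.re = 0 := by
    rw [e4] at e1
    have : S * a.re ^ 2 = 0 := by linarith
    have := (mul_eq_zero.mp this).resolve_left hs.ne'
    exact pow_eq_zero_iff two_ne_zero |>.mp this
  apply UpperHalfPlane.ext
  exact Complex.ext e5 e4

/-- Rays are geodesics. -/
lemma IsRay.exists_geo {r : ℝ≥0 → ℍ} (hr : IsRay r) : ∃ θ, ∀ s, r s = geo (rot θ) s := by
  obtain ⟨θ, h⟩ := exists_rot_geo (r 1)
  have hd : ∀ s t : ℝ≥0, dist (r s) (r t) = |(s : ℝ) - t| := fun s t => by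
    rw [hr.isometry.dist_eq, NNReal.dist_eq]
  have h1 : dist I (r 1) = 1 := by
    rw [← hr.start, hd]; simp
  rw [h1] at h
  refine ⟨θ, fun s => ?_⟩
  have hk : (rot θ)⁻¹ • r s = vert s := by
    refine eq_vert_of_cosh_dist (τ := 1) one_ne_zero ?_ ?_
    · rw [← dist_smul (rot θ), smul_inv_smul, rot_smul_I, ← hr.start, hd]
      simp
    · rw [← dist_smul (rot θ), smul_inv_smul]
      change cosh (dist (r s) (geo (rot θ) 1)) = _
      rw [h, hd, Real.cosh_abs]; simp
  rw [geo, ← hk, smul_inv_smul]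

lemma isRay_geo (θ : ℝ) : IsRay fun s : ℝ≥0 => geo (rot θ) s where
  isometry := by
    refine Isometry.of_dist_eq fun s t => ?_
    rw [dist_geo, NNReal.dist_eq]
  start := by simp [geo_zero, rot_smul_I]

/-- Among three points with the same distances to two distinct points two coincide. -/
lemma eq_of_equidistant {z w o₁ o₂ o₃ : ℍ} (hzw : z ≠ w)
    (h12 : dist z o₁ = dist z o₂) (h13 : dist z o₁ = dist z o₃)
    (h12' : dist w o₁ = dist w o₂) (h13' : dist w o₁ = dist w o₃) (h : o₁ ≠ o₂) :
    o₃ = o₁ ∨ o₃ = o₂ := by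
  obtain ⟨k, rfl, hk1⟩ := exists_geo z w
  set d := dist (geo k 0) w
  have hd : d ≠ 0 := dist_ne_zero.mpr hzw
  rw [← hk1] at h12' h13'
  set p₁ := k⁻¹ • o₁ with hp₁
  set p₂ := k⁻¹ • o₂ with hp₂
  set p₃ := k⁻¹ • o₃ with hp₃
  have key : ∀ (s : ℝ) (o : ℍ), dist (geo k s) o = dist (vert s) (k⁻¹ • o) := fun s o => by
    rw [← dist_smul k⁻¹, geo, inv_smul_smul]
  rw [key, key] at h12 h12' h13 h13'
  have main : ∀ p q : ℍ, dist (vert 0) p = dist (vert 0) q → dist (vert d) p = dist (vert d) q →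
      p.im = q.im ∧ p.re ^ 2 = q.re ^ 2 := by
    intro p q h1 h2
    have h1 := congrArg cosh h1
    have h2 := congrArg cosh h2
    rw [cosh_dist_vert, cosh_dist_vert] at h1 h2
    simp only [Real.exp_zero, neg_zero, one_mul] at h1
    have ha := p.im_pos
    have hb := q.im_pos
    have hT := Real.exp_pos d
    rw [Real.exp_neg] at h2
    set T := exp d
    have hT1 : T ^ 2 - 1 ≠ 0 := by
      intro h
      have : T = 1 := by nlinarith
      exact hd (by simpa [T] using this)
    have e1 : q.im * (1 + p.re ^ 2 + p.im ^ 2) = p.im * (1 + q.re ^ 2 + q.im ^ 2) := by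
      field_simp at h1
      linarith
    have e2 : q.im * (T ^ 2 + p.re ^ 2 + p.im ^ 2) = p.im * (T ^ 2 + q.re ^ 2 + q.im ^ 2) := by
      field_simp at h2
      linarith
    have e3 : (p.im - q.im) * (T ^ 2 - 1) = 0 := by linarith
    have e4 : p.im = q.im := by
      have := (mul_eq_zero.mp e3).resolve_right hT1
      linarith
    refine ⟨e4, ?_⟩
    rw [← e4] at e1
    have := mul_left_cancel₀ ha.ne' e1
    linarith
  obtain ⟨a1, a2⟩ := main p₁ p₂ h12 h12'
  obtain ⟨b1, b2⟩ := main p₁ p₃ h13 h13'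
  have hext : ∀ p q : ℍ, p.re = q.re → p.im = q.im → p = q := fun p q h1 h2 =>
    UpperHalfPlane.ext (Complex.ext h1 h2)
  have inj : ∀ o o' : ℍ, k⁻¹ • o = k⁻¹ • o' → o = o' := fun o o' h => smul_left_cancel _ h
  rcases sq_eq_sq_iff_eq_or_eq_neg.mp a2 with c | c
  · exact absurd (inj _ _ (hext _ _ c a1)) h
  rcases sq_eq_sq_iff_eq_or_eq_neg.mp b2 with c' | c'
  · exact Or.inl (inj _ _ (hext _ _ c'.symm b1.symm))
  · refine Or.inr (inj _ _ (hext _ _ ?_ (b1.symm.trans a1)))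
    linarith

/-! ### Letters and words -/

section Words

variable {u v : ℕ} {G : Subgroup SL(2, ℝ)} {h : Fin u → SL(2, ℝ)} {γ : Fin v → SL(2, ℝ)}

/-- The inverse letter. -/
def Letter.inv (l : Letter u v) : Letter u v := (l.1, !l.2)

@[simp] lemma Letter.inv_inv (l : Letter u v) : l.inv.inv = l := by simp [Letter.inv]

lemma Letter.inv_ne (l : Letter u v) : l.inv ≠ l := by
  intro hl
  have := congrArg Prod.snd hl
  simp [Letter.inv] at this

lemma Letter.inv_injective : Function.Injective (Letter.inv : Letter u v → Letter u v) :=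
  fun a b hab => by rw [← a.inv_inv, hab, b.inv_inv]

lemma Letter.val_inv (l : Letter u v) : l.inv.val h γ = (l.val h γ)⁻¹ := by
  rcases l with ⟨a, b⟩
  cases b <;> simp [Letter.inv, Letter.val]

/-- The group element denoted by a word. -/
def wordProd (h : Fin u → SL(2, ℝ)) (γ : Fin v → SL(2, ℝ)) (L : List (Letter u v)) : SL(2, ℝ) :=
  (L.map (Letter.val h γ)).prod

@[simp] lemma wordProd_nil : wordProd h γ [] = 1 := rfl

@[simp] lemma wordProd_cons (l : Letter u v) (L : List (Letter u v)) :
    wordProd h γ (l :: L) = l.val h γ * wordProd h γ L := by simp [wordProd]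

lemma wordProd_append (L L' : List (Letter u v)) :
    wordProd h γ (L ++ L') = wordProd h γ L * wordProd h γ L' := by simp [wordProd]

lemma wordProd_eq_lift (L : List (Letter u v)) :
    wordProd h γ L = FreeGroup.lift (Sum.elim h γ) (FreeGroup.mk L) := by
  rw [FreeGroup.lift_mk, wordProd]
  congr 1
  refine List.map_congr_left fun l _ => ?_
  rcases l with ⟨a, b⟩
  cases b <;> simp [Letter.val]

lemma isReduced_cons_cons {a b : Letter u v} {L : List (Letter u v)} :
    FreeGroup.IsReduced (a :: b :: L) ↔ b ≠ a.inv ∧ FreeGroup.IsReduced (b :: L) := by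
  rw [FreeGroup.isReduced_cons_cons]
  refine and_congr_left fun _ => ?_
  rcases a with ⟨a, s⟩
  rcases b with ⟨b, t⟩
  simp only [Letter.inv, ne_eq, Prod.mk.injEq, not_and]
  constructor
  · rintro h1 rfl h2
    have := h1 rfl
    subst this; simp at h2
  · rintro h1 rfl
    have := h1 rfl
    cases s <;> cases t <;> simp_all

lemma isReduced_append_singleton {L : List (Letter u v)} {a b : Letter u v}
    (hL : FreeGroup.IsReduced (L ++ [a])) (hab : b ≠ a.inv) :
    FreeGroup.IsReduced (L ++ [a] ++ [b]) :=
  hL.append_overlap (isReduced_cons_cons.mpr ⟨hab, FreeGroup.IsReduced.singleton⟩) (by simp)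

namespace IsFreeFuchsianGroup

variable (hG : IsFreeFuchsianGroup G h γ)
include hG

lemma wordProd_mem (L : List (Letter u v)) : wordProd h γ L ∈ G := by
  rw [← hG.generates, wordProd_eq_lift]
  exact ⟨_, rfl⟩

lemma val_mem (l : Letter u v) : l.val h γ ∈ G := by
  simpa using hG.wordProd_mem [l]

lemma wordProd_injOn {L L' : List (Letter u v)} (hL : FreeGroup.IsReduced L)
    (hL' : FreeGroup.IsReduced L') (heq : wordProd h γ L = wordProd h γ L') : L = L' := by
  rw [wordProd_eq_lift, wordProd_eq_lift] at heq
  have := FreeGroup.reduce.sound (hG.free heq)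
  rwa [hL.reduce_eq, hL'.reduce_eq] at this

lemma exists_word {g : SL(2, ℝ)} (hg : g ∈ G) :
    ∃ L, FreeGroup.IsReduced L ∧ wordProd h γ L = g := by
  rw [← hG.generates] at hg
  obtain ⟨x, rfl⟩ := hg
  exact ⟨x.toWord, FreeGroup.isReduced_toWord, by rw [wordProd_eq_lift, FreeGroup.mk_toWord]⟩

lemma val_injective : Function.Injective (Letter.val h γ) := fun a b hab => by
  have := hG.wordProd_injOn (L := [a]) (L' := [b]) FreeGroup.IsReduced.singleton
    FreeGroup.IsReduced.singleton (by simpa using hab)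
  simpa using this

lemma val_ne_one (l : Letter u v) : l.val h γ ≠ 1 := fun hl => by
  have := hG.wordProd_injOn (L := [l]) (L' := []) FreeGroup.IsReduced.singleton
    FreeGroup.IsReduced.nil (by simpa using hl)
  simp at this

lemma zpow_eq_one {g : SL(2, ℝ)} (hg : g ∈ G) {n : ℤ} (hn : n ≠ 0) (h1 : g ^ n = 1) : g = 1 := by
  rw [← hG.generates] at hg
  obtain ⟨x, rfl⟩ := hg
  rw [← map_zpow, ← map_one (FreeGroup.lift (Sum.elim h γ))] at h1
  have := hG.free h1
  rw [IsMulTorsionFree.zpow_eq_one_iff_left hn] at this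
  rw [this, map_one]

/-- The orbit map `g ↦ g • I` is proper on `SL(2, ℝ)`, and a discrete subgroup is closed and meets a
compact set in finitely many points. -/
lemma finite_ball (R : ℝ) : {g | g ∈ G ∧ dist (g • I) I ≤ R}.Finite := by
  have hd : DiscreteTopology G := hG.discrete.to_subtype
  have hcl : IsClosed (G : Set SL(2, ℝ)) := Subgroup.isClosed_of_discrete
  have hK : IsCompact ((fun g : SL(2, ℝ) => g • I) ⁻¹' Metric.closedBall I R) :=
    UpperHalfPlane.isProperMap_smul_I.isCompact_preimage (isCompact_closedBall _ _)
  have := (hK.inter_left hcl).finite (hG.discrete.mono inter_subset_left)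
  refine this.subset fun g hg => ⟨hg.1, ?_⟩
  simpa using hg.2

/-- All powers of a stabilising element lie in one finite ball, so it has finite order; free groups
are torsion free. -/
lemma eq_one_of_smul_I {g : SL(2, ℝ)} (hg : g ∈ G) (h1 : g • I = I) : g = 1 := by
  have hfin := hG.finite_ball 0
  have hmaps : ∀ n : ℕ, g ^ n ∈ {g | g ∈ G ∧ dist (g • I) I ≤ 0} := fun n => by
    refine ⟨pow_mem hg n, ?_⟩
    have : ∀ n : ℕ, g ^ n • I = I := fun n => by
      induction n with
      | zero => simp
      | succ n ih => rw [pow_succ, mul_smul, h1, ih]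
    rw [this, dist_self]
  obtain ⟨m, n, hmn, heq⟩ : ∃ m n : ℕ, m < n ∧ g ^ m = g ^ n := by
    by_contra! hcon
    have hinj : Function.Injective fun n : ℕ => g ^ n := by
      intro a b hab
      rcases lt_trichotomy a b with hlt | heq | hlt
      · exact absurd hab (hcon _ _ hlt)
      · exact heq
      · exact absurd hab.symm (hcon _ _ hlt)
    exact (Set.infinite_of_injective_forall_mem hinj hmaps) hfin
  refine hG.zpow_eq_one hg (n := ((n - m : ℕ) : ℤ)) (by omega) ?_
  rw [zpow_natCast, ← mul_left_cancel_iff (a := g ^ m), ← pow_add, mul_one, heq]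
  congr 1; omega

lemma smul_I_inj {g g' : SL(2, ℝ)} (hg : g ∈ G) (hg' : g' ∈ G) (heq : g • I = g' • I) : g = g' := by
  have := hG.eq_one_of_smul_I (mul_mem (inv_mem hg') hg) (by rw [mul_smul, heq, inv_smul_smul])
  rwa [inv_mul_eq_one, eq_comm] at this

lemma gap_I_pos {g : SL(2, ℝ)} (hg : g ∈ G) (h1 : g ≠ 1) : 0 < gap (g • I) I I := by
  rw [gap_pos_iff, dist_self, dist_pos]
  intro h2
  exact h1 (hG.eq_one_of_smul_I hg h2.symm)

omit hG in
lemma mem_dirichletDomain {z : ℍ} :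
    z ∈ dirichletDomain G ↔ ∀ g ∈ G, 0 ≤ gap (g • I) I z := by
  simp only [gap_nonneg_iff]; rfl

omit hG in
lemma I_mem_dirichletDomain : I ∈ dirichletDomain G := fun g _ => by simp

omit hG in
lemma mem_smul_dirichletDomain {g : SL(2, ℝ)} (hg : g ∈ G) {z : ℍ} :
    z ∈ g • dirichletDomain G ↔ ∀ g' ∈ G, dist z (g • I) ≤ dist z (g' • I) := by
  rw [Set.mem_smul_set_iff_inv_smul_mem]
  have key : ∀ w : ℍ, dist (g⁻¹ • z) w = dist z (g • w) := fun w => by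
    rw [← dist_smul g, smul_inv_smul]
  constructor
  · intro hz g' hg'
    have := hz (g⁻¹ * g') (mul_mem (inv_mem hg) hg')
    rwa [key, key, ← mul_smul, mul_inv_cancel_left] at this
  · intro hz g' hg'
    rw [key, key, ← mul_smul]
    exact hz _ (mul_mem hg hg')

omit hG in
lemma mem_smul_dirichletDomain_of_eq {g : SL(2, ℝ)} (hg : g ∈ G) {z : ℍ}
    (hz : z ∈ dirichletDomain G) (hd : gap (g • I) I z = 0) : z ∈ g • dirichletDomain G := by
  rw [mem_smul_dirichletDomain hg]
  intro g' hg'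
  rw [gap_eq_zero_iff.mp hd]
  exact hz g' hg'

omit hG in
lemma gap_eq_zero_of_mem {g : SL(2, ℝ)} (hg : g ∈ G) {z : ℍ}
    (hz : z ∈ dirichletDomain G) (hz' : z ∈ g • dirichletDomain G) : gap (g • I) I z = 0 := by
  rw [gap_eq_zero_iff]
  refine le_antisymm ?_ (hz g hg)
  simpa using (mem_smul_dirichletDomain hg).mp hz' 1 (one_mem _)

end IsFreeFuchsianGroup

end Words

/-! ### The Dirichlet domain is bounded by its labelled sides -/

lemma finite_quadratic_roots {a b c : ℝ} (hne : a ≠ 0 ∨ b ≠ 0) :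
    {t : ℝ | a * t ^ 2 + b * t + c = 0}.Finite := by
  open Polynomial in
  set p : ℝ[X] := C a * X ^ 2 + C b * X + C c with hp
  have hp0 : p ≠ 0 := by
    intro h0
    have h1 : p.coeff 2 = 0 := by rw [h0]; simp
    have h2 : p.coeff 1 = 0 := by rw [h0]; simp
    rw [hp] at h1 h2
    simp [Polynomial.coeff_C] at h1 h2
    rcases hne with h | h
    · exact h h1
    · exact h h2
  refine (Polynomial.finite_setOfPred_isRoot hp0).subset fun t ht => ?_
  simpa [Polynomial.IsRoot, hp] using ht

/-- Points on the same ray from `i` are proportional in the projective model. -/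
lemma geo_rot_parallel (θ s t : ℝ) :
    2 * (geo (rot θ) s).re * ((geo (rot θ) t).re ^ 2 + (geo (rot θ) t).im ^ 2 - 1) =
    2 * (geo (rot θ) t).re * ((geo (rot θ) s).re ^ 2 + (geo (rot θ) s).im ^ 2 - 1) := by
  have key : ∀ s : ℝ, ∃ a : ℝ, 2 * (geo (rot θ) s).re = Real.sin θ * Real.cos θ * a ∧
      2 * ((geo (rot θ) s).re ^ 2 + (geo (rot θ) s).im ^ 2 - 1) =
        -(Real.cos θ ^ 2 - Real.sin θ ^ 2) * a := by
    intro s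
    obtain ⟨h1, h2, h3, h4⟩ := rot_entries θ
    have hD := denomSq_pos (rot θ) (vert s)
    have hcs := Real.cos_sq_add_sin_sq θ
    rw [h3, h4] at hD
    simp only [vert_re, vert_im, mul_zero, zero_add] at hD
    refine ⟨2 * (1 - exp s ^ 2) / (Real.cos θ ^ 2 + (-Real.sin θ * exp s) ^ 2), ?_, ?_⟩
    · rw [geo, smul_re, h1, h2, h3, h4]
      simp only [vert_re, vert_im, mul_zero, zero_add]
      field_simp
      ring
    · rw [geo, smul_re, smul_im, h1, h2, h3, h4]
      simp only [vert_re, vert_im, mul_zero, zero_add]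
      generalize Real.cos θ = c at *
      generalize Real.sin θ = σ at *
      generalize exp s = E at *
      have : (σ * c + c * -σ * E ^ 2) ^ 2 + E ^ 2 =
          (c ^ 2 * E ^ 2 + σ ^ 2) * (c ^ 2 + (-σ * E) ^ 2) := by
        linear_combination (-(E ^ 2) * (c ^ 2 + σ ^ 2 + 1)) * hcs
      have hD' := hD.ne'
      rw [div_pow, div_pow, ← add_div, this]
      generalize hDD : c ^ 2 + (-σ * E) ^ 2 = D at *
      field_simp
      rw [← hDD]
      ring
  obtain ⟨a, ha, ha'⟩ := key s
  obtain ⟨b, hb, hb'⟩ := key t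
  have e1 : 2 * (2 * (geo (rot θ) s).re * ((geo (rot θ) t).re ^ 2 + (geo (rot θ) t).im ^ 2 - 1)) =
    2 * (2 * (geo (rot θ) t).re * ((geo (rot θ) s).re ^ 2 + (geo (rot θ) s).im ^ 2 - 1)) := by
    linear_combination (2 * ((geo (rot θ) t).re ^ 2 + (geo (rot θ) t).im ^ 2 - 1)) * ha -
      (2 * ((geo (rot θ) s).re ^ 2 + (geo (rot θ) s).im ^ 2 - 1)) * hb +
      Real.sin θ * Real.cos θ * a * hb' - Real.sin θ * Real.cos θ * b * ha'
  linarith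

lemma gap_geo_crossing (k : SL(2, ℝ)) {o o' : ℍ} {a b : ℝ} (hab : a ≤ b)
    (h1 : 0 ≤ gap o o' (geo k a)) (h2 : gap o o' (geo k b) ≤ 0) :
    ∃ s ∈ Icc a b, gap o o' (geo k s) = 0 := by
  have hc := (continuous_gap o o').comp (continuous_geo k)
  obtain ⟨s, hs, h⟩ := intermediate_value_Icc' hab hc.continuousOn ⟨h2, h1⟩
  exact ⟨s, hs, h⟩

namespace IsFreeFuchsianGroup

variable {u v : ℕ} {G : Subgroup SL(2, ℝ)} {h : Fin u → SL(2, ℝ)} {γ : Fin v → SL(2, ℝ)}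
variable (hG : IsFreeFuchsianGroup G h γ)
include hG

/-- The last point in the domain on the segment from `i` to a point outside. -/
lemma exists_exit {z : ℍ} {g : SL(2, ℝ)} (hg : g ∈ G) (hz : gap (g • I) I z < 0) :
    ∃ θ s, 0 < s ∧ s < dist I z ∧ geo (rot θ) (dist I z) = z ∧
      geo (rot θ) s ∈ dirichletDomain G ∧
      ∃ g' ∈ G, g' ≠ 1 ∧ gap (g' • I) I (geo (rot θ) s) = 0 := by
  obtain ⟨θ, hθ⟩ := exists_rot_geo z
  set D := dist I z with hD
  have hI : geo (rot θ) 0 = I := by rw [geo_zero, rot_smul_I]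
  set S := {g | g ∈ G ∧ gap (g • I) I z < 0} with hS
  have hfin : S.Finite := by
    refine (hG.finite_ball (2 * D)).subset fun g' hg' => ⟨hg'.1, ?_⟩
    have := gap_neg_iff.mp hg'.2
    have h2 := dist_triangle (g' • I) z I
    rw [dist_comm (g' • I) z] at h2
    rw [dist_comm z I] at this h2
    linarith
  have hS1 : ∀ g' ∈ S, g' ≠ 1 := by
    rintro g' ⟨-, hg'⟩ rfl
    simp [gap] at hg'
  have hroot : ∀ g', ∃ s, g' ∈ S → 0 < s ∧ s < D ∧ gap (g' • I) I (geo (rot θ) s) = 0 := by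
    intro g'
    by_cases hg' : g' ∈ S
    · have h0 : 0 < gap (g' • I) I (geo (rot θ) 0) := by
        rw [hI]; exact hG.gap_I_pos hg'.1 (hS1 _ hg')
      have h1 : gap (g' • I) I (geo (rot θ) D) < 0 := by rw [hθ]; exact hg'.2
      obtain ⟨s, hs, hs0⟩ := gap_geo_crossing (rot θ) (dist_nonneg) h0.le h1.le
      refine ⟨s, fun _ => ⟨lt_of_le_of_ne hs.1 ?_, lt_of_le_of_ne hs.2 ?_, hs0⟩⟩
      · rintro rfl; exact h0.ne' hs0
      · rintro rfl; exact h1.ne hs0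
    · exact ⟨0, fun h => absurd h hg'⟩
  choose σ hσ using hroot
  -- The exit point is on the first bisector met among the finitely many half planes violated at
  -- `z`. All other half planes contain both ends of the segment, hence the point as well, by
  -- convexity.
  obtain ⟨g₀, hg₀, hmin⟩ := Set.exists_min_image S σ hfin ⟨g, hg, hz⟩
  obtain ⟨a1, a2, a3⟩ := hσ g₀ hg₀
  refine ⟨θ, σ g₀, a1, a2, hθ, ?_, g₀, hg₀.1, hS1 _ hg₀, a3⟩
  rw [mem_dirichletDomain]
  intro g' hg'
  have h0 : 0 ≤ gap (g' • I) I (geo (rot θ) 0) := by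
    rw [hI, gap_nonneg_iff]; simp
  by_cases hgS : g' ∈ S
  · exact gap_geo_between (rot θ) _ _ a1.le (hmin _ hgS) h0 (hσ g' hgS).2.2.ge
  · refine gap_geo_between (rot θ) _ _ a1.le a2.le h0 ?_
    rw [hθ]
    by_contra! hcon
    exact hgS ⟨hg', hcon⟩

/-- The domain is the intersection of the half planes of the generators. -/
lemma mem_dirichletDomain_of_letters {z : ℍ}
    (hz : ∀ l : Letter u v, 0 ≤ gap (l.val h γ • I) I z) : z ∈ dirichletDomain G := by
  rw [mem_dirichletDomain]
  -- If the letters did not suffice, a whole open set of points would see `i` along segments leaving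
  -- the domain through corners. There are only finitely many corners in a ball, hence only finitely
  -- many such directions.
  by_contra! hcon
  obtain ⟨g, hg, hgz⟩ := hcon
  -- move into the interior of the half planes
  obtain ⟨z₁, hz₁, hgz₁⟩ : ∃ z₁ : ℍ, (∀ l : Letter u v, 0 < gap (l.val h γ • I) I z₁) ∧
      gap (g • I) I z₁ < 0 := by
    obtain ⟨θ, hθ⟩ := exists_rot_geo z
    have hI : geo (rot θ) 0 = I := by rw [geo_zero, rot_smul_I]
    have hD : 0 < dist I z := by
      rw [dist_pos]
      rintro rfl
      rw [gap_neg_iff] at hgz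
      simp at hgz
      exact absurd hgz dist_nonneg.not_gt
    have hc : Continuous fun s => gap (g • I) I (geo (rot θ) s) :=
      (continuous_gap _ _).comp (continuous_geo _)
    have hev : ∀ᶠ s in 𝓝 (dist I z), gap (g • I) I (geo (rot θ) s) < 0 :=
      hc.continuousAt.eventually_lt continuousAt_const (by rwa [hθ])
    have hev2 : ∀ᶠ s in 𝓝[<] (dist I z), gap (g • I) I (geo (rot θ) s) < 0 ∧ 0 < s ∧ s < dist I z :=
      (hev.filter_mono nhdsWithin_le_nhds).and
        (((lt_mem_nhds hD).filter_mono nhdsWithin_le_nhds).and self_mem_nhdsWithin)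
    obtain ⟨s, h1, h2, h3⟩ := hev2.exists
    refine ⟨geo (rot θ) s, fun l => ?_, h1⟩
    refine gap_geo_between_pos (rot θ) _ _ h2.le h3 ?_ ?_
    · rw [hI]; exact hG.gap_I_pos (hG.val_mem l) (hG.val_ne_one l)
    · rw [hθ]; exact hz l
  set R := dist I z₁ + 1 with hR
  set U : Set ℍ := {z | (∀ l : Letter u v, 0 < gap (l.val h γ • I) I z) ∧
      gap (g • I) I z < 0 ∧ dist I z < R} with hU
  have hUopen : IsOpen U := by
    refine IsOpen.inter ?_ (IsOpen.inter ?_ ?_)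
    · have : {z : ℍ | ∀ l : Letter u v, 0 < gap (l.val h γ • I) I z} =
          ⋂ l : Letter u v, {z | 0 < gap (l.val h γ • I) I z} := by ext; simp
      have hop : IsOpen {z : ℍ | ∀ l : Letter u v, 0 < gap (l.val h γ • I) I z} := by
        rw [this]
        exact isOpen_iInter_of_finite fun l => isOpen_lt continuous_const (continuous_gap _ _)
      exact hop
    · exact isOpen_lt (continuous_gap _ _) continuous_const
    · exact isOpen_lt (continuous_const.dist continuous_id) continuous_const
  have hz₁U : z₁ ∈ U := ⟨hz₁, hgz₁, by rw [hR]; linarith⟩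
  -- the possible exit points
  set X : Set ℍ := ⋃ g' ∈ {g' | g' ∈ G ∧ dist (g' • I) I ≤ 2 * R},
    {m | m ∈ dirichletDomain G ∩ g' • dirichletDomain G ∧
      (dirichletDomain G ∩ g' • dirichletDomain G).Subsingleton} with hX
  have hXfin : X.Finite := by
    refine (hG.finite_ball (2 * R)).biUnion fun g' _ => ?_
    by_cases hs : (dirichletDomain G ∩ g' • dirichletDomain G).Subsingleton
    · exact hs.finite.subset fun m hm => hm.1
    · convert Set.finite_empty
      ext m
      simp [hs]
  -- The letter inequalities are strict along the segment, so the exit is into a tile `g' F` with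
  -- `g'` not a letter; by `sides` such a tile meets the domain in at most one point. The equation
  -- says that `m` and `z'` lie on one geodesic through `i`.
  have hexit : ∀ z' ∈ U, ∃ m ∈ X, m ≠ I ∧
      2 * m.re * (z'.re ^ 2 + z'.im ^ 2 - 1) = 2 * z'.re * (m.re ^ 2 + m.im ^ 2 - 1) := by
    rintro z' ⟨hl, hg', hR'⟩
    obtain ⟨θ, s, hs0, hsD, hθ, hm, g', hgG, hg1, hg0⟩ := hG.exists_exit hg hg'
    have hI : geo (rot θ) 0 = I := by rw [geo_zero, rot_smul_I]
    have hmg := mem_smul_dirichletDomain_of_eq hgG hm hg0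
    have hdist : dist (geo (rot θ) s) I = s := by
      rw [← hI, dist_geo, sub_zero, abs_of_pos hs0]
    refine ⟨geo (rot θ) s, ?_, ?_, ?_⟩
    · simp only [hX, mem_iUnion]
      refine ⟨g', ⟨hgG, ?_⟩, ⟨hm, hmg⟩, ?_⟩
      · have h2 := dist_triangle (g' • I) (geo (rot θ) s) I
        rw [dist_comm (g' • I) (geo _ _), gap_eq_zero_iff.mp hg0, hdist] at h2
        linarith
      · rw [← Set.not_nontrivial_iff, hG.sides g' hgG hg1]
        rintro ⟨l, rfl⟩
        have : 0 < gap (l.val h γ • I) I (geo (rot θ) s) := by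
          refine gap_geo_between_pos (rot θ) _ _ hs0.le hsD ?_ ?_
          · rw [hI]; exact hG.gap_I_pos hgG hg1
          · rw [hθ]; exact (hl l).le
        exact this.ne' hg0
    · intro hcon
      rw [hcon, dist_self] at hdist
      exact hs0.ne hdist
    · have := geo_rot_parallel θ s (dist I z')
      rwa [hθ] at this
  -- infinitely many directions
  have hcont : Continuous fun t : ℝ => t +ᵥ z₁ := by
    rw [Metric.continuous_iff]
    intro b ε hε
    have hy := z₁.im_pos
    have hc2 : Continuous fun a : ℝ => (a - b) ^ 2 / (2 * z₁.im * z₁.im) := by fun_prop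
    have hd : ∀ a : ℝ, cosh (dist (a +ᵥ z₁) (b +ᵥ z₁)) = 1 + (a - b) ^ 2 / (2 * z₁.im * z₁.im) := by
      intro a
      rw [UpperHalfPlane.cosh_dist']
      simp only [UpperHalfPlane.vadd_re, UpperHalfPlane.vadd_im]
      field_simp
      ring
    have h1 : ∀ᶠ a in 𝓝 b, (a - b) ^ 2 / (2 * z₁.im * z₁.im) < cosh ε - 1 := by
      refine hc2.continuousAt.eventually_lt continuousAt_const ?_
      simp
      exact hε.ne'
    obtain ⟨δ, hδ, hball⟩ := Metric.eventually_nhds_iff.mp h1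
    refine ⟨δ, hδ, fun a ha => ?_⟩
    have := hball ha
    rw [← abs_of_nonneg (dist_nonneg (x := a +ᵥ z₁)), ← abs_of_pos hε, ← Real.cosh_lt_cosh, hd]
    linarith
  have hpre : (fun t : ℝ => t +ᵥ z₁) ⁻¹' U ∈ 𝓝 (0 : ℝ) :=
    hcont.continuousAt.preimage_mem_nhds (hUopen.mem_nhds (by simpa using hz₁U))
  have hinf : ((fun t : ℝ => t +ᵥ z₁) ⁻¹' U).Infinite := infinite_of_mem_nhds 0 hpre
  refine hinf ?_
  -- For fixed `m ≠ i`, alignment of `t +ᵥ z₁` with `m` and `i` is a nontrivial quadratic equation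
  -- in `t`.
  refine (hXfin.biUnion (t := fun m => {t : ℝ | m ≠ I ∧
    2 * m.re * ((t +ᵥ z₁).re ^ 2 + (t +ᵥ z₁).im ^ 2 - 1) =
      2 * (t +ᵥ z₁).re * (m.re ^ 2 + m.im ^ 2 - 1)}) fun m _ => ?_).subset ?_
  · by_cases hm : m = I
    · simp [hm]
    · have hne : 2 * m.re ≠ 0 ∨ -2 * (m.re ^ 2 + m.im ^ 2 - 1) ≠ 0 := by
        by_contra! hcon
        apply hm
        have h1 : m.re = 0 := by linarith [hcon.1]
        have h2 : m.im ^ 2 = 1 := by have := hcon.2; rw [h1] at this; linarith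
        have h3 : m.im = 1 := by nlinarith [m.im_pos]
        exact UpperHalfPlane.ext (Complex.ext (by simpa using h1) (by simpa using h3))
      have := (finite_quadratic_roots (c := 2 * m.re * (z₁.im ^ 2 - 1)) hne).preimage
        (f := fun t : ℝ => t + z₁.re) (fun a _ b _ hab => by simpa using hab)
      refine this.subset fun t ht => ?_
      have h2 := ht.2
      simp only [UpperHalfPlane.vadd_re, UpperHalfPlane.vadd_im] at h2
      simp only [mem_preimage, mem_ofPred_eq]
      linear_combination h2
  · intro t ht
    obtain ⟨m, hm, hmI, heq⟩ := hexit _ ht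
    exact mem_biUnion hm ⟨hmI, heq⟩

end IsFreeFuchsianGroup

/-! ### Absence of vertices and disjointness of the half planes -/

namespace IsFreeFuchsianGroup

variable {u v : ℕ} {G : Subgroup SL(2, ℝ)} {h : Fin u → SL(2, ℝ)} {γ : Fin v → SL(2, ℝ)}
variable (hG : IsFreeFuchsianGroup G h γ)
include hG

/-- A point of the domain in two other tiles lies in the tiles of two letters. -/
lemma exists_two_letters {z : ℍ} (hz : z ∈ dirichletDomain G) {a b : SL(2, ℝ)} (ha : a ∈ G)
    (hb : b ∈ G) (ha1 : a ≠ 1) (hb1 : b ≠ 1) (hab : a ≠ b) (hza : gap (a • I) I z = 0)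
    (hzb : gap (b • I) I z = 0) :
    ∃ l l' : Letter u v, l ≠ l' ∧ gap (l.val h γ • I) I z = 0 ∧ gap (l'.val h γ • I) I z = 0 := by
  have hzG := mem_dirichletDomain.mp hz
  have hnear : ∀ (P : Letter u v → Prop) (k : SL(2, ℝ)) (s₀ : ℝ), geo k s₀ = z →
      (∀ l, P l → 0 < gap (l.val h γ • I) I z) →
      ∀ᶠ s in 𝓝 s₀, ∀ l, P l → 0 < gap (l.val h γ • I) I (geo k s) := by
    intro P k s₀ hk hP
    rw [eventually_all]
    intro l
    by_cases hl : P l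
    · have hc : Continuous fun s => gap (l.val h γ • I) I (geo k s) :=
        (continuous_gap _ _).comp (continuous_geo _)
      filter_upwards [continuousAt_const.eventually_lt hc.continuousAt
        (by rw [hk]; exact hP l hl)] with s hs _
      exact hs
    · exact Eventually.of_forall fun s h => absurd h hl
  -- If no letter had its bisector through `z`, the domain would continue beyond `z` on the ray from
  -- `i`, where the inequality of `a` already fails.
  obtain ⟨l, hl⟩ : ∃ l : Letter u v, gap (l.val h γ • I) I z = 0 := by
    by_contra! hcon
    obtain ⟨θ, hθ⟩ := exists_rot_geo z
    have hI : geo (rot θ) 0 = I := by rw [geo_zero, rot_smul_I]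
    have hD : 0 < dist I z := by
      rw [dist_pos]
      rintro rfl
      exact (hG.gap_I_pos ha ha1).ne' hza
    have hev := hnear (fun _ => True) _ _ hθ fun l _ =>
      lt_of_le_of_ne (hzG _ (hG.val_mem l)) (hcon l).symm
    have hev2 : ∀ᶠ s in 𝓝[>] (dist I z), (∀ l : Letter u v, True →
        0 < gap (l.val h γ • I) I (geo (rot θ) s)) ∧ dist I z < s :=
      (hev.filter_mono nhdsWithin_le_nhds).and self_mem_nhdsWithin
    obtain ⟨s, h1, h2⟩ := hev2.exists
    have hF := hG.mem_dirichletDomain_of_letters fun l => (h1 l trivial).le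
    refine absurd (mem_dirichletDomain.mp hF a ha) (not_le.mpr ?_)
    refine gap_geo_neg_of_pos (rot θ) _ _ hD h2 ?_ ?_
    · rw [hI]; exact hG.gap_I_pos ha ha1
    · rwa [hθ]
  by_contra! hcon
  obtain ⟨g, hg, hg1, hgl, hgz⟩ : ∃ g ∈ G, g ≠ 1 ∧ g ≠ l.val h γ ∧ gap (g • I) I z = 0 := by
    by_cases hal : a = l.val h γ
    · exact ⟨b, hb, hb1, fun hbl => hab (hal.trans hbl.symm), hzb⟩
    · exact ⟨a, ha, ha1, hal, hza⟩
  have hlG := hG.val_mem l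
  have hnt := (hG.sides _ hlG (hG.val_ne_one l)).mpr ⟨l, rfl⟩
  -- If `l` were the only letter at `z`, the side of `l` could be prolonged from `q` slightly beyond
  -- `z` inside the domain. But the bisector of `g` crosses it at `z`; if it contained `q` too, `g
  -- i` would be `i` or `l i`.
  obtain ⟨q, ⟨hqF, hql⟩, hqz⟩ := hnt.exists_ne z
  have hql0 := gap_eq_zero_of_mem hlG hqF hql
  obtain ⟨k, hk0, hkd⟩ := exists_geo z q
  have hd : 0 < dist z q := dist_pos.mpr hqz.symm
  have hline : ∀ s, gap (l.val h γ • I) I (geo k s) = 0 :=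
    gap_geo_eq_zero k _ _ hd.ne (by rwa [hk0]) (by rwa [hkd])
  rcases (mem_dirichletDomain.mp hqF g hg).eq_or_lt with hq0 | hq0
  · have := eq_of_equidistant (o₁ := I) (o₂ := l.val h γ • I) (o₃ := g • I) hqz.symm
      (gap_eq_zero_iff.mp hl).symm (gap_eq_zero_iff.mp hgz).symm
      (gap_eq_zero_iff.mp hql0).symm (gap_eq_zero_iff.mp hq0.symm).symm
      (fun h1 => hG.val_ne_one l (hG.eq_one_of_smul_I hlG h1.symm))
    rcases this with h1 | h1
    · exact hg1 (hG.eq_one_of_smul_I hg h1)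
    · exact hgl (hG.smul_I_inj hg hlG h1)
  · have hev := hnear (fun l' => l' ≠ l) k 0 hk0 fun l' hl' =>
      lt_of_le_of_ne (hzG _ (hG.val_mem l')) (hcon l l' hl'.symm hl).symm
    have hev2 : ∀ᶠ s in 𝓝[<] (0 : ℝ), (∀ l' : Letter u v, l' ≠ l →
        0 < gap (l'.val h γ • I) I (geo k s)) ∧ s < 0 :=
      (hev.filter_mono nhdsWithin_le_nhds).and self_mem_nhdsWithin
    obtain ⟨s, h1, h2⟩ := hev2.exists
    have hF : geo k s ∈ dirichletDomain G := hG.mem_dirichletDomain_of_letters fun l' => by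
      by_cases hl' : l' = l
      · rw [hl', hline]
      · exact (h1 l' hl').le
    refine absurd (mem_dirichletDomain.mp hF g hg) (not_le.mpr ?_)
    refine gap_geo_neg_of_pos' k _ _ hd h2 ?_ ?_
    · rwa [hkd]
    · rwa [hk0]

/-- There are no vertices: no point lies in three tiles. -/
lemma not_mem_three_tiles {z : ℍ} (hz : z ∈ dirichletDomain G) {a b : SL(2, ℝ)} (ha : a ∈ G)
    (hb : b ∈ G) (ha1 : a ≠ 1) (hb1 : b ≠ 1) (hab : a ≠ b) (hza : gap (a • I) I z = 0) :
    gap (b • I) I z ≠ 0 := by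
  intro hzb
  set S : Set SL(2, ℝ) := {g | g ∈ G ∧ z ∈ g • dirichletDomain G} with hS
  have hfin : S.Finite := by
    refine (hG.finite_ball (2 * dist z I)).subset fun g hg => ⟨hg.1, ?_⟩
    have h1 := (mem_smul_dirichletDomain hg.1).mp hg.2 1 (one_mem _)
    rw [one_smul] at h1
    have h2 := dist_triangle (g • I) z I
    rw [dist_comm (g • I) z] at h2
    linarith
  have h1S : (1 : SL(2, ℝ)) ∈ S := ⟨one_mem _, by simpa using hz⟩
  have haS : a ∈ S := ⟨ha, mem_smul_dirichletDomain_of_eq ha hz hza⟩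
  have hbS : b ∈ S := ⟨hb, mem_smul_dirichletDomain_of_eq hb hz hzb⟩
  -- every element has two neighbours
  have hnbr : ∀ g ∈ S, ∃ l l' : Letter u v, l ≠ l' ∧ g * l.val h γ ∈ S ∧ g * l'.val h γ ∈ S := by
    rintro g ⟨hgG, hgz⟩
    have hgz' : g⁻¹ • z ∈ dirichletDomain G := by rwa [← Set.mem_smul_set_iff_inv_smul_mem]
    have key : ∀ c ∈ S, gap ((g⁻¹ * c) • I) I (g⁻¹ • z) = 0 := by
      rintro c ⟨hcG, hcz⟩
      have : gap ((g⁻¹ * c) • I) I (g⁻¹ • z) = gap (c • I) (g • I) z := by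
        rw [← gap_smul g, smul_inv_smul, ← mul_smul, mul_inv_cancel_left]
      rw [this, gap_eq_zero_iff]
      exact le_antisymm ((mem_smul_dirichletDomain hcG).mp hcz g hgG)
        ((mem_smul_dirichletDomain hgG).mp hgz c hcG)
    have hthree : ∃ c ∈ S, ∃ d ∈ S, c ≠ g ∧ d ≠ g ∧ c ≠ d := by
      by_cases h1 : g = 1
      · exact ⟨a, haS, b, hbS, by rwa [h1], by rwa [h1], hab⟩
      · by_cases h2 : g = a
        · exact ⟨1, h1S, b, hbS, Ne.symm h1, by rw [h2]; exact hab.symm, hb1.symm⟩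
        · exact ⟨1, h1S, a, haS, Ne.symm h1, Ne.symm h2, ha1.symm⟩
    obtain ⟨c, hc, d, hd, hcg, hdg, hcd⟩ := hthree
    obtain ⟨l, l', hll, h1, h2⟩ := hG.exists_two_letters hgz' (mul_mem (inv_mem hgG) hc.1)
      (mul_mem (inv_mem hgG) hd.1) (fun h => hcg (inv_mul_eq_one.mp h).symm)
      (fun h => hdg (inv_mul_eq_one.mp h).symm) (fun h => hcd (mul_left_cancel h))
      (key c hc) (key d hd)
    have back : ∀ l : Letter u v, gap (l.val h γ • I) I (g⁻¹ • z) = 0 → g * l.val h γ ∈ S := by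
      intro l hl
      refine ⟨mul_mem hgG (hG.val_mem l), ?_⟩
      rw [mul_smul]
      have := mem_smul_dirichletDomain_of_eq (hG.val_mem l) hgz' hl
      rw [Set.mem_smul_set_iff_inv_smul_mem]
      exact this
    exact ⟨l, l', hll, back l h1, back l' h2⟩
  have hw : ∀ g, ∃ L : List (Letter u v), g ∈ G → FreeGroup.IsReduced L ∧ wordProd h γ L = g := by
    intro g
    by_cases hg : g ∈ G
    · obtain ⟨L, hL⟩ := hG.exists_word hg
      exact ⟨L, fun _ => hL⟩
    · exact ⟨[], fun h => absurd h hg⟩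
  choose W hW using hw
  -- Freeness enters here: take a tile at `z` with the longest reduced word. Of its two neighbouring
  -- letters at most one cancels with the last letter, so the other one leads to a longer word in
  -- `S`.
  obtain ⟨g, hgS, hmax⟩ := Set.exists_max_image S (fun g => (W g).length) hfin ⟨1, h1S⟩
  obtain ⟨l, l', hll, hl, hl'⟩ := hnbr g hgS
  obtain ⟨hred, hprod⟩ := hW g hgS.1
  obtain ⟨m, hm, hmred⟩ : ∃ m : Letter u v, g * m.val h γ ∈ S ∧
      FreeGroup.IsReduced (W g ++ [m]) := by
    rcases List.eq_nil_or_concat (W g) with h0 | ⟨L, c, h0⟩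
    · refine ⟨l, hl, ?_⟩
      rw [h0]
      exact FreeGroup.IsReduced.singleton
    · rw [h0] at hred ⊢
      simp only [List.concat_eq_append] at hred ⊢
      by_cases hc : l = c.inv
      · exact ⟨l', hl', isReduced_append_singleton hred (fun h => hll (hc.trans h.symm))⟩
      · exact ⟨l, hl, isReduced_append_singleton hred hc⟩
  have hlen := hmax _ hm
  obtain ⟨hr, hp⟩ := hW _ hm.1
  have : W (g * m.val h γ) = W g ++ [m] := hG.wordProd_injOn hr hmred (by
    rw [hp, wordProd_append, hprod]; simp)
  rw [this] at hlen
  simp at hlen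

/-- The bisector of a letter lies on the positive side of all the other letters. -/
lemma gap_pos_of_gap_eq_zero {l l' : Letter u v} (hll : l' ≠ l) {q : ℍ}
    (hq : gap (l.val h γ • I) I q = 0) : 0 < gap (l'.val h γ • I) I q := by
  have hlG := hG.val_mem l
  obtain ⟨q₁, hq₁F, hq₁l⟩ := ((hG.sides _ hlG (hG.val_ne_one l)).mpr ⟨l, rfl⟩).nonempty
  have hq₁ := gap_eq_zero_of_mem hlG hq₁F hq₁l
  have hpos : ∀ p ∈ dirichletDomain G, gap (l.val h γ • I) I p = 0 → ∀ m : Letter u v, m ≠ l →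
      0 < gap (m.val h γ • I) I p := by
    intro p hp hp0 m hm
    refine lt_of_le_of_ne (mem_dirichletDomain.mp hp _ (hG.val_mem m)) (Ne.symm ?_)
    exact hG.not_mem_three_tiles hp hlG (hG.val_mem m) (hG.val_ne_one l) (hG.val_ne_one m)
      (fun h => hm (hG.val_injective h).symm) hp0
  by_contra! hcon
  -- Follow the bisector of `l` from a point `q₁` of the actual side. At the first bisector of
  -- another letter one is still in the domain, and this would be a vertex.
  obtain ⟨k, hk0, hkd⟩ := exists_geo q₁ q
  have hd : 0 < dist q₁ q := by
    rw [dist_pos]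
    rintro rfl
    exact (hpos _ hq₁F hq₁ l' hll).not_ge hcon
  have hline : ∀ s, gap (l.val h γ • I) I (geo k s) = 0 :=
    gap_geo_eq_zero k _ _ hd.ne (by rwa [hk0]) (by rwa [hkd])
  set S : Set (Letter u v) := {m | m ≠ l ∧ gap (m.val h γ • I) I q ≤ 0} with hS
  have hroot : ∀ m, ∃ s, m ∈ S → 0 < s ∧ s ≤ dist q₁ q ∧
      gap (m.val h γ • I) I (geo k s) = 0 := by
    intro m
    by_cases hm : m ∈ S
    · have h0 : 0 < gap (m.val h γ • I) I (geo k 0) := by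
        rw [hk0]; exact hpos _ hq₁F hq₁ m hm.1
      obtain ⟨s, hs, hs0⟩ := gap_geo_crossing k hd.le h0.le (by rw [hkd]; exact hm.2)
      refine ⟨s, fun _ => ⟨lt_of_le_of_ne hs.1 ?_, hs.2, hs0⟩⟩
      rintro rfl; exact h0.ne' hs0
    · exact ⟨0, fun h => absurd h hm⟩
  choose σ hσ using hroot
  obtain ⟨m₀, hm₀, hmin⟩ := Set.exists_min_image S σ S.toFinite ⟨l', hll, hcon⟩
  obtain ⟨a1, a2, a3⟩ := hσ m₀ hm₀
  have hmem : geo k (σ m₀) ∈ dirichletDomain G := hG.mem_dirichletDomain_of_letters fun m => by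
    by_cases hml : m = l
    · rw [hml, hline]
    have h0 : 0 ≤ gap (m.val h γ • I) I (geo k 0) := by
      rw [hk0]; exact (hpos _ hq₁F hq₁ m hml).le
    by_cases hmS : m ∈ S
    · exact gap_geo_between k _ _ a1.le (hmin _ hmS) h0 (hσ m hmS).2.2.ge
    · refine gap_geo_between k _ _ a1.le a2 h0 ?_
      rw [hkd]
      by_contra! hneg
      exact hmS ⟨hml, hneg.le⟩
  exact (hpos _ hmem (hline _) m₀ hm₀.1).ne' a3

/-- The half planes of distinct letters are disjoint. -/
lemma gap_pos_of_gap_nonpos {l l' : Letter u v} (hll : l' ≠ l) {z : ℍ}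
    (hz : gap (l.val h γ • I) I z ≤ 0) : 0 < gap (l'.val h γ • I) I z := by
  rcases hz.eq_or_lt with h0 | h0
  · exact hG.gap_pos_of_gap_eq_zero hll h0
  by_contra! hcon
  obtain ⟨k, hk0, hkd⟩ := exists_geo z I
  have hI : ∀ m : Letter u v, 0 < gap (m.val h γ • I) I I := fun m =>
    hG.gap_I_pos (hG.val_mem m) (hG.val_ne_one m)
  -- crossing of the bisector of `l'`
  obtain ⟨t, ht, ht0⟩ : ∃ t ∈ Icc 0 (dist z I), gap (l'.val h γ • I) I (geo k t) = 0 := by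
    have hc := (continuous_gap (l'.val h γ • I) I).comp (continuous_geo k)
    obtain ⟨s, hs, h⟩ := intermediate_value_Icc (dist_nonneg (x := z) (y := I)) hc.continuousOn
      ⟨by simpa [hk0] using hcon, by simpa [hkd] using (hI l').le⟩
    exact ⟨s, hs, h⟩
  -- On the way from `z` to `i`, the half plane of `l` is left at a time `s` before the exit time
  -- `t` from that of `l'`. At time `s` the point is on the bisector of `l` and inside the half
  -- plane of `l'`, which was just excluded.
  have htl := hG.gap_pos_of_gap_eq_zero hll.symm ht0
  obtain ⟨s, hs, hs0⟩ : ∃ s ∈ Icc 0 t, gap (l.val h γ • I) I (geo k s) = 0 := by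
    have hc := (continuous_gap (l.val h γ • I) I).comp (continuous_geo k)
    obtain ⟨s, hs, h⟩ := intermediate_value_Icc ht.1 hc.continuousOn
      ⟨by simpa [hk0] using h0.le, htl.le⟩
    exact ⟨s, hs, h⟩
  have hst : s < t := lt_of_le_of_ne hs.2 (by rintro rfl; exact htl.ne' hs0)
  have htd : t < dist z I := lt_of_le_of_ne ht.2 (by
    rintro rfl; rw [hkd] at ht0; exact (hI l').ne' ht0)
  have := gap_geo_neg_of_pos' k _ _ htd hst (by rw [hkd]; exact hI l') ht0
  exact absurd (hG.gap_pos_of_gap_eq_zero hll hs0) this.not_gt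

omit hG in
lemma gap_smul_letter (l : Letter u v) (z : ℍ) :
    gap (l.val h γ • I) I (l.val h γ • z) = - gap (l.inv.val h γ • I) I z := by
  rw [← gap_smul (l.val h γ)⁻¹, inv_smul_smul, inv_smul_smul, gap_swap, Letter.val_inv]

/-- Ping-pong. -/
lemma gap_wordProd_nonpos {l : Letter u v} {L : List (Letter u v)}
    (hL : FreeGroup.IsReduced (l :: L)) {z : ℍ} (hz : z ∈ dirichletDomain G) :
    gap (l.val h γ • I) I (wordProd h γ (l :: L) • z) ≤ 0 := by
  induction L generalizing l with
  | nil =>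
    simp only [wordProd_cons, wordProd_nil, mul_one]
    rw [gap_smul_letter, neg_nonpos]
    exact mem_dirichletDomain.mp hz _ (hG.val_mem _)
  | cons l' L ih =>
    rw [isReduced_cons_cons] at hL
    rw [wordProd_cons, mul_smul, gap_smul_letter, neg_nonpos]
    exact (hG.gap_pos_of_gap_nonpos hL.1.symm (ih hL.2)).le

end IsFreeFuchsianGroup

/-! ### Ideal points, represented by vectors of the plane -/

section Vectors

lemma det_entries (g : SL(2, ℝ)) : g 0 0 * g 1 1 - g 0 1 * g 1 0 = 1 := by
  have := Matrix.det_fin_two g.val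
  rw [g.2] at this
  exact this.symm

lemma mul_entry (g h : SL(2, ℝ)) (i j : Fin 2) :
    (g * h) i j = g i 0 * h 0 j + g i 1 * h 1 j := by
  change (g.val * h.val) i j = _
  rw [Matrix.mul_apply, Fin.sum_univ_two]

lemma inv_entry (g : SL(2, ℝ)) : g⁻¹ 0 0 = g 1 1 ∧ g⁻¹ 0 1 = - g 0 1 ∧ g⁻¹ 1 0 = - g 1 0 ∧
    g⁻¹ 1 1 = g 0 0 := by
  rw [Matrix.SpecialLinearGroup.SL2_inv_expl]
  exact ⟨rfl, rfl, rfl, rfl⟩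

lemma one_entry : (1 : SL(2, ℝ)) 0 0 = 1 ∧ (1 : SL(2, ℝ)) 0 1 = 0 ∧ (1 : SL(2, ℝ)) 1 0 = 0 ∧
    (1 : SL(2, ℝ)) 1 1 = 1 := by simp

/-- The linear action on the plane. -/
def app (g : SL(2, ℝ)) (w : ℝ × ℝ) : ℝ × ℝ :=
  (g 0 0 * w.1 + g 0 1 * w.2, g 1 0 * w.1 + g 1 1 * w.2)

lemma app_mul (g h : SL(2, ℝ)) (w : ℝ × ℝ) : app (g * h) w = app g (app h w) := by
  simp only [app, mul_entry, Prod.mk.injEq]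
  constructor <;> ring

@[simp] lemma app_one (w : ℝ × ℝ) : app 1 w = w := by
  simp [app]

@[simp] lemma app_inv_app (g : SL(2, ℝ)) (w : ℝ × ℝ) : app g⁻¹ (app g w) = w := by
  rw [← app_mul, inv_mul_cancel, app_one]

@[simp] lemma app_app_inv (g : SL(2, ℝ)) (w : ℝ × ℝ) : app g (app g⁻¹ w) = w := by
  rw [← app_mul, mul_inv_cancel, app_one]

lemma app_smul (g : SL(2, ℝ)) (c : ℝ) (w : ℝ × ℝ) : app g (c • w) = c • app g w := by
  simp only [app, Prod.smul_mk, Prod.smul_fst, Prod.smul_snd, smul_eq_mul, Prod.mk.injEq]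
  constructor <;> ring

lemma app_zero (g : SL(2, ℝ)) : app g 0 = 0 := by simp [app]

lemma app_ne_zero (g : SL(2, ℝ)) {w : ℝ × ℝ} (hw : w ≠ 0) : app g w ≠ 0 := fun h0 => hw (by
  rw [← app_inv_app g w, h0, app_zero])

/-- The squared Euclidean norm. -/
def vsq (w : ℝ × ℝ) : ℝ := w.1 ^ 2 + w.2 ^ 2

lemma vsq_pos {w : ℝ × ℝ} (hw : w ≠ 0) : 0 < vsq w := by
  unfold vsq
  by_contra! hcon
  have h1 : w.1 ^ 2 = 0 := by nlinarith [sq_nonneg w.1, sq_nonneg w.2]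
  have h2 : w.2 ^ 2 = 0 := by nlinarith [sq_nonneg w.1, sq_nonneg w.2]
  exact hw (Prod.ext (by simpa using h1) (by simpa using h2))

lemma vsq_smul (c : ℝ) (w : ℝ × ℝ) : vsq (c • w) = c ^ 2 * vsq w := by
  simp [vsq]; ring

/-- A rotation which puts the ideal point `w` at infinity. -/
lemma exists_chart {w : ℝ × ℝ} (hw : w ≠ 0) :
    ∃ k : SL(2, ℝ), k • I = I ∧ ∀ g : SL(2, ℝ), ((k⁻¹ * g) • I).im = vsq w / vsq (app g⁻¹ w) := by
  have hp := vsq_pos hw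
  set r := √(vsq w) with hr
  have hr2 : r ^ 2 = vsq w := Real.sq_sqrt hp.le
  have hr0 : 0 < r := Real.sqrt_pos.mpr hp
  have hr3 : r ^ 2 = w.1 ^ 2 + w.2 ^ 2 := hr2
  let k : SL(2, ℝ) := ⟨!![w.1 / r, -w.2 / r; w.2 / r, w.1 / r], by
    rw [Matrix.det_fin_two]
    simp
    field_simp
    linarith⟩
  have k00 : k 0 0 = w.1 / r := rfl
  have k01 : k 0 1 = -w.2 / r := rfl
  have k10 : k 1 0 = w.2 / r := rfl
  have k11 : k 1 1 = w.1 / r := rfl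
  refine ⟨k, ?_, fun g => ?_⟩
  · have e : (w.1 / r) ^ 2 + (w.2 / r) ^ 2 = 1 := by field_simp; linarith
    apply UpperHalfPlane.ext
    apply Complex.ext
    · change (k • I).re = I.re
      rw [smul_re, k00, k01, k10, k11]
      simp only [UpperHalfPlane.I_re, UpperHalfPlane.I_im]
      field_simp
      ring
    · change (k • I).im = I.im
      rw [smul_im, k10, k11]
      simp [e]
  · obtain ⟨i1, i2, i3, i4⟩ := inv_entry k
    obtain ⟨j1, j2, j3, j4⟩ := inv_entry g
    have hv := vsq_pos (app_ne_zero g⁻¹ hw)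
    rw [smul_im]
    simp only [mul_entry, i3, i4, k00, k10, UpperHalfPlane.I_re, UpperHalfPlane.I_im, mul_zero,
      zero_add, mul_one]
    have : (-(w.2 / r) * g 0 1 + w.1 / r * g 1 1) ^ 2 + (-(w.2 / r) * g 0 0 + w.1 / r * g 1 0) ^ 2
        = vsq (app g⁻¹ w) / vsq w := by
      rw [← hr2]
      simp only [vsq, app, j1, j2, j3, j4]
      field_simp
      ring
    rw [this, one_div_div]

lemma gap_neg_coord {p z : ℍ} (hz : (z.re - p.re) ^ 2 + z.im ^ 2 + p.im ^ 2 <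
    p.im * (z.re ^ 2 + z.im ^ 2 + 1)) : gap p I z < 0 := by
  have h1 := z.im_pos
  have h2 := p.im_pos
  rw [gap, UpperHalfPlane.cosh_dist', UpperHalfPlane.cosh_dist']
  simp only [UpperHalfPlane.I_re, UpperHalfPlane.I_im, sub_zero, one_pow, mul_one]
  rw [sub_neg, div_lt_div_iff₀ (by positivity) (by positivity)]
  nlinarith

/-- Near infinity: a half plane at a higher point. -/
lemma exists_height_of_one_lt {p : ℍ} (hp : 1 < p.im) (x : ℝ) :
    ∃ y₀ : ℝ, ∀ z : ℍ, z.re = x → y₀ < z.im → gap p I z < 0 := by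
  refine ⟨1 + ((x - p.re) ^ 2 + p.im ^ 2) / (p.im - 1), fun z hx hy => gap_neg_coord ?_⟩
  rw [hx]
  have h0 : 0 < p.im - 1 := by linarith
  have h1 : ((x - p.re) ^ 2 + p.im ^ 2) < (z.im - 1) * (p.im - 1) := by
    rw [← div_lt_iff₀ h0]; linarith
  have h2 : 0 ≤ ((x - p.re) ^ 2 + p.im ^ 2) / (p.im - 1) := by positivity
  have h3 : 1 < z.im := by linarith
  nlinarith [mul_pos h0 (show 0 < z.im by linarith), sq_nonneg x, mul_nonneg h0.le (sq_nonneg (z.im - 1))]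

/-- Near infinity: a half plane at a point of the same height. -/
lemma gap_neg_of_im_eq_one {p z : ℍ} (hp : p.im = 1) (hz : p.re ^ 2 < 2 * p.re * z.re) :
    gap p I z < 0 := by
  refine gap_neg_coord ?_
  rw [hp]
  nlinarith

end Vectors

/-! ### Disjointness of half planes and ping-pong on the ideal boundary -/

namespace IsFreeFuchsianGroup

variable {u v : ℕ} {G : Subgroup SL(2, ℝ)} {h : Fin u → SL(2, ℝ)} {γ : Fin v → SL(2, ℝ)}
variable (hG : IsFreeFuchsianGroup G h γ)
include hG

omit hG in
lemma gap_chart {k : SL(2, ℝ)} (hk : k • I = I) (g : SL(2, ℝ)) (z : ℍ) :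
    gap (g • I) I (k • z) = gap ((k⁻¹ * g) • I) I z := by
  rw [← gap_smul k⁻¹, inv_smul_smul, mul_smul]
  congr 1
  rw [← hk, inv_smul_smul, hk]

omit hG in
/-- There is no point in the half planes of two different letters. -/
lemma false_of_gap_neg (hG : IsFreeFuchsianGroup G h γ) {k : SL(2, ℝ)} (hk : k • I = I)
    {a b : Letter u v} (hab : a ≠ b) (z : ℍ) (ha : gap ((k⁻¹ * a.val h γ) • I) I z < 0)
    (hb : gap ((k⁻¹ * b.val h γ) • I) I z < 0) : False := by
  rw [← gap_chart hk] at ha hb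
  exact (hG.gap_pos_of_gap_nonpos hab.symm ha.le).not_gt hb

lemma chart_re_ne_zero {k : SL(2, ℝ)} (hk : k • I = I) (a : Letter u v)
    (ha : ((k⁻¹ * a.val h γ) • I).im = 1) : ((k⁻¹ * a.val h γ) • I).re ≠ 0 := by
  intro h0
  have : (k⁻¹ * a.val h γ) • I = I := UpperHalfPlane.ext (Complex.ext h0 ha)
  rw [mul_smul, inv_smul_eq_iff, hk] at this
  exact hG.val_ne_one a (hG.eq_one_of_smul_I (hG.val_mem a) this)

/-- The ideal boundary of a half plane does not meet the other open half planes. -/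
lemma ideal_strict {w : ℝ × ℝ} (hw : w ≠ 0) {a b : Letter u v} (hab : a ≠ b)
    (ha : vsq (app (a.val h γ)⁻¹ w) < vsq w) : vsq w < vsq (app (b.val h γ)⁻¹ w) := by
  by_contra! hb
  -- With `w` at infinity, `i` keeps height one, and `vsq (app g⁻¹ w) < vsq w` says that `g i` is
  -- higher, that is, infinity belongs to the open half plane around `g i`.
  obtain ⟨k, hk, him⟩ := exists_chart hw
  have hpa := vsq_pos (app_ne_zero (a.val h γ)⁻¹ hw)
  have hpb := vsq_pos (app_ne_zero (b.val h γ)⁻¹ hw)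
  have h1 : 1 < ((k⁻¹ * a.val h γ) • I).im := by rwa [him, one_lt_div hpa]
  have h2 : 1 ≤ ((k⁻¹ * b.val h γ) • I).im := by rwa [him, one_le_div hpb]
  -- At equal height the half plane of `b` is bounded by a vertical line and contains the vertical
  -- line through `b i`; in the other case both half planes contain all high points of the imaginary
  -- axis. Either way they intersect.
  rcases h2.eq_or_lt with h2 | h2
  · have hne := hG.chart_re_ne_zero hk b h2.symm
    set x := ((k⁻¹ * b.val h γ) • I).re
    obtain ⟨y₀, hy₀⟩ := exists_height_of_one_lt h1 x
    have hpos : 0 < |y₀| + 1 := by positivity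
    refine hG.false_of_gap_neg hk hab ⟨⟨x, |y₀| + 1⟩, hpos⟩ (hy₀ _ rfl ?_)
      (gap_neg_of_im_eq_one h2.symm ?_)
    · change y₀ < |y₀| + 1
      linarith [le_abs_self y₀]
    · change x ^ 2 < 2 * x * x
      have := sq_nonneg x
      have : 0 < x ^ 2 := by positivity
      nlinarith
  · obtain ⟨y₀, hy₀⟩ := exists_height_of_one_lt h1 0
    obtain ⟨y₁, hy₁⟩ := exists_height_of_one_lt h2 0
    have hpos : 0 < |y₀| + |y₁| + 1 := by positivity
    refine hG.false_of_gap_neg hk hab ⟨⟨0, |y₀| + |y₁| + 1⟩, hpos⟩ (hy₀ _ rfl ?_) (hy₁ _ rfl ?_)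
    · change y₀ < |y₀| + |y₁| + 1
      linarith [le_abs_self y₀, abs_nonneg y₁]
    · change y₁ < |y₀| + |y₁| + 1
      linarith [le_abs_self y₁, abs_nonneg y₀]

/-- At most two half planes touch at an ideal point; the others stay away. -/
lemma ideal_two {w : ℝ × ℝ} (hw : w ≠ 0) {a b c : Letter u v} (hab : a ≠ b) (hac : c ≠ a)
    (hbc : c ≠ b) (ha : vsq (app (a.val h γ)⁻¹ w) = vsq w)
    (hb : vsq (app (b.val h γ)⁻¹ w) = vsq w) : vsq w < vsq (app (c.val h γ)⁻¹ w) := by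
  by_contra! hc
  rcases hc.eq_or_lt with hc | hc
  · obtain ⟨k, hk, him⟩ := exists_chart hw
    have hp := (vsq_pos hw).ne'
    have h1 : ((k⁻¹ * a.val h γ) • I).im = 1 := by rw [him, ha, div_self hp]
    have h2 : ((k⁻¹ * b.val h γ) • I).im = 1 := by rw [him, hb, div_self hp]
    have h3 : ((k⁻¹ * c.val h γ) • I).im = 1 := by rw [him, hc, div_self hp]
    have n1 := hG.chart_re_ne_zero hk a h1
    have n2 := hG.chart_re_ne_zero hk b h2
    have n3 := hG.chart_re_ne_zero hk c h3
    -- Two orbit points of height one on the same side of `i`, with real parts `p` and `q`, have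
    -- intersecting half planes: both contain the point `p + q + i`. Among three nonzero real parts
    -- two have the same sign.
    have main : ∀ x y : Letter u v, x ≠ y → ((k⁻¹ * x.val h γ) • I).im = 1 →
        ((k⁻¹ * y.val h γ) • I).im = 1 →
        ¬ 0 < ((k⁻¹ * x.val h γ) • I).re * ((k⁻¹ * y.val h γ) • I).re := by
      intro x y hxy hx hy hpos
      set p := ((k⁻¹ * x.val h γ) • I).re
      set q := ((k⁻¹ * y.val h γ) • I).re
      refine hG.false_of_gap_neg hk hxy ⟨⟨p + q, 1⟩, one_pos⟩ (gap_neg_of_im_eq_one hx ?_)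
        (gap_neg_of_im_eq_one hy ?_)
      · change p ^ 2 < 2 * p * (p + q)
        nlinarith [sq_nonneg p]
      · change q ^ 2 < 2 * q * (p + q)
        nlinarith [sq_nonneg q]
    have m1 := main a b hab h1 h2
    have m2 := main a c hac.symm h1 h3
    have m3 := main b c hbc.symm h2 h3
    rcases lt_or_gt_of_ne n1 with x1 | x1 <;> rcases lt_or_gt_of_ne n2 with x2 | x2 <;>
      rcases lt_or_gt_of_ne n3 with x3 | x3
    all_goals first
      | exact m1 (mul_pos_of_neg_of_neg x1 x2)
      | exact m2 (mul_pos_of_neg_of_neg x1 x3)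
      | exact m3 (mul_pos_of_neg_of_neg x2 x3)
      | exact m1 (mul_pos x1 x2)
      | exact m2 (mul_pos x1 x3)
      | exact m3 (mul_pos x2 x3)
  · exact (hG.ideal_strict hw hac hc).ne ha.symm

/-- Ping-pong on the ideal boundary. -/
lemma ideal_pingpong {w : ℝ × ℝ} (hw : w ≠ 0) {l c : Letter u v} {L : List (Letter u v)}
    (hred : FreeGroup.IsReduced (l :: L ++ [c]))
    (hc : vsq w < vsq (app (c.val h γ) w)) :
    vsq (app (l.val h γ)⁻¹ (app (wordProd h γ (l :: L ++ [c])) w)) <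
      vsq (app (wordProd h γ (l :: L ++ [c])) w) := by
  induction L generalizing l with
  | nil =>
    simp only [List.cons_append, List.nil_append] at hred ⊢
    rw [isReduced_cons_cons] at hred
    have h1 := hG.ideal_strict (w := app (c.val h γ) w) (app_ne_zero _ hw) (a := c) (b := l.inv)
      hred.1 (by rwa [app_inv_app])
    rw [Letter.val_inv, inv_inv] at h1
    simpa [app_mul] using h1
  | cons l' L ih =>
    simp only [List.cons_append] at hred ih ⊢
    rw [isReduced_cons_cons] at hred
    have h0 := ih hred.2
    have h1 := hG.ideal_strict (app_ne_zero _ hw) (a := l') (b := l.inv) hred.1 h0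
    rw [Letter.val_inv, inv_inv] at h1
    rw [wordProd_cons l, app_mul, app_inv_app]
    exact h1

end IsFreeFuchsianGroup

/-! ### Limit sets -/

section Symm

/-- The symmetric matrix `g gᵀ`, as a triple of entries. -/
def gram (g : SL(2, ℝ)) : ℝ × ℝ × ℝ :=
  (g 0 0 ^ 2 + g 0 1 ^ 2, g 0 0 * g 1 0 + g 0 1 * g 1 1, g 1 0 ^ 2 + g 1 1 ^ 2)

/-- Trace of a symmetric matrix. -/
def tr (S : ℝ × ℝ × ℝ) : ℝ := S.1 + S.2.2

/-- The action `S ↦ a S aᵀ`. -/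
def act (a : SL(2, ℝ)) (S : ℝ × ℝ × ℝ) : ℝ × ℝ × ℝ :=
  (a 0 0 ^ 2 * S.1 + 2 * (a 0 0 * a 0 1) * S.2.1 + a 0 1 ^ 2 * S.2.2,
    a 0 0 * a 1 0 * S.1 + (a 0 0 * a 1 1 + a 0 1 * a 1 0) * S.2.1 + a 0 1 * a 1 1 * S.2.2,
    a 1 0 ^ 2 * S.1 + 2 * (a 1 0 * a 1 1) * S.2.1 + a 1 1 ^ 2 * S.2.2)

/-- The rank one matrix `w wᵀ`. -/
def outer (w : ℝ × ℝ) : ℝ × ℝ × ℝ := (w.1 ^ 2, w.1 * w.2, w.2 ^ 2)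

/-- The polar form of the determinant. -/
def pairing (S T : ℝ × ℝ × ℝ) : ℝ := S.2.2 * T.1 - 2 * S.2.1 * T.2.1 + S.1 * T.2.2

lemma tr_gram (g : SL(2, ℝ)) : tr (gram g) = normSq g := by
  simp only [tr, gram, normSq]; ring

lemma act_gram (a g : SL(2, ℝ)) : act a (gram g) = gram (a * g) := by
  simp only [act, gram, mul_entry, Prod.mk.injEq]
  refine ⟨?_, ?_, ?_⟩ <;> ring

lemma act_outer (a : SL(2, ℝ)) (w : ℝ × ℝ) : act a (outer w) = outer (app a w) := by
  simp only [act, outer, app, Prod.mk.injEq]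
  refine ⟨?_, ?_, ?_⟩ <;> ring

lemma tr_outer (w : ℝ × ℝ) : tr (outer w) = vsq w := rfl

lemma act_smul (a : SL(2, ℝ)) (c : ℝ) (S : ℝ × ℝ × ℝ) : act a (c • S) = c • act a S := by
  simp only [act, Prod.smul_fst, Prod.smul_snd, smul_eq_mul, Prod.smul_mk, Prod.mk.injEq]
  refine ⟨?_, ?_, ?_⟩ <;> ring

lemma tr_smul (c : ℝ) (S : ℝ × ℝ × ℝ) : tr (c • S) = c * tr S := by
  simp only [tr, Prod.smul_fst, Prod.smul_snd, smul_eq_mul]; ring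

/-- Bilinearity allows `normSq (g⁻¹ * h)` to be compared with `normSq g * normSq h` by minimising
over normalised matrices. -/
lemma pairing_gram (g h : SL(2, ℝ)) : pairing (gram g) (gram h) = normSq (g⁻¹ * h) := by
  obtain ⟨i1, i2, i3, i4⟩ := inv_entry g
  simp only [pairing, gram, normSq, mul_entry, i1, i2, i3, i4]
  ring

lemma pairing_smul (c d : ℝ) (S T : ℝ × ℝ × ℝ) :
    pairing (c • S) (d • T) = c * d * pairing S T := by
  simp only [pairing, Prod.smul_fst, Prod.smul_snd, smul_eq_mul]; ring

lemma continuous_tr : Continuous tr := by unfold tr; fun_prop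

lemma continuous_act (a : SL(2, ℝ)) : Continuous (act a) := by unfold act; fun_prop

lemma continuous_pairing : Continuous fun p : (ℝ × ℝ × ℝ) × (ℝ × ℝ × ℝ) => pairing p.1 p.2 := by
  unfold pairing; fun_prop

lemma normSq_pos (g : SL(2, ℝ)) : 0 < normSq g := by linarith [one_le_normSq_half g]

lemma normSq_mul_le (g h : SL(2, ℝ)) : normSq (g * h) ≤ normSq g * normSq h := by
  simp only [normSq, mul_entry]
  nlinarith [sq_nonneg (g 0 0 * h 1 0 - g 0 1 * h 0 0), sq_nonneg (g 0 0 * h 1 1 - g 0 1 * h 0 1),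
    sq_nonneg (g 1 0 * h 1 0 - g 1 1 * h 0 0), sq_nonneg (g 1 0 * h 1 1 - g 1 1 * h 0 1)]

/-- `g gᵀ` normalised to trace one. -/
def nrm (g : SL(2, ℝ)) : ℝ × ℝ × ℝ := (normSq g)⁻¹ • gram g

/-- The action on matrices of trace one. -/
def nact (a : SL(2, ℝ)) (S : ℝ × ℝ × ℝ) : ℝ × ℝ × ℝ := (tr (act a S))⁻¹ • act a S

lemma nact_nrm (a g : SL(2, ℝ)) : nact a (nrm g) = nrm (a * g) := by
  have h1 := (normSq_pos g).ne'
  have h2 := (normSq_pos (a * g)).ne'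
  rw [nact, nrm, act_smul, tr_smul, act_gram, tr_gram, smul_smul, nrm]
  congr 1
  field_simp

lemma tr_nrm (g : SL(2, ℝ)) : tr (nrm g) = 1 := by
  rw [nrm, tr_smul, tr_gram, inv_mul_cancel₀ (normSq_pos g).ne']

lemma tr_act_nrm (a g : SL(2, ℝ)) : tr (act a (nrm g)) = normSq (a * g) / normSq g := by
  rw [nrm, act_smul, tr_smul, act_gram, tr_gram]
  field_simp

/-- Closure of the normalised orbit, as in the projective model. -/
def limCl (T : Set SL(2, ℝ)) : Set (ℝ × ℝ × ℝ) := closure (nrm '' T)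

lemma limCl_le {T : Set SL(2, ℝ)} {f g : ℝ × ℝ × ℝ → ℝ} (hf : Continuous f) (hg : Continuous g)
    (hT : ∀ x ∈ T, f (nrm x) ≤ g (nrm x)) {S : ℝ × ℝ × ℝ} (hS : S ∈ limCl T) : f S ≤ g S := by
  have hcl : IsClosed {S | f S ≤ g S} := isClosed_le hf hg
  refine closure_minimal ?_ hcl hS
  rintro _ ⟨x, hx, rfl⟩
  exact hT x hx

lemma tr_limCl {T : Set SL(2, ℝ)} {S : ℝ × ℝ × ℝ} (hS : S ∈ limCl T) : tr S = 1 :=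
  le_antisymm (limCl_le continuous_tr continuous_const (fun x _ => (tr_nrm x).le) hS)
    (limCl_le continuous_const continuous_tr (fun x _ => (tr_nrm x).ge) hS)

lemma det_limCl {T : Set SL(2, ℝ)} {S : ℝ × ℝ × ℝ} (hS : S ∈ limCl T) :
    S.2.1 ^ 2 ≤ S.1 * S.2.2 := by
  refine limCl_le (f := fun S => S.2.1 ^ 2) (g := fun S => S.1 * S.2.2) (by fun_prop) (by fun_prop)
    (fun x _ => ?_) hS
  have h1 := det_entries x
  have h2 := inv_pos.mpr (normSq_pos x)
  simp only [nrm, gram, Prod.smul_mk, smul_eq_mul]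
  have : (x 0 0 * x 1 0 + x 0 1 * x 1 1) ^ 2 ≤ (x 0 0 ^ 2 + x 0 1 ^ 2) * (x 1 0 ^ 2 + x 1 1 ^ 2) := by
    nlinarith [sq_nonneg (x 0 0 * x 1 1 - x 0 1 * x 1 0)]
  nlinarith [mul_le_mul_of_nonneg_left this (sq_nonneg (normSq x)⁻¹)]

lemma nonneg_limCl {T : Set SL(2, ℝ)} {S : ℝ × ℝ × ℝ} (hS : S ∈ limCl T) : 0 ≤ S.1 ∧ 0 ≤ S.2.2 := by
  constructor
  · refine limCl_le (f := fun _ => 0) (g := fun S => S.1) (by fun_prop) (by fun_prop)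
      (fun x _ => ?_) hS
    have h2 := inv_pos.mpr (normSq_pos x)
    simp only [nrm, gram, Prod.smul_mk, smul_eq_mul]
    positivity
  · refine limCl_le (f := fun _ => 0) (g := fun S => S.2.2) (by fun_prop) (by fun_prop)
      (fun x _ => ?_) hS
    have h2 := inv_pos.mpr (normSq_pos x)
    simp only [nrm, gram, Prod.smul_mk, smul_eq_mul]
    positivity

lemma isCompact_limCl (T : Set SL(2, ℝ)) : IsCompact (limCl T) := by
  have hc : IsCompact (Icc (0 : ℝ) 1 ×ˢ (Icc (-1 : ℝ) 1 ×ˢ Icc (0 : ℝ) 1)) :=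
    isCompact_Icc.prod (isCompact_Icc.prod isCompact_Icc)
  refine hc.of_isClosed_subset isClosed_closure fun S hS => ?_
  have h1 := tr_limCl hS
  have h2 := det_limCl hS
  obtain ⟨h3, h4⟩ := nonneg_limCl hS
  rw [tr] at h1
  refine ⟨⟨h3, by linarith⟩, ⟨?_, ?_⟩, ⟨h4, by linarith⟩⟩
  · nlinarith
  · nlinarith

/-- Submultiplicativity for `x = a⁻¹ (a x)` gives the lower bound `(normSq a⁻¹)⁻¹`, uniform in `x`,
which passes to the closure. It makes `nact a` continuous there. -/
lemma tr_act_pos {T : Set SL(2, ℝ)} {S : ℝ × ℝ × ℝ} (a : SL(2, ℝ)) (hS : S ∈ limCl T) :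
    0 < tr (act a S) := by
  have h0 := normSq_pos a⁻¹
  have : (normSq a⁻¹)⁻¹ ≤ tr (act a S) := by
    refine limCl_le continuous_const (continuous_tr.comp (continuous_act a)) (fun x _ => ?_) hS
    simp only [Function.comp]
    rw [tr_act_nrm, inv_le_iff_one_le_mul₀ h0, div_mul_eq_mul_div, one_le_div (normSq_pos x)]
    have := normSq_mul_le a⁻¹ (a * x)
    rw [inv_mul_cancel_left] at this
    linarith
  exact lt_of_lt_of_le (inv_pos.mpr h0) this

lemma nact_mem_limCl {T T' : Set SL(2, ℝ)} {S : ℝ × ℝ × ℝ} (a : SL(2, ℝ)) (hS : S ∈ limCl T)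
    (hT : ∀ x ∈ T, a * x ∈ T') : nact a S ∈ limCl T' := by
  have hc : ContinuousAt (nact a) S := by
    have h1 : ContinuousAt (fun S => (tr (act a S))⁻¹) S :=
      ((continuous_tr.comp (continuous_act a)).continuousAt).inv₀ (tr_act_pos a hS).ne'
    exact h1.smul (continuous_act a).continuousAt
  have := hc.continuousWithinAt.mem_closure_image (s := nrm '' T) hS
  refine closure_mono ?_ this
  rintro _ ⟨_, ⟨x, hx, rfl⟩, rfl⟩
  exact ⟨a * x, hT x hx, (nact_nrm a x).symm⟩

lemma nact_outer {a : SL(2, ℝ)} {w : ℝ × ℝ} (hw : vsq (app a w) = 1) :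
    nact a (outer w) = outer (app a w) := by
  rw [nact, act_outer, tr_outer, hw, inv_one, one_smul]

/-- Positive semidefinite matrices of trace one with vanishing pairing. -/
lemma exists_outer_of_pairing_nonpos {S T : ℝ × ℝ × ℝ} (hS : tr S = 1) (hT : tr T = 1)
    (hS' : S.2.1 ^ 2 ≤ S.1 * S.2.2) (hT' : T.2.1 ^ 2 ≤ T.1 * T.2.2) (hp : 0 ≤ S.1 ∧ 0 ≤ S.2.2)
    (h0 : pairing S T ≤ 0) : ∃ w, S = outer w ∧ T = outer w := by
  obtain ⟨p, q, r⟩ := S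
  obtain ⟨p', q', r'⟩ := T
  simp only [tr, pairing] at *
  have hr : r = 1 - p := by linarith
  have hr' : r' = 1 - p' := by linarith
  subst hr hr'
  -- At trace one the pairing is `p + p' - 2pp' - 2qq'`, and positivity of the determinants reads
  -- `p² + q² ≤ p`, `p'² + q'² ≤ p'`.
  have e1 : (p - p') ^ 2 + (q - q') ^ 2 ≤ 0 := by nlinarith
  have e2 : p = p' := by nlinarith [sq_nonneg (p - p'), sq_nonneg (q - q')]
  have e3 : q = q' := by nlinarith [sq_nonneg (p - p'), sq_nonneg (q - q')]
  subst e2 e3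
  have e4 : q ^ 2 = p * (1 - p) := by nlinarith
  have key : ∃ w : ℝ × ℝ, (p, q, 1 - p) = outer w := by
    have h1 : |q| = √p * √(1 - p) := by
      rw [← Real.sqrt_mul hp.1, ← e4, Real.sqrt_sq_eq_abs]
    rcases le_total 0 q with hq | hq
    · refine ⟨(√p, √(1 - p)), ?_⟩
      rw [abs_of_nonneg hq] at h1
      simp only [outer, Real.sq_sqrt hp.1, Real.sq_sqrt hp.2, h1]
    · refine ⟨(√p, -√(1 - p)), ?_⟩
      rw [abs_of_nonpos hq] at h1
      simp only [outer, Real.sq_sqrt hp.1, neg_sq, Real.sq_sqrt hp.2, mul_neg, ← h1, neg_neg]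
  obtain ⟨w, hw⟩ := key
  exact ⟨w, hw, hw⟩

end Symm

/-! ### Cylinders of reduced words and their common limit points -/

namespace IsFreeFuchsianGroup

variable {u v : ℕ} {G : Subgroup SL(2, ℝ)} {h : Fin u → SL(2, ℝ)} {γ : Fin v → SL(2, ℝ)}

variable (h γ) in
/-- The elements whose reduced word begins with the letter `x`. -/
def starts (x : Letter u v) : Set SL(2, ℝ) :=
  {g | ∃ L, FreeGroup.IsReduced (x :: L) ∧ g = wordProd h γ (x :: L)}

/-- The unit vector `w` is a common limit point of two cylinders. -/
def Touch (h : Fin u → SL(2, ℝ)) (γ : Fin v → SL(2, ℝ)) (x y : Letter u v) (w : ℝ × ℝ) : Prop :=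
  x ≠ y ∧ vsq w = 1 ∧ outer w ∈ limCl (starts h γ x) ∧ outer w ∈ limCl (starts h γ y)

variable (hG : IsFreeFuchsianGroup G h γ)
include hG

omit hG in
lemma gap_eq_normSq (a g : SL(2, ℝ)) :
    gap (a • I) I (g • I) = (normSq (a⁻¹ * g) - normSq g) / 2 := by
  rw [gap, dist_smul_smul_I, cosh_dist_smul_I, cosh_dist_smul_I]
  ring

omit hG in
lemma mul_mem_starts {a y : Letter u v} (hy : y ≠ a.inv) {g : SL(2, ℝ)} (hg : g ∈ starts h γ y) :
    a.val h γ * g ∈ starts h γ a := by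
  obtain ⟨L, hL, rfl⟩ := hg
  exact ⟨y :: L, isReduced_cons_cons.mpr ⟨hy, hL⟩, by simp⟩

omit hG in
lemma inv_mul_mem_starts {x : Letter u v} {g : SL(2, ℝ)} (hg : g ∈ starts h γ x) :
    (x.val h γ)⁻¹ * g ∈ {1} ∪ ⋃ y ∈ {y | y ≠ x.inv}, starts h γ y := by
  obtain ⟨L, hL, rfl⟩ := hg
  rw [wordProd_cons, inv_mul_cancel_left]
  cases L with
  | nil => left; simp
  | cons y L =>
    right
    rw [isReduced_cons_cons] at hL
    exact mem_biUnion hL.1 ⟨L, hL.2, rfl⟩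

/-- Ping-pong puts the orbit points of the cylinder in the closed half plane of `x`; as an
inequality of traces this survives the closure. -/
lemma vsq_le_of_mem {x : Letter u v} {w : ℝ × ℝ} (hw : outer w ∈ limCl (starts h γ x)) :
    vsq (app (x.val h γ)⁻¹ w) ≤ vsq w := by
  rw [← tr_outer, ← tr_outer, ← act_outer]
  refine limCl_le (continuous_tr.comp (continuous_act _)) continuous_tr (fun g hg => ?_) hw
  obtain ⟨L, hL, rfl⟩ := hg
  have := hG.gap_wordProd_nonpos hL I_mem_dirichletDomain
  rw [gap_eq_normSq] at this
  simp only [Function.comp]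
  rw [tr_act_nrm, tr_nrm, div_le_one (normSq_pos _)]
  linarith

/-- The half plane of `x` lies outside that of `y`, and again the trace inequality is closed. For a
touching point this and `vsq_le_of_mem` together give equality. -/
lemma le_vsq_of_mem {x y : Letter u v} (hxy : x ≠ y) {w : ℝ × ℝ}
    (hw : outer w ∈ limCl (starts h γ x)) : vsq w ≤ vsq (app (y.val h γ)⁻¹ w) := by
  rw [← tr_outer, ← tr_outer (app _ _), ← act_outer]
  refine limCl_le continuous_tr (continuous_tr.comp (continuous_act _)) (fun g hg => ?_) hw
  obtain ⟨L, hL, rfl⟩ := hg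
  have := hG.gap_pos_of_gap_nonpos hxy.symm (hG.gap_wordProd_nonpos hL I_mem_dirichletDomain)
  rw [gap_eq_normSq] at this
  simp only [Function.comp]
  rw [tr_act_nrm, tr_nrm, one_le_div (normSq_pos _)]
  linarith

lemma Touch.vsq_eq {x y : Letter u v} {w : ℝ × ℝ} (ht : Touch h γ x y w) :
    vsq (app (x.val h γ)⁻¹ w) = 1 := by
  rw [← ht.2.1]
  exact le_antisymm (hG.vsq_le_of_mem ht.2.2.1) (hG.le_vsq_of_mem ht.1.symm ht.2.2.2)

omit hG in
lemma Touch.symm {x y : Letter u v} {w : ℝ × ℝ} (ht : Touch h γ x y w) : Touch h γ y x w :=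
  ⟨ht.1.symm, ht.2.1, ht.2.2.2, ht.2.2.1⟩

lemma Touch.one_le {x y : Letter u v} {w : ℝ × ℝ} (ht : Touch h γ x y w) (z : Letter u v) :
    vsq w ≤ vsq (app (z.val h γ)⁻¹ w) := by
  by_cases hz : z = x
  · rw [hz, ht.vsq_eq hG, ht.2.1]
  · exact hG.le_vsq_of_mem (Ne.symm hz) ht.2.2.1

/-- Moving a touching point along one of its sides. -/
lemma Touch.next {x y : Letter u v} {w : ℝ × ℝ} (ht : Touch h γ x y w) :
    ∃ y' : Letter u v, Touch h γ y' x.inv (app (x.val h γ)⁻¹ w) := by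
  have hv := ht.vsq_eq hG
  have hmem : outer (app (x.val h γ)⁻¹ w) ∈ limCl (starts h γ x.inv) := by
    rw [← nact_outer hv]
    refine nact_mem_limCl _ ht.2.2.2 fun g hg => ?_
    rw [← Letter.val_inv]
    exact mul_mem_starts (by rw [Letter.inv_inv]; exact ht.1.symm) hg
  have hmem2 : outer (app (x.val h γ)⁻¹ w) ∈
      limCl ({1} ∪ ⋃ y ∈ {y : Letter u v | y ≠ x.inv}, starts h γ y) := by
    rw [← nact_outer hv]
    exact nact_mem_limCl _ ht.2.2.1 fun g hg => inv_mul_mem_starts hg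
  rw [limCl, image_union, closure_union, image_iUnion₂,
    (Set.toFinite {y : Letter u v | y ≠ x.inv}).closure_biUnion, image_singleton,
    closure_singleton] at hmem2
  rcases hmem2 with h1 | h1
  -- The identity contributes half the unit matrix, which has rank two and is no `outer w`.
  · exfalso
    have h2 : nrm 1 = (1 / 2, 0, 1 / 2) := by
      obtain ⟨i1, i2, i3, i4⟩ := one_entry
      simp only [nrm, gram, normSq, i1, i2, i3, i4]
      norm_num
    rw [mem_singleton_iff, h2] at h1
    simp only [outer, Prod.mk.injEq] at h1
    have : (app (x.val h γ)⁻¹ w).1 ^ 2 * (app (x.val h γ)⁻¹ w).2 ^ 2 = 0 := by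
      rw [← mul_pow, h1.2.1]; norm_num
    rw [h1.1, h1.2.2] at this
    norm_num at this
  · simp only [mem_iUnion] at h1
    obtain ⟨y', hy', h2⟩ := h1
    exact ⟨y', hy', hv, h2, hmem⟩

end IsFreeFuchsianGroup

/-! ### Touching points are cusps -/

/-- Since `x / 0 = 0`, the quotient does not distinguish the two coordinate axes; `h2` does. -/
lemma eq_smul_of_ratio_eq {w w' : ℝ × ℝ} (hw : vsq w = 1) (hw' : vsq w' = 1)
    (h1 : w.1 / w.2 = w'.1 / w'.2) (h2 : w.2 = 0 ↔ w'.2 = 0) :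
    ∃ ε : ℝ, ε ^ 2 = 1 ∧ w = ε • w' := by
  obtain ⟨a, b⟩ := w
  obtain ⟨c, d⟩ := w'
  simp only [vsq] at *
  by_cases hb : b = 0
  · have hd := h2.mp hb
    subst hb hd
    refine ⟨a * c, ?_, ?_⟩
    · have ha : a ^ 2 = 1 := by linarith
      have hc : c ^ 2 = 1 := by linarith
      rw [mul_pow, ha, hc, one_mul]
    · have hc : c ^ 2 = 1 := by linarith
      simp only [Prod.smul_mk, smul_eq_mul, mul_zero, Prod.mk.injEq, and_true]
      linear_combination -a * hc
  · have hd : d ≠ 0 := fun h => hb (h2.mpr h)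
    rw [div_eq_div_iff hb hd] at h1
    refine ⟨a * c + b * d, ?_, ?_⟩
    · have : (a * c + b * d) ^ 2 = (a ^ 2 + b ^ 2) * (c ^ 2 + d ^ 2) - (a * d - c * b) ^ 2 := by ring
      rw [this, hw, hw', h1, sub_self]; norm_num
    · simp only [Prod.smul_mk, smul_eq_mul, Prod.mk.injEq]
      constructor
      · linear_combination -a * hw' + d * h1
      · linear_combination -b * hw' - c * h1

/-- As `g` commutes with `g ^ e`, it maps `w` to another eigenvector for the same eigenvalue. If
that were independent of `w`, `g ^ e` would be scalar. So `w` is an eigenvector of `g`, whose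
characteristic polynomial has the double root `±1`. -/
lemma exists_eigen_of_zpow {g : SL(2, ℝ)} (hg : g.val.IsParabolic) {e : ℤ}
    (hne : ¬ ((g ^ e) 0 1 = 0 ∧ (g ^ e) 1 0 = 0 ∧ (g ^ e) 0 0 = (g ^ e) 1 1)) {w : ℝ × ℝ}
    (hw : w ≠ 0) {ε : ℝ} (hε : app (g ^ e) w = ε • w) :
    ∃ δ : ℝ, δ ^ 2 = 1 ∧ app g w = δ • w := by
  have hcomm : app (g ^ e) (app g w) = ε • app g w := by
    rw [← app_mul, ← zpow_add_one, zpow_add_one, (Commute.self_zpow g e).symm.eq, app_mul, hε,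
      app_smul]
  set M := g ^ e
  set w' := app g w with hw'
  have hdet : w.1 * w'.2 - w.2 * w'.1 = 0 := by
    by_contra hd
    apply hne
    obtain ⟨a1, a2⟩ := Prod.ext_iff.mp hε
    obtain ⟨b1, b2⟩ := Prod.ext_iff.mp hcomm
    simp only [app, Prod.smul_fst, Prod.smul_snd, smul_eq_mul] at a1 a2 b1 b2
    have c1 : M 0 0 - ε = 0 := (mul_eq_zero.mp (show (M 0 0 - ε) * (w.1 * w'.2 - w.2 * w'.1) = 0 by
      linear_combination w'.2 * a1 - w.2 * b1)).resolve_right hd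
    have c2 : M 0 1 = 0 := (mul_eq_zero.mp (show M 0 1 * (w.1 * w'.2 - w.2 * w'.1) = 0 by
      linear_combination w.1 * b1 - w'.1 * a1)).resolve_right hd
    have c3 : M 1 0 = 0 := (mul_eq_zero.mp (show M 1 0 * (w.1 * w'.2 - w.2 * w'.1) = 0 by
      linear_combination w'.2 * a2 - w.2 * b2)).resolve_right hd
    have c4 : M 1 1 - ε = 0 := (mul_eq_zero.mp (show (M 1 1 - ε) * (w.1 * w'.2 - w.2 * w'.1) = 0 by
      linear_combination w.1 * b2 - w'.1 * a2)).resolve_right hd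
    exact ⟨c2, c3, by linarith⟩
  have hp := vsq_pos hw
  have hpar := hg.2
  rw [Matrix.discr_fin_two, g.2, Matrix.trace_fin_two] at hpar
  have hd := det_entries g
  have htr : (g 0 0 + g 1 1) ^ 2 = 4 := by
    have : (g 0 0 + g 1 1) ^ 2 - 4 * 1 = 0 := hpar
    linarith
  set lam := (w.1 * w'.1 + w.2 * w'.2) / vsq w with hlam
  have e1 : w'.1 = lam * w.1 := by
    rw [hlam, div_mul_eq_mul_div, eq_div_iff hp.ne', vsq]
    linear_combination -w.2 * hdet
  have e2 : w'.2 = lam * w.2 := by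
    rw [hlam, div_mul_eq_mul_div, eq_div_iff hp.ne', vsq]
    linear_combination w.1 * hdet
  have f1 : g 0 0 * w.1 + g 0 1 * w.2 = lam * w.1 := e1
  have f2 : g 1 0 * w.1 + g 1 1 * w.2 = lam * w.2 := e2
  refine ⟨lam, ?_, Prod.ext e1 e2⟩
  have char : lam ^ 2 - (g 0 0 + g 1 1) * lam + 1 = 0 := by
    have k1 : (lam ^ 2 - (g 0 0 + g 1 1) * lam + 1) * w.1 = 0 := by
      linear_combination (g 1 1 - lam) * f1 - g 0 1 * f2 - w.1 * hd
    have k2 : (lam ^ 2 - (g 0 0 + g 1 1) * lam + 1) * w.2 = 0 := by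
      linear_combination (g 0 0 - lam) * f2 - g 1 0 * f1 - w.2 * hd
    by_contra hc
    exact hw (Prod.ext ((mul_eq_zero.mp k1).resolve_left hc) ((mul_eq_zero.mp k2).resolve_left hc))
  have h1 : (2 * lam - (g 0 0 + g 1 1)) ^ 2 = 0 := by linear_combination 4 * char + htr
  have h2 : 2 * lam = g 0 0 + g 1 1 := by
    have := pow_eq_zero_iff two_ne_zero |>.mp h1
    linarith
  rw [← h2] at htr
  linarith

lemma vsq_app_of_eigen {g : SL(2, ℝ)} {w : ℝ × ℝ} {δ : ℝ} (hδ : δ ^ 2 = 1)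
    (hg : app g w = δ • w) : vsq (app g w) = vsq w ∧ vsq (app g⁻¹ w) = vsq w := by
  constructor
  · rw [hg, vsq_smul, hδ, one_mul]
  · have h1 : w = δ • app g⁻¹ w := by
      rw [← app_smul, ← hg, app_inv_app]
    conv_rhs => rw [h1]
    rw [vsq_smul, hδ, one_mul]

namespace IsFreeFuchsianGroup

variable {u v : ℕ} {G : Subgroup SL(2, ℝ)} {h : Fin u → SL(2, ℝ)} {γ : Fin v → SL(2, ℝ)}
variable (hG : IsFreeFuchsianGroup G h γ)
include hG

lemma two_lt_normSq {g : SL(2, ℝ)} (hg : g ∈ G) (h1 : g ≠ 1) : 2 < normSq g := by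
  have h2 : 1 < cosh (dist (g • I) I) := by
    rw [Real.one_lt_cosh, dist_ne_zero]
    exact fun h3 => h1 (hG.eq_one_of_smul_I hg h3)
  rw [cosh_dist_smul_I] at h2
  linarith

lemma not_scalar {g : SL(2, ℝ)} (hg : g ∈ G) (h1 : g ≠ 1) :
    ¬ (g 0 1 = 0 ∧ g 1 0 = 0 ∧ g 0 0 = g 1 1) := by
  rintro ⟨a, b, c⟩
  have h2 := hG.two_lt_normSq hg h1
  have h3 := det_entries g
  rw [normSq, a, b, c] at h2
  rw [a, b, c] at h3
  nlinarith

/-- Determinant one and the eigenvalue `ε = ±1` force trace `2 ε`, so the discriminant vanishes. -/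
lemma isParabolic_of_eigen {g : SL(2, ℝ)} (hg : g ∈ G) (h1 : g ≠ 1) {w : ℝ × ℝ} (hw : w ≠ 0)
    {ε : ℝ} (hε : ε ^ 2 = 1) (hgw : app g w = ε • w) : g.val.IsParabolic := by
  refine ⟨?_, ?_⟩
  · rintro ⟨a, ha⟩
    apply hG.not_scalar hg h1
    rw [← ha]
    simp
  · rw [Matrix.discr_fin_two, g.2, Matrix.trace_fin_two]
    change (g 0 0 + g 1 1) ^ 2 - 4 * 1 = 0
    obtain ⟨a1, a2⟩ := Prod.ext_iff.mp hgw
    simp only [app, Prod.smul_fst, Prod.smul_snd, smul_eq_mul] at a1 a2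
    have hd := det_entries g
    have char : ε ^ 2 - (g 0 0 + g 1 1) * ε + 1 = 0 := by
      have k1 : (ε ^ 2 - (g 0 0 + g 1 1) * ε + 1) * w.1 = 0 := by
        linear_combination (g 1 1 - ε) * a1 - g 0 1 * a2 - w.1 * hd
      have k2 : (ε ^ 2 - (g 0 0 + g 1 1) * ε + 1) * w.2 = 0 := by
        linear_combination (g 0 0 - ε) * a2 - g 1 0 * a1 - w.2 * hd
      by_contra hc
      exact hw (Prod.ext ((mul_eq_zero.mp k1).resolve_left hc)
        ((mul_eq_zero.mp k2).resolve_left hc))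
    have e2 : (g 0 0 + g 1 1) * ε = 2 := by linarith
    have e3 : (g 0 0 + g 1 1) ^ 2 * ε ^ 2 = 4 := by rw [← mul_pow, e2]; norm_num
    rw [hε, mul_one] at e3
    linarith

/-- The ideal points of a bisector have finitely many slopes. -/
lemma finite_slopes (x : Letter u v) : ∃ S : Set ℝ, S.Finite ∧ ∀ w : ℝ × ℝ, vsq w = 1 →
    vsq (app (x.val h γ)⁻¹ w) = 1 → w.1 / w.2 ∈ S := by
  set m := (x.val h γ)⁻¹ with hm
  have hN : 2 < normSq m := by
    rw [hm, normSq_inv]; exact hG.two_lt_normSq (hG.val_mem x) (hG.val_ne_one x)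
  rw [normSq] at hN
  set A := m 0 0 ^ 2 + m 1 0 ^ 2 - 1
  set B := 2 * (m 0 0 * m 0 1 + m 1 0 * m 1 1)
  set C := m 0 1 ^ 2 + m 1 1 ^ 2 - 1
  -- The quadratic form of `mᵀ m - 1` vanishes at `w`. It is not the zero form, since its trace `A +
  -- C` is `normSq m - 2 > 0`.
  have hq : ∀ w : ℝ × ℝ, vsq w = 1 → vsq (app m w) = 1 →
      A * w.1 ^ 2 + B * (w.1 * w.2) + C * w.2 ^ 2 = 0 := by
    intro w h1 h2
    simp only [vsq, app] at h1 h2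
    simp only [A, B, C]
    linear_combination h2 - h1
  by_cases hne : A ≠ 0 ∨ B ≠ 0
  · refine ⟨insert 0 {t | A * t ^ 2 + B * t + C = 0}, (finite_quadratic_roots hne).insert _, ?_⟩
    intro w h1 h2
    by_cases hw : w.2 = 0
    · left; simp [hw]
    · right
      have := hq w h1 h2
      simp only [mem_ofPred_eq]
      field_simp
      linarith
  · refine ⟨{0}, finite_singleton 0, fun w h1 h2 => ?_⟩
    push Not at hne
    have h3 := hq w h1 h2
    have h4 : C ≠ 0 := by
      intro hC
      have h5 : A + C = 0 := by rw [hne.1, hC, add_zero]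
      simp only [A, C] at h5
      linarith
    rw [hne.1, hne.2] at h3
    have h5 : w.2 = 0 := by
      have : C * w.2 ^ 2 = 0 := by linarith
      simpa [h4] using this
    simp [h5]

/-- The orbit of a touching point along its sides returns, up to sign. -/
lemma Touch.exists_parabolic {x y : Letter u v} {w : ℝ × ℝ} (ht : Touch h γ x y w) :
    ∃ j, ∃ k ∈ G, ∃ w' : ℝ × ℝ, w' ≠ 0 ∧ w = app k w' ∧
      ∃ δ : ℝ, δ ^ 2 = 1 ∧ app (γ j) w' = δ • w' := by
  -- Iterating `Touch.next` produces an infinite reduced word `X` and unit vectors with `W n = X n ·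
  -- W (n + 1)`, each an ideal end of one of finitely many bisectors.
  let St := {s : Letter u v × Letter u v × (ℝ × ℝ) // Touch h γ s.1 s.2.1 s.2.2}
  have hnext : ∀ s : St, ∃ s' : St, s'.1.2.1 = s.1.1.inv ∧
      s'.1.2.2 = app (s.1.1.val h γ)⁻¹ s.1.2.2 := fun s => by
    obtain ⟨y', hy'⟩ := s.2.next hG
    exact ⟨⟨(y', s.1.1.inv, _), hy'⟩, rfl, rfl⟩
  choose nx hnx1 hnx2 using hnext
  let s : ℕ → St := fun n => nx^[n] ⟨(x, y, w), ht⟩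
  have hs : ∀ n, s (n + 1) = nx (s n) := fun n => Function.iterate_succ_apply' nx n _
  let X : ℕ → Letter u v := fun n => (s n).1.1
  let W : ℕ → ℝ × ℝ := fun n => (s n).1.2.2
  have hXW : ∀ n, W n = app ((X n).val h γ) (W (n + 1)) := fun n => by
    change _ = app _ (s (n + 1)).1.2.2
    rw [hs, hnx2, app_app_inv]
  have hX : ∀ n, X (n + 1) ≠ (X n).inv := fun n => by
    have h1 := (s (n + 1)).2.1
    change _ ≠ (s n).1.1.inv
    rw [← hnx1, ← hs]
    exact h1
  have hword : ∀ d n, FreeGroup.IsReduced (X n :: (List.range' (n + 1) d).map X) ∧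
      W n = app (wordProd h γ (X n :: (List.range' (n + 1) d).map X)) (W (n + 1 + d)) := by
    intro d
    induction d with
    | zero =>
      intro n
      refine ⟨FreeGroup.IsReduced.singleton, ?_⟩
      simpa using hXW n
    | succ d ih =>
      intro n
      obtain ⟨h1, h2⟩ := ih (n + 1)
      rw [List.range'_succ, List.map_cons]
      refine ⟨isReduced_cons_cons.mpr ⟨hX n, h1⟩, ?_⟩
      rw [wordProd_cons, app_mul, show n + 1 + (d + 1) = n + 1 + 1 + d by ring, ← h2]
      exact hXW n
  have hW1 : ∀ n, vsq (W n) = 1 := fun n => (s n).2.2.1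
  -- pigeonhole
  obtain ⟨n, m, hnm, ε, hε, heq⟩ : ∃ n m, n < m ∧ ∃ ε : ℝ, ε ^ 2 = 1 ∧ W n = ε • W m := by
    choose S hSfin hS using hG.finite_slopes
    have hfin : ((⋃ x : Letter u v, S x) ×ˢ (univ : Set Prop)).Finite :=
      (finite_iUnion hSfin).prod finite_univ
    have hmaps : MapsTo (fun n => ((W n).1 / (W n).2, (W n).2 = 0)) (univ : Set ℕ)
        ((⋃ x : Letter u v, S x) ×ˢ (univ : Set Prop)) := fun n _ =>
      ⟨mem_iUnion.mpr ⟨X n, hS _ _ (hW1 n) ((s n).2.vsq_eq hG)⟩, mem_univ _⟩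
    obtain ⟨n, -, m, -, hne, hfeq⟩ := infinite_univ.exists_ne_map_eq_of_mapsTo hmaps hfin
    have key : ∀ n m, ((W n).1 / (W n).2, (W n).2 = 0) = ((W m).1 / (W m).2, (W m).2 = 0) →
        ∃ ε : ℝ, ε ^ 2 = 1 ∧ W n = ε • W m := fun n m he => by
      rw [Prod.mk.injEq] at he
      exact eq_smul_of_ratio_eq (hW1 n) (hW1 m) he.1 (iff_of_eq he.2)
    rcases lt_or_gt_of_ne hne with hlt | hlt
    · exact ⟨n, m, hlt, key n m hfeq⟩
    · exact ⟨m, n, hlt, key m n hfeq.symm⟩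
  obtain ⟨d, rfl⟩ := Nat.exists_eq_add_of_lt hnm
  obtain ⟨hred, hWn⟩ := hword d n
  set g := wordProd h γ (X n :: (List.range' (n + 1) d).map X) with hg
  have hgG : g ∈ G := hG.wordProd_mem _
  have hg1 : g ≠ 1 := fun h1 => by
    have := hG.wordProd_injOn hred FreeGroup.IsReduced.nil h1
    simp at this
  rw [show n + d + 1 = n + 1 + d by ring] at heq
  have hWm0 : W (n + 1 + d) ≠ 0 := fun h0 => by
    have := hW1 (n + 1 + d)
    rw [h0] at this
    simp [vsq] at this
  have hgw : app g (W (n + 1 + d)) = ε • W (n + 1 + d) := by rw [← hWn, heq]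
  -- The word read between the two coinciding positions has eigenvalue `±1` there, hence is
  -- parabolic; `cusps` then transports its fixed point to that of a generator.
  have hpar := hG.isParabolic_of_eigen hgG hg1 hWm0 hε hgw
  obtain ⟨j, k, hk, e, he⟩ := hG.cusps g hgG hpar
  have he : γ j ^ e = k⁻¹ * g * k := he
  have hw'0 : app k⁻¹ (W (n + 1 + d)) ≠ 0 := app_ne_zero _ hWm0
  have hP := hword (n + d) 0
  have hγG : γ j ^ e ∈ G := by rw [he]; exact mul_mem (mul_mem (inv_mem hk) hgG) hk
  have hγ1 : γ j ^ e ≠ 1 := by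
    rw [he]
    intro h1
    apply hg1
    have : g = k * (k⁻¹ * g * k) * k⁻¹ := by group
    rw [this, h1]; group
  obtain ⟨δ, hδ, hδw⟩ := exists_eigen_of_zpow (hG.parabolic j) (hG.not_scalar hγG hγ1) hw'0
    (ε := ε) (by
      rw [he, app_mul, app_app_inv, app_mul, hgw, app_smul])
  refine ⟨j, wordProd h γ (X 0 :: (List.range' (0 + 1) (n + d)).map X) * k,
    mul_mem (hG.wordProd_mem _) hk, app k⁻¹ (W (n + 1 + d)), hw'0, ?_, δ, hδ, hδw⟩
  rw [app_mul, app_app_inv, show n + 1 + d = 0 + 1 + (n + d) by ring, ← hP.2]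
  rfl

/-- A common limit point of two cylinders is the cusp of a parabolic letter. -/
lemma Touch.isParabolic {x y : Letter u v} {w : ℝ × ℝ} (ht : Touch h γ x y w) :
    x.IsParabolic ∧ y = x.inv := by
  obtain ⟨j, k, hk, w', hw', hwk, δ, hδ, hδw⟩ := ht.exists_parabolic hG
  let lj : Letter u v := (Sum.inr j, true)
  have hlj : lj.val h γ = γ j := rfl
  have hljinv : lj.inv.val h γ = (γ j)⁻¹ := by rw [Letter.val_inv, hlj]
  -- Choose a shortest word `L` carrying a fixed vector of `γ j` to `w`. Minimality prevents `L`
  -- from ending in `γ j` or its inverse, as these preserve the fixed line.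
  have hex : ∃ n, ∃ L : List (Letter u v), FreeGroup.IsReduced L ∧ L.length = n ∧
      ∃ w' : ℝ × ℝ, w' ≠ 0 ∧ w = app (wordProd h γ L) w' ∧
        ∃ δ : ℝ, δ ^ 2 = 1 ∧ app (γ j) w' = δ • w' := by
    obtain ⟨L, hL, hLk⟩ := hG.exists_word hk
    exact ⟨_, L, hL, rfl, w', hw', by rw [hLk, hwk], δ, hδ, hδw⟩
  classical
  obtain ⟨L, hL, hlen, w₁, hw₁, hwL, δ₁, hδ₁, hδw₁⟩ := Nat.find_spec hex
  have hmin : ∀ L' : List (Letter u v), FreeGroup.IsReduced L' → L'.length < L.length →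
      ∀ w' : ℝ × ℝ, w' ≠ 0 → w = app (wordProd h γ L') w' →
        ∀ δ : ℝ, δ ^ 2 = 1 → app (γ j) w' ≠ δ • w' := by
    intro L' hL' hlt w' hw' hwL' δ hδ hc
    rw [hlen] at hlt
    exact Nat.find_min hex hlt ⟨L', hL', rfl, w', hw', hwL', δ, hδ, hc⟩
  obtain ⟨hv1, hv2⟩ := vsq_app_of_eigen hδ₁ hδw₁
  rcases List.eq_nil_or_concat L with h0 | ⟨L₀, c, h0⟩
  · rw [h0, wordProd_nil, app_one] at hwL
    subst hwL
    -- With `L` empty, `w` is the cusp of `γ j` itself, where the half planes of `γ j` and its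
    -- inverse touch and no other half plane comes close.
    have main : ∀ z : Letter u v, vsq (app (z.val h γ)⁻¹ w) = 1 → z = lj ∨ z = lj.inv := by
      intro z hz
      by_contra! hcon
      have := hG.ideal_two hw₁ (a := lj) (b := lj.inv) (c := z) lj.inv_ne.symm hcon.1 hcon.2
        hv2 (by rw [hljinv, inv_inv]; exact hv1)
      rw [hz, ht.2.1] at this
      exact this.false
    have hx := main x (ht.vsq_eq hG)
    have hy := main y (ht.symm.vsq_eq hG)
    have hxy := ht.1
    rcases hx with rfl | rfl <;> rcases hy with rfl | rfl
    · exact absurd rfl hxy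
    · exact ⟨⟨j, rfl⟩, rfl⟩
    · exact ⟨⟨j, rfl⟩, by simp⟩
    · exact absurd rfl hxy
  · exfalso
    rw [List.concat_eq_append] at h0
    have hL₀ : FreeGroup.IsReduced L₀ := hL.infix ⟨[], [c], by rw [h0]; simp⟩
    have hlt : L₀.length < L.length := by rw [h0]; simp
    have hwc : w = app (wordProd h γ L₀) (app (c.val h γ) w₁) := by
      rw [hwL, h0, wordProd_append, app_mul]; simp
    have hgen : ∀ w₂ : ℝ × ℝ, app (c.val h γ) w₁ = w₂ → w₂ ≠ 0 → app (γ j) w₂ ≠ δ₁ • w₂ :=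
      fun w₂ he h2 => hmin L₀ hL₀ hlt w₂ h2 (by rw [hwc, he]) δ₁ hδ₁
    have hc1 : c ≠ lj := by
      rintro rfl
      refine hgen _ rfl (app_ne_zero _ hw₁) ?_
      rw [hlj, hδw₁, app_smul, hδw₁]
    have hc2 : c ≠ lj.inv := by
      rintro rfl
      refine hgen _ rfl (app_ne_zero _ hw₁) ?_
      rw [hljinv, app_app_inv, ← app_smul, ← hδw₁, app_inv_app]
    -- With `L` nonempty, the cusp stays away from the half plane of `c⁻¹`, so ideal ping-pong
    -- places `w` strictly inside the half plane of the first letter of `L`. A touching point lies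
    -- in no open half plane.
    have hstrict := hG.ideal_two hw₁ (a := lj) (b := lj.inv) (c := c.inv) lj.inv_ne.symm
      (fun h => hc2 (by rw [← h, Letter.inv_inv])) (fun h => hc1 (Letter.inv_injective h))
      hv2 (by rw [hljinv, inv_inv]; exact hv1)
    rw [Letter.val_inv, inv_inv] at hstrict
    cases L₀ with
    | nil =>
      simp only [wordProd_nil, app_one] at hwc
      have := ht.one_le hG c
      rw [hwc, app_inv_app] at this
      exact this.not_gt hstrict
    | cons l L₁ =>
      have h1 := hG.ideal_pingpong hw₁ (l := l) (c := c) (L := L₁) (h0 ▸ hL) hstrict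
      rw [List.cons_append, ← List.cons_append, ← h0, ← hwL] at h1
      exact (ht.one_le hG l).not_gt h1

/-- Quasi-multiplicativity of the norm. -/
lemma exists_normSq_mul_ge : ∃ c > 0, ∀ x y : Letter u v, x ≠ y → ¬ (x.IsParabolic ∧ y = x.inv) →
    ∀ g ∈ starts h γ x, ∀ g' ∈ starts h γ y, c * (normSq g * normSq g') ≤ normSq (g⁻¹ * g') := by
  have main : ∀ p : Letter u v × Letter u v, ∃ c > 0, p.1 ≠ p.2 →
      ¬ (p.1.IsParabolic ∧ p.2 = p.1.inv) → ∀ g ∈ starts h γ p.1, ∀ g' ∈ starts h γ p.2,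
        c * (normSq g * normSq g') ≤ normSq (g⁻¹ * g') := by
    rintro ⟨x, y⟩
    by_cases hxy : x ≠ y ∧ ¬ (x.IsParabolic ∧ y = x.inv)
    swap
    · exact ⟨1, one_pos, fun h1 h2 => absurd ⟨h1, h2⟩ hxy⟩
    -- A vanishing pairing would make both matrices the same rank one matrix, a touching point of
    -- `x` and `y`; these occur only for the excluded pairs.
    have hpos : ∀ q ∈ limCl (starts h γ x) ×ˢ limCl (starts h γ y), 0 < pairing q.1 q.2 := by
      rintro ⟨S, T⟩ ⟨hS, hT⟩
      by_contra! hcon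
      obtain ⟨w, hw1, hw2⟩ := exists_outer_of_pairing_nonpos (tr_limCl hS) (tr_limCl hT)
        (det_limCl hS) (det_limCl hT) (nonneg_limCl hS) hcon
      have hv : vsq w = 1 := by
        have := tr_limCl hS
        change tr S = 1 at this
        rwa [show S = outer w from hw1, tr_outer] at this
      have ht : Touch h γ x y w := ⟨hxy.1, hv, by rw [← hw1]; exact hS, by rw [← hw2]; exact hT⟩
      exact hxy.2 (ht.isParabolic hG)
    have hcomp := (isCompact_limCl (starts h γ x)).prod (isCompact_limCl (starts h γ y))
    have hx : (nrm (x.val h γ), nrm (y.val h γ)) ∈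
        limCl (starts h γ x) ×ˢ limCl (starts h γ y) :=
      ⟨subset_closure ⟨_, ⟨[], FreeGroup.IsReduced.singleton, by simp⟩, rfl⟩,
        subset_closure ⟨_, ⟨[], FreeGroup.IsReduced.singleton, by simp⟩, rfl⟩⟩
    obtain ⟨q, hq, hmin⟩ := hcomp.exists_isMinOn ⟨_, hx⟩ continuous_pairing.continuousOn
    refine ⟨pairing q.1 q.2, hpos q hq, fun _ _ g hg g' hg' => ?_⟩
    have h1 : pairing q.1 q.2 ≤ pairing (nrm g) (nrm g') :=
      hmin (show (nrm g, nrm g') ∈ limCl (starts h γ x) ×ˢ limCl (starts h γ y) from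
        ⟨subset_closure ⟨g, hg, rfl⟩, subset_closure ⟨g', hg', rfl⟩⟩)
    rw [nrm, nrm, pairing_smul, pairing_gram] at h1
    have h2 := normSq_pos g
    have h3 := normSq_pos g'
    rw [← mul_inv, inv_mul_eq_div, le_div_iff₀ (by positivity)] at h1
    exact h1
  choose c hc0 hc using main
  rcases isEmpty_or_nonempty (Letter u v × Letter u v) with he | hne
  · exact ⟨1, one_pos, fun x y => (he.false (x, y)).elim⟩
  obtain ⟨p, hp⟩ := Finite.exists_min c
  refine ⟨c p, hc0 p, fun x y h1 h2 g hg g' hg' => ?_⟩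
  refine le_trans ?_ (hc (x, y) h1 h2 g hg g' hg')
  have h2 := normSq_pos g
  have h3 := normSq_pos g'
  exact mul_le_mul_of_nonneg_right (hp _) (by positivity)

end IsFreeFuchsianGroup

/-! ### Block words -/

section Blocks

variable {u v : ℕ} {G : Subgroup SL(2, ℝ)} {h : Fin u → SL(2, ℝ)} {γ : Fin v → SL(2, ℝ)}

/-- The letter `l'` may begin the block after a block of the letter `l`. -/
def Adj (l l' : Letter u v) : Prop := l' ≠ l.inv ∧ (l.IsParabolic → l' ≠ l)

/-- A possible block. -/
def Block.Ok (b : Block u v) : Prop := 1 ≤ b.2 ∧ (¬ b.1.IsParabolic → b.2 = 1)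

/-- A word of blocks that can follow one another. -/
def Admissible (bs : List (Block u v)) : Prop :=
  (∀ b ∈ bs, Block.Ok b) ∧ bs.IsChain fun b b' => Adj b.1 b'.1

/-- The group element of a block word. -/
def blockElt (h : Fin u → SL(2, ℝ)) (γ : Fin v → SL(2, ℝ)) (bs : List (Block u v)) : SL(2, ℝ) :=
  (bs.map fun b => b.1.val h γ ^ b.2).prod

/-- The word in the letters of a block word. -/
def expand (bs : List (Block u v)) : List (Letter u v) :=
  bs.flatMap fun b => List.replicate b.2 b.1

@[simp] lemma blockElt_nil : blockElt h γ ([] : List (Block u v)) = 1 := rfl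

@[simp] lemma blockElt_cons (b : Block u v) (bs : List (Block u v)) :
    blockElt h γ (b :: bs) = b.1.val h γ ^ b.2 * blockElt h γ bs := by simp [blockElt]

lemma blockElt_append (bs bs' : List (Block u v)) :
    blockElt h γ (bs ++ bs') = blockElt h γ bs * blockElt h γ bs' := by simp [blockElt]

@[simp] lemma expand_cons (b : Block u v) (bs : List (Block u v)) :
    expand (b :: bs) = List.replicate b.2 b.1 ++ expand bs := by simp [expand]

@[simp] lemma expand_nil : expand ([] : List (Block u v)) = [] := rfl

lemma expand_append (bs bs' : List (Block u v)) :
    expand (bs ++ bs') = expand bs ++ expand bs' := by simp [expand]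

lemma wordProd_replicate (l : Letter u v) (n : ℕ) :
    wordProd h γ (List.replicate n l) = l.val h γ ^ n := by simp [wordProd]

lemma wordProd_expand (bs : List (Block u v)) : wordProd h γ (expand bs) = blockElt h γ bs := by
  induction bs with
  | nil => rfl
  | cons b bs ih => rw [expand_cons, wordProd_append, ih, wordProd_replicate, blockElt_cons]

lemma Admissible.tail {b : Block u v} {bs : List (Block u v)} (hb : Admissible (b :: bs)) :
    Admissible bs :=
  ⟨fun c hc => hb.1 c (List.mem_cons_of_mem _ hc), hb.2.tail⟩

lemma admissible_nil : Admissible ([] : List (Block u v)) := ⟨by simp, List.IsChain.nil⟩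

lemma Admissible.infix {bs bs' : List (Block u v)} (hb : Admissible bs') (hi : bs <:+: bs') :
    Admissible bs :=
  ⟨fun c hc => hb.1 c (hi.subset hc), hb.2.infix hi⟩

lemma Admissible.left {bs bs' : List (Block u v)} (hb : Admissible (bs ++ bs')) :
    Admissible bs := hb.infix ⟨[], bs', by simp⟩

lemma Admissible.right {bs bs' : List (Block u v)} (hb : Admissible (bs ++ bs')) :
    Admissible bs' := hb.infix ⟨bs, [], by simp⟩

lemma admissible_cons_cons {b b' : Block u v} {bs : List (Block u v)} :
    Admissible (b :: b' :: bs) ↔ Block.Ok b ∧ Adj b.1 b'.1 ∧ Admissible (b' :: bs) := by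
  simp only [Admissible, List.isChain_cons_cons, List.mem_cons, forall_eq_or_imp]
  tauto

lemma admissible_singleton {b : Block u v} : Admissible [b] ↔ Block.Ok b := by
  simp [Admissible]

lemma isReduced_replicate_append {l : Letter u v} {L : List (Letter u v)} (n : ℕ)
    (hL : FreeGroup.IsReduced (l :: L)) : FreeGroup.IsReduced (List.replicate n l ++ l :: L) := by
  induction n with
  | zero => simpa
  | succ n ih =>
    rw [List.replicate_succ, List.cons_append]
    cases n with
    | zero =>
      simp only [List.replicate_zero, List.nil_append]
      exact isReduced_cons_cons.mpr ⟨l.inv_ne.symm, hL⟩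
    | succ n =>
      rw [List.replicate_succ, List.cons_append] at ih ⊢
      exact isReduced_cons_cons.mpr ⟨l.inv_ne.symm, ih⟩

/-- Admissible block words expand to reduced words. -/
lemma Admissible.exists_expand {b : Block u v} {bs : List (Block u v)}
    (hb : Admissible (b :: bs)) :
    ∃ L, expand (b :: bs) = b.1 :: L ∧ FreeGroup.IsReduced (b.1 :: L) := by
  induction bs generalizing b with
  | nil =>
    have h1 := (hb.1 b (by simp)).1
    obtain ⟨n, hn⟩ := Nat.exists_eq_add_of_le' h1
    refine ⟨List.replicate n b.1, ?_, ?_⟩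
    · rw [expand_cons, hn, List.replicate_succ]; simp
    · have := isReduced_replicate_append n (FreeGroup.IsReduced.singleton (a := b.1))
      rwa [← List.replicate_succ, List.replicate_succ'] 
  | cons b' bs ih =>
    rw [admissible_cons_cons] at hb
    obtain ⟨L, hL, hred⟩ := ih hb.2.2
    obtain ⟨n, hn⟩ := Nat.exists_eq_add_of_le' hb.1.1
    refine ⟨List.replicate n b.1 ++ b'.1 :: L, ?_, ?_⟩
    · rw [expand_cons, hL, hn, List.replicate_succ]; simp
    · have h1 : FreeGroup.IsReduced (b.1 :: b'.1 :: L) := isReduced_cons_cons.mpr ⟨hb.2.1.1, hred⟩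
      have := isReduced_replicate_append n h1
      rwa [List.append_cons, ← List.replicate_succ', List.replicate_succ, List.cons_append] at this

lemma Admissible.isReduced {bs : List (Block u v)} (hb : Admissible bs) :
    FreeGroup.IsReduced (expand bs) := by
  cases bs with
  | nil => exact FreeGroup.IsReduced.nil
  | cons b bs =>
    obtain ⟨L, h1, h2⟩ := hb.exists_expand
    rwa [h1]

lemma Admissible.length_le {bs : List (Block u v)} (hb : Admissible bs) :
    bs.length ≤ (expand bs).length := by
  induction bs with
  | nil => simp
  | cons b bs ih =>
    have := (hb.1 b (by simp)).1
    have := ih hb.tail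
    simp only [List.length_cons, expand_cons, List.length_append, List.length_replicate]
    omega

lemma exists_expand_concat {b : Block u v} (bs : List (Block u v)) (hb : 1 ≤ b.2) :
    ∃ L, expand (bs ++ [b]) = L ++ [b.1] := by
  obtain ⟨n, hn⟩ := Nat.exists_eq_add_of_le' hb
  refine ⟨expand bs ++ List.replicate n b.1, ?_⟩
  rw [expand_append, expand_cons, hn, List.replicate_succ']
  simp

/-- A letter over a different generator may always follow; this is where having at least two
generators matters. -/
lemma exists_adj (hu : 1 < u + v) (l : Letter u v) : ∃ l' : Letter u v, Adj l l' := by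
  obtain ⟨a, s⟩ := l
  have : ∃ a' : Fin u ⊕ Fin v, a' ≠ a := by
    have hcard : 1 < Fintype.card (Fin u ⊕ Fin v) := by simpa using hu
    exact Fintype.exists_ne_of_one_lt_card hcard a
  obtain ⟨a', ha'⟩ := this
  refine ⟨(a', true), ?_, ?_⟩
  · intro he; exact ha' (congrArg Prod.fst he)
  · intro _ he; exact ha' (congrArg Prod.fst he)

/-- The distance by which an element moves the base point. -/
def disp (g : SL(2, ℝ)) : ℝ := dist (g • I) I

lemma disp_nonneg (g : SL(2, ℝ)) : 0 ≤ disp g := dist_nonneg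

lemma disp_mul_le (g g' : SL(2, ℝ)) : disp (g * g') ≤ disp g + disp g' := by
  have := dist_triangle ((g * g') • I) (g • I) I
  rw [mul_smul, dist_smul] at this
  rw [disp, mul_smul, disp, disp]
  linarith

@[simp] lemma disp_one : disp 1 = 0 := by simp [disp]

lemma exp_disp_le (g : SL(2, ℝ)) : exp (disp g) ≤ normSq g := by
  have h1 := cosh_dist_smul_I g
  rw [Real.cosh_eq] at h1
  have := Real.exp_pos (-dist (g • I) I)
  change exp (dist (g • I) I) ≤ _
  linarith

lemma normSq_le_exp_disp (g : SL(2, ℝ)) : normSq g ≤ 2 * exp (disp g) := by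
  have h1 := cosh_dist_smul_I g
  rw [Real.cosh_eq] at h1
  have : exp (-dist (g • I) I) ≤ exp (dist (g • I) I) :=
    Real.exp_le_exp.mpr (by linarith [dist_nonneg (x := g • I) (y := I)])
  change _ ≤ 2 * exp (dist (g • I) I)
  linarith

end Blocks

namespace IsFreeFuchsianGroup

variable {u v : ℕ} {G : Subgroup SL(2, ℝ)} {h : Fin u → SL(2, ℝ)} {γ : Fin v → SL(2, ℝ)}

lemma inv_mem_starts {l : Letter u v} {L : List (Letter u v)}
    (hL : FreeGroup.IsReduced (L ++ [l])) : (wordProd h γ (L ++ [l]))⁻¹ ∈ starts h γ l.inv := by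
  have e1 : FreeGroup.invRev (L ++ [l]) = l.inv :: FreeGroup.invRev L := by
    simp [FreeGroup.invRev, Letter.inv]
  refine ⟨FreeGroup.invRev L, ?_, ?_⟩
  · rw [← e1]
    apply FreeGroup.IsReduced.of_reduce_eq
    rw [FreeGroup.reduce_invRev, hL.reduce_eq]
  · rw [← e1, wordProd_eq_lift, wordProd_eq_lift, ← FreeGroup.inv_mk, map_inv]

variable (hG : IsFreeFuchsianGroup G h γ)
include hG

/-- Quasi-additivity of the displacement on block words. -/
lemma exists_disp_append_ge : ∃ C : ℝ, 0 ≤ C ∧ ∀ bs bs' : List (Block u v),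
    Admissible (bs ++ bs') →
      disp (blockElt h γ bs) + disp (blockElt h γ bs') ≤ disp (blockElt h γ (bs ++ bs')) + C := by
  obtain ⟨c, hc, hF⟩ := hG.exists_normSq_mul_ge
  refine ⟨max 0 (Real.log (2 / c)), le_max_left _ _, fun bs bs' hadm => ?_⟩
  rcases List.eq_nil_or_concat bs with h0 | ⟨bs₀, b, h0⟩
  · subst h0
    simp
  rw [List.concat_eq_append] at h0
  subst h0
  cases bs' with
  | nil =>
    simp
  | cons b' bs' =>
    have h1 := hadm.left
    have h2 := hadm.right
    have hadj : Adj b.1 b'.1 := by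
      have := hadm.infix (bs := [b, b']) ⟨bs₀, bs', by simp⟩
      exact (admissible_cons_cons.mp this).2.1
    obtain ⟨L, hL⟩ := exists_expand_concat (b := b) bs₀ (h1.1 b (by simp)).1
    obtain ⟨L', hL', hred'⟩ := h2.exists_expand
    have hred := h1.isReduced
    have hg1 : (blockElt h γ (bs₀ ++ [b]))⁻¹ ∈ starts h γ b.1.inv := by
      rw [hL] at hred
      rw [← wordProd_expand, hL]
      exact inv_mem_starts hred
    have hg2 : blockElt h γ (b' :: bs') ∈ starts h γ b'.1 := by
      rw [← wordProd_expand, hL']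
      exact ⟨L', hred', rfl⟩
    -- The inverse of the first factor starts with the inverse of its last letter. The two
    -- conditions in `Adj` are precisely those under which quasi-multiplicativity holds for this
    -- pair.
    have key := hF b.1.inv b'.1 hadj.1.symm (fun hp => hadj.2 hp.1 (by
      rw [hp.2, Letter.inv_inv])) _ hg1 _ hg2
    rw [inv_inv, normSq_inv, ← blockElt_append] at key
    set g₁ := blockElt h γ (bs₀ ++ [b])
    set g₂ := blockElt h γ (b' :: bs')
    set g₃ := blockElt h γ (bs₀ ++ [b] ++ b' :: bs')
    have e1 := exp_disp_le g₁
    have e2 := exp_disp_le g₂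
    have e3 := normSq_le_exp_disp g₃
    have p1 := Real.exp_pos (disp g₁)
    have p2 := Real.exp_pos (disp g₂)
    have e4 : exp (disp g₁ + disp g₂) ≤ exp (disp g₃ + Real.log (2 / c)) := by
      rw [Real.exp_add, Real.exp_add, Real.exp_log (by positivity)]
      have : exp (disp g₁) * exp (disp g₂) ≤ normSq g₁ * normSq g₂ :=
        mul_le_mul e1 e2 p2.le (normSq_pos g₁).le
      have : c * (exp (disp g₁) * exp (disp g₂)) ≤ 2 * exp (disp g₃) := by nlinarith
      rw [mul_div_assoc', le_div_iff₀ hc]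
      linarith
    have := Real.exp_le_exp.mp e4
    linarith [le_max_right 0 (Real.log (2 / c))]

end IsFreeFuchsianGroup

/-! ### Cusps -/

section HalfPlanes

/-- A half plane inside a vertical strip lies inside a half disc. -/
lemma halfplane_in_strip {p q : ℍ} {T : ℝ} (hT : 0 < T) (hne : ∃ z, gap p q z < 0)
    (hs : ∀ z, gap p q z < 0 → |z.re| ≤ T) {z : ℍ} :
    (gap p q z ≤ 0 → z.re ^ 2 + z.im ^ 2 ≤ T ^ 2) ∧
      (gap p q z < 0 → z.re ^ 2 + z.im ^ 2 < T ^ 2) := by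
  have hp := p.im_pos
  have hq := q.im_pos
  set A := q.im - p.im with hA
  set B := 2 * (p.im * q.re - q.im * p.re) with hB
  set C := q.im * (p.re ^ 2 + p.im ^ 2) - p.im * (q.re ^ 2 + q.im ^ 2) with hC
  have hgap : ∀ z : ℍ, gap p q z * (2 * z.im * p.im * q.im) =
      A * (z.re ^ 2 + z.im ^ 2) + B * z.re + C := by
    intro z
    have := z.im_pos
    rw [gap, UpperHalfPlane.cosh_dist', UpperHalfPlane.cosh_dist', hA, hB, hC]
    field_simp
    ring
  have hpos : ∀ z : ℍ, 0 < 2 * z.im * p.im * q.im := fun z => by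
    have := z.im_pos
    positivity
  have hneg : ∀ z : ℍ, gap p q z < 0 ↔ A * (z.re ^ 2 + z.im ^ 2) + B * z.re + C < 0 := by
    intro z
    rw [← hgap]
    refine ⟨fun h1 => mul_neg_of_neg_of_pos h1 (hpos z), fun h1 => ?_⟩
    by_contra! h2
    exact (mul_nonneg h2 (hpos z).le).not_gt h1
  have hnonpos : ∀ z : ℍ, gap p q z ≤ 0 ↔ A * (z.re ^ 2 + z.im ^ 2) + B * z.re + C ≤ 0 := by
    intro z
    rw [← hgap]
    refine ⟨fun h1 => mul_nonpos_of_nonpos_of_nonneg h1 (hpos z).le, fun h1 => ?_⟩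
    by_contra! h2
    exact (mul_pos h2 (hpos z)).not_ge h1
  have hmem : ∀ x y : ℝ, 0 < y → A * (x ^ 2 + y ^ 2) + B * x + C < 0 → |x| ≤ T := by
    intro x y hy hxy
    exact hs ⟨⟨x, y⟩, hy⟩ ((hneg ⟨⟨x, y⟩, hy⟩).mpr hxy)
  -- If `A ≤ 0`, moving a point of the half plane horizontally in the direction favoured by `B`
  -- keeps it inside and leaves the strip.
  have hApos : 0 < A := by
    by_contra! hA0
    obtain ⟨z, hz⟩ := hne
    rw [hneg] at hz
    have hx0 := abs_nonneg z.re
    have h1 := neg_abs_le z.re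
    have h2 := le_abs_self z.re
    have h3 : z.re ^ 2 ≤ (|z.re| + T + 1) ^ 2 := by
      rw [← sq_abs z.re]
      gcongr
      linarith
    rcases le_total 0 B with hB0 | hB0
    · have := hmem (-(|z.re| + T + 1)) z.im z.im_pos (by nlinarith)
      rw [abs_neg, abs_of_pos (by linarith)] at this
      linarith
    · have := hmem (|z.re| + T + 1) z.im z.im_pos (by nlinarith)
      rw [abs_of_pos (by linarith)] at this
      linarith
  have main : ∀ z : ℍ, gap p q z ≤ 0 → z.re ^ 2 + z.im ^ 2 ≤ T ^ 2 := by
    intro z hz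
    rw [hnonpos] at hz
    by_contra! hcon
    set R := z.re ^ 2 + z.im ^ 2 with hR
    have hR1 : |z.re| < √R := by
      rw [← Real.sqrt_sq_eq_abs]
      apply Real.sqrt_lt_sqrt (sq_nonneg _)
      have := z.im_pos
      have : 0 < z.im ^ 2 := by positivity
      linarith
    have hR2 : T < √R := Real.lt_sqrt_of_sq_lt hcon
    obtain ⟨ρ, hρ1, hρ2⟩ := exists_between (max_lt hR1 hR2)
    rw [max_lt_iff] at hρ1
    have hρ0 : 0 < ρ := hT.trans hρ1.2
    have hρ3 : ρ ^ 2 < R := by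
      rw [← Real.lt_sqrt hρ0.le]; exact hρ2
    -- A point with `|z|² = R > T²` can be slid down to a point of real part `±ρ`, `T < ρ < √R`, of
    -- smaller modulus. It is still in the half plane but outside the strip.
    have key : ∀ x : ℝ, |x| = ρ → B * x ≤ B * z.re → False := by
      intro x hx hBx
      have hx2 : x ^ 2 = ρ ^ 2 := by rw [← hx, sq_abs]
      have h2 : 0 < (R - ρ ^ 2) / 2 := by linarith
      have := hmem x (√((R - ρ ^ 2) / 2)) (Real.sqrt_pos.mpr h2) (by
        rw [Real.sq_sqrt h2.le, hx2]
        nlinarith)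
      rw [hx] at this
      linarith [hρ1.2]
    rcases le_total 0 B with hB0 | hB0
    · refine key (-ρ) (by rw [abs_neg, abs_of_pos hρ0]) ?_
      have := neg_abs_le z.re
      nlinarith [hρ1.1]
    · refine key ρ (abs_of_pos hρ0) ?_
      have := le_abs_self z.re
      nlinarith [hρ1.1]
  refine ⟨main z, fun hz => ?_⟩
  rw [hneg] at hz
  have hz0 := z.im_pos
  set R := z.re ^ 2 + z.im ^ 2 with hR
  set E := -(A * R + B * z.re + C) with hE
  have hE0 : 0 < E := by linarith
  have hpos2 : 0 < z.im ^ 2 + E / A := by positivity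
  -- An interior point can be raised by exactly the slack `E` before it reaches the boundary, so its
  -- own modulus is strictly smaller.
  have := main ⟨⟨z.re, √(z.im ^ 2 + E / A)⟩, Real.sqrt_pos.mpr hpos2⟩ (by
    rw [hnonpos]
    change A * (z.re ^ 2 + √(z.im ^ 2 + E / A) ^ 2) + B * z.re + C ≤ 0
    rw [Real.sq_sqrt hpos2.le]
    have : A * (E / A) = E := by field_simp
    nlinarith)
  change z.re ^ 2 + √(z.im ^ 2 + E / A) ^ 2 ≤ T ^ 2 at this
  rw [Real.sq_sqrt hpos2.le] at this
  have : 0 < E / A := by positivity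
  linarith

/-- The squared modulus in the chart `k`. -/
def chartSq (k : SL(2, ℝ)) (z : ℍ) : ℝ := (k⁻¹ • z).re ^ 2 + (k⁻¹ • z).im ^ 2

/-- The point `i t` in the chart `k`. -/
def chartPt (k : SL(2, ℝ)) (t : ℝ) : ℍ := geo k (Real.log t)

/-- The circle of radius `T`, the geometric mean of `2 T` and `T / 2`, is the bisector of these two
points of the imaginary axis. So half discs and their complements are half planes described by
`gap`. -/
lemma gap_chartPt (k : SL(2, ℝ)) {T : ℝ} (hT : 0 < T) (z : ℍ) :
    gap (chartPt k (2 * T)) (chartPt k (T / 2)) z * (4 * T * (k⁻¹ • z).im) =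
      3 * (T ^ 2 - chartSq k z) := by
  have hy := (k⁻¹ • z).im_pos
  have h1 : gap (chartPt k (2 * T)) (chartPt k (T / 2)) z =
      gap (vert (Real.log (2 * T))) (vert (Real.log (T / 2))) (k⁻¹ • z) := by
    rw [← gap_smul k⁻¹, chartPt, chartPt, geo, geo, inv_smul_smul, inv_smul_smul]
  rw [h1, gap, UpperHalfPlane.cosh_dist', UpperHalfPlane.cosh_dist', chartSq]
  simp only [vert_re, vert_im]
  rw [Real.exp_log (by positivity), Real.exp_log (by positivity)]
  field_simp
  ring

lemma gap_chartPt_nonneg (k : SL(2, ℝ)) {T : ℝ} (hT : 0 < T) (z : ℍ) :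
    0 ≤ gap (chartPt k (2 * T)) (chartPt k (T / 2)) z ↔ chartSq k z ≤ T ^ 2 := by
  have hy := (k⁻¹ • z).im_pos
  have := gap_chartPt k hT z
  rw [← mul_nonneg_iff_of_pos_right (show 0 < 4 * T * (k⁻¹ • z).im by positivity), this]
  constructor <;> intro <;> linarith

lemma gap_chartPt_nonpos (k : SL(2, ℝ)) {T : ℝ} (hT : 0 < T) (z : ℍ) :
    gap (chartPt k (2 * T)) (chartPt k (T / 2)) z ≤ 0 ↔ T ^ 2 ≤ chartSq k z := by
  have hy := (k⁻¹ • z).im_pos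
  have := gap_chartPt k hT z
  rw [← neg_nonneg, ← mul_nonneg_iff_of_pos_right (show 0 < 4 * T * (k⁻¹ • z).im by positivity),
    neg_mul, this]
  constructor <;> intro <;> linarith

lemma chartSq_chartPt (k : SL(2, ℝ)) {t : ℝ} (ht : 0 < t) : chartSq k (chartPt k t) = t ^ 2 := by
  rw [chartSq, chartPt, geo, inv_smul_smul, vert_re, vert_im, Real.exp_log ht]
  ring

/-- `g` is the parabolic translation by `τ` in the chart `k` about `i`. -/
structure IsCuspChart (g k : SL(2, ℝ)) (τ : ℝ) : Prop where
  fixes : k • I = I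
  ne_zero : τ ≠ 0
  translation : ∀ (n : ℤ) (z : ℍ), (k⁻¹ • g ^ n • z).re = (k⁻¹ • z).re + n * τ ∧
    (k⁻¹ • g ^ n • z).im = (k⁻¹ • z).im

/-- Rotating the eigenvector of `g` to the first basis vector makes `g` upper triangular with
diagonal `δ, δ`, `δ = ±1`. The remaining entry is nonzero because `g` is not scalar. -/
lemma exists_isCuspChart {g : SL(2, ℝ)} (hg : g.val.IsParabolic) : ∃ k τ, IsCuspChart g k τ := by
  have hdet := det_entries g
  obtain ⟨hns, hd⟩ := hg
  have hd' : (g 0 0 - g 1 1) ^ 2 + 4 * (g 0 1 * g 1 0) = 0 := by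
    have h1 : g.val.discr = (g 0 0 + g 1 1) ^ 2 - 4 := by
      rw [Matrix.discr_fin_two, Matrix.trace_fin_two, g.2]; ring
    rw [hd] at h1
    nlinarith
  have hw : ∃ w : ℝ × ℝ, w ≠ 0 ∧ app g w = ((g 0 0 + g 1 1) / 2) • w := by
    by_cases hc : g 1 0 = 0
    · refine ⟨(1, 0), by simp, ?_⟩
      have : g 0 0 = g 1 1 := by
        rw [hc] at hd'
        have : (g 0 0 - g 1 1) ^ 2 = 0 := by linarith
        have := pow_eq_zero_iff (two_ne_zero) |>.mp this
        linarith
      simp [app, hc, this]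
    · refine ⟨((g 0 0 - g 1 1) / 2, g 1 0), by simp [hc], ?_⟩
      simp only [app, Prod.smul_mk, smul_eq_mul, Prod.mk.injEq]
      constructor <;> linarith
  obtain ⟨w, hw0, hgw⟩ := hw
  set δ := (g 0 0 + g 1 1) / 2 with hδ
  have hδ2 : δ ^ 2 = 1 := by rw [hδ]; nlinarith
  have hp := vsq_pos hw0
  set r := √(vsq w) with hr
  have hr2 : r ^ 2 = vsq w := Real.sq_sqrt hp.le
  have hr0 : 0 < r := Real.sqrt_pos.mpr hp
  have hr3 : r ^ 2 = w.1 ^ 2 + w.2 ^ 2 := hr2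
  set x := w.1 / r with hx
  set y := w.2 / r with hy
  have hxy : x ^ 2 + y ^ 2 = 1 := by rw [hx, hy]; field_simp; linarith
  have e1 : g 0 0 * x + g 0 1 * y = δ * x := by
    have := congrArg Prod.fst hgw
    simp only [app, Prod.smul_fst, smul_eq_mul] at this
    rw [hx, hy]; field_simp; linarith
  have e2 : g 1 0 * x + g 1 1 * y = δ * y := by
    have := congrArg Prod.snd hgw
    simp only [app, Prod.smul_snd, smul_eq_mul] at this
    rw [hx, hy]; field_simp; linarith
  let k : SL(2, ℝ) := ⟨!![x, -y; y, x], by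
    rw [Matrix.det_fin_two]
    simp
    linarith⟩
  have k00 : k 0 0 = x := rfl
  have k01 : k 0 1 = -y := rfl
  have k10 : k 1 0 = y := rfl
  have k11 : k 1 1 = x := rfl
  have hk : k • I = I := by
    apply UpperHalfPlane.ext
    apply Complex.ext
    · change (k • I).re = I.re
      rw [smul_re, k00, k01, k10, k11]
      simp only [UpperHalfPlane.I_re, UpperHalfPlane.I_im]
      rw [div_eq_zero_iff]; left; ring
    · change (k • I).im = I.im
      rw [smul_im, k10, k11]
      simp [hxy]
  set p := k⁻¹ * g * k with hpdef
  obtain ⟨i1, i2, i3, i4⟩ := inv_entry k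
  have p00 : p 0 0 = δ := by
    simp only [hpdef, mul_entry, i1, i2, k00, k10, k11, k01]
    linear_combination x * e1 + y * e2 + δ * hxy
  have p10 : p 1 0 = 0 := by
    simp only [hpdef, mul_entry, i3, i4, k00, k10]
    linear_combination -y * e1 + x * e2
  have p11 : p 1 1 = δ := by
    have h1 := det_entries p
    rw [p00, p10] at h1
    have : δ * (p 1 1 - δ) = 0 := by linarith
    rcases mul_eq_zero.mp this with h0 | h0
    · rw [h0] at hδ2; norm_num at hδ2
    · linarith
  have hδ0 : δ ≠ 0 := fun h0 => by rw [h0] at hδ2; norm_num at hδ2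
  have p01 : p 0 1 ≠ 0 := by
    intro h0
    apply hns
    refine ⟨δ, ?_⟩
    have hpe : p.val = Matrix.scalar (Fin 2) δ := by
      ext i j
      fin_cases i <;> fin_cases j
      · simpa using p00
      · simpa using h0
      · simpa using p10
      · simpa using p11
    have hkp : k * p = g * k := by rw [hpdef, ← mul_assoc, mul_inv_cancel_left]
    have h3 : k.val * p.val = g.val * k.val := congrArg Subtype.val hkp
    rw [hpe, ← (Matrix.scalar_commute δ (fun r' => Commute.all _ _) k.val).eq] at h3
    have h4 := congrArg (· * (k⁻¹).val) h3
    simp only [Matrix.mul_assoc] at h4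
    rw [← Matrix.SpecialLinearGroup.coe_mul, mul_inv_cancel, Matrix.SpecialLinearGroup.coe_one,
      Matrix.mul_one, Matrix.mul_one] at h4
    exact h4
  have hstep : ∀ z : ℍ, (p • z).re = z.re + p 0 1 / δ ∧ (p • z).im = z.im := by
    intro z
    rw [smul_re, smul_im, p00, p10, p11]
    simp only [zero_mul, zero_add, mul_zero, ne_eq, OfNat.ofNat_ne_zero, not_false_eq_true,
      zero_pow, add_zero]
    constructor
    · field_simp
    · rw [hδ2, div_one]
  have hconj : ∀ (z : ℍ), k⁻¹ • g • z = p • k⁻¹ • z := by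
    intro z
    rw [hpdef, smul_smul, smul_smul]
    congr 1
    group
  refine ⟨k, p 0 1 / δ, hk, div_ne_zero p01 hδ0, fun n => ?_⟩
  induction n using Int.induction_on with
  | zero => intro z; simp
  | succ n ih =>
    intro z
    rw [zpow_add_one, mul_smul, (ih _).1, (ih _).2, hconj, (hstep _).1, (hstep _).2]
    refine ⟨?_, rfl⟩
    push_cast; ring
  | pred n ih =>
    intro z
    have := ih (g⁻¹ • z)
    have h5 := hstep (k⁻¹ • g⁻¹ • z)
    rw [← hconj, smul_inv_smul] at h5
    rw [zpow_sub_one, mul_smul, (ih _).1, (ih _).2, h5.1, h5.2]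
    refine ⟨?_, rfl⟩
    push_cast; ring

end HalfPlanes

/-! ### The displacement of block words -/

section Winding

variable {u v : ℕ}

/-- `∑ 2 log⁺ a` over the blocks of a word. -/
def windSum (bs : List (Block u v)) : ℝ := (bs.map fun b => 2 * Real.posLog (winding b : ℝ)).sum

/-- The number of blocks of length at least two. -/
def longCount (bs : List (Block u v)) : ℕ := bs.countP fun b => 2 ≤ b.2

@[simp] lemma windSum_nil : windSum ([] : List (Block u v)) = 0 := rfl

@[simp] lemma windSum_cons (b : Block u v) (bs : List (Block u v)) :
    windSum (b :: bs) = 2 * Real.posLog (winding b : ℝ) + windSum bs := by simp [windSum]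

lemma windSum_append (bs bs' : List (Block u v)) :
    windSum (bs ++ bs') = windSum bs + windSum bs' := by simp [windSum]

lemma windSum_nonneg (bs : List (Block u v)) : 0 ≤ windSum bs := by
  induction bs with
  | nil => simp
  | cons b bs ih =>
    rw [windSum_cons]
    have := Real.posLog_nonneg (x := (winding b : ℝ))
    linarith

lemma windSum_eq_zero {bs : List (Block u v)} (hb : ∀ b ∈ bs, ¬ 2 ≤ b.2) : windSum bs = 0 := by
  induction bs with
  | nil => simp
  | cons b bs ih =>
    have h1 := hb b (by simp)
    have : winding b = 0 := by rw [winding]; omega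
    rw [windSum_cons, ih fun c hc => hb c (List.mem_cons_of_mem _ hc), this]
    simp

@[simp] lemma longCount_nil : longCount ([] : List (Block u v)) = 0 := rfl

lemma longCount_cons (b : Block u v) (bs : List (Block u v)) :
    longCount (b :: bs) = longCount bs + if 2 ≤ b.2 then 1 else 0 := by
  simp [longCount, List.countP_cons]

lemma longCount_append (bs bs' : List (Block u v)) :
    longCount (bs ++ bs') = longCount bs + longCount bs' := by simp [longCount]

/-- Either there are many long blocks, or there is a long stretch of short blocks. -/
lemma exists_short_stretch (R Q : ℕ) (bs : List (Block u v)) (hl : bs.length = Q * R)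
    (hc : longCount bs < Q) :
    ∃ l m r, bs = l ++ m ++ r ∧ m.length = R ∧ ∀ b ∈ m, ¬ 2 ≤ b.2 := by
  induction Q generalizing bs with
  | zero => omega
  | succ Q ih =>
    have hlen : (bs.take R).length = R := by
      rw [List.length_take, hl]
      exact min_eq_left (by nlinarith)
    by_cases hs : ∀ b ∈ bs.take R, ¬ 2 ≤ b.2
    · exact ⟨[], bs.take R, bs.drop R, by simp, hlen, hs⟩
    · push Not at hs
      obtain ⟨b, hb, hb2⟩ := hs
      have h1 : 0 < longCount (bs.take R) := by
        rw [longCount, List.countP_pos_iff]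
        exact ⟨b, hb, by simpa using hb2⟩
      have h2 : longCount bs = longCount (bs.take R) + longCount (bs.drop R) := by
        rw [← longCount_append, List.take_append_drop]
      obtain ⟨l, m, r, he, hm⟩ := ih (bs.drop R) (by
        rw [List.length_drop, hl, Nat.succ_mul]; omega) (by omega)
      refine ⟨bs.take R ++ l, m, r, ?_, hm⟩
      conv_lhs => rw [← List.take_append_drop R bs, he]
      simp

end Winding

/-! ### Geometry in the chart of one cusp -/

section Charts

lemma IsCuspChart.inv_smul_I {g k : SL(2, ℝ)} {τ : ℝ} (hk : IsCuspChart g k τ) : k⁻¹ • I = I := by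
  rw [inv_smul_eq_iff, hk.fixes]

lemma IsCuspChart.pos {g k : SL(2, ℝ)} {τ : ℝ} (hk : IsCuspChart g k τ) : 0 < |τ| / 2 := by
  have := abs_pos.mpr hk.ne_zero
  positivity

lemma IsCuspChart.gap_eq {g k : SL(2, ℝ)} {τ : ℝ} (hk : IsCuspChart g k τ) (n : ℤ) (z : ℍ) :
    gap (g ^ n • I) I z * (2 * (k⁻¹ • z).im) = (n * τ) ^ 2 - 2 * (n * τ) * (k⁻¹ • z).re := by
  have h1 := hk.translation n I
  rw [hk.inv_smul_I] at h1
  have hy := (k⁻¹ • z).im_pos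
  rw [← gap_smul k⁻¹, hk.inv_smul_I, gap, UpperHalfPlane.cosh_dist', UpperHalfPlane.cosh_dist',
    h1.1, h1.2]
  simp only [UpperHalfPlane.I_re, UpperHalfPlane.I_im]
  field_simp
  ring

lemma IsCuspChart.abs_re_le {g k : SL(2, ℝ)} {τ : ℝ} (hk : IsCuspChart g k τ) {z : ℍ}
    (h1 : 0 ≤ gap (g • I) I z) (h2 : 0 ≤ gap (g⁻¹ • I) I z) : |(k⁻¹ • z).re| ≤ |τ| / 2 := by
  have hy := (k⁻¹ • z).im_pos
  have e1 := hk.gap_eq 1 z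
  have e2 := hk.gap_eq (-1) z
  rw [zpow_one] at e1
  rw [zpow_neg_one] at e2
  push_cast at e1 e2
  have p1 := mul_nonneg h1 (show 0 ≤ 2 * (k⁻¹ • z).im by positivity)
  have p2 := mul_nonneg h2 (show 0 ≤ 2 * (k⁻¹ • z).im by positivity)
  have ht := abs_pos.mpr hk.ne_zero
  have h3 : |τ| * |(k⁻¹ • z).re| ≤ |τ| * (|τ| / 2) := by
    rw [← abs_mul, mul_div_assoc', abs_mul_abs_self, abs_le]
    constructor <;> nlinarith
  exact le_of_mul_le_mul_left h3 ht

lemma IsCuspChart.cosh_disp {g k : SL(2, ℝ)} {τ : ℝ} (hk : IsCuspChart g k τ) (n : ℤ) :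
    cosh (disp (g ^ n)) = 1 + (n * τ) ^ 2 / 2 := by
  have h1 := hk.translation n I
  rw [hk.inv_smul_I] at h1
  rw [disp, ← dist_smul k⁻¹, hk.inv_smul_I, UpperHalfPlane.cosh_dist', h1.1, h1.2]
  simp
  ring

/-- Crossing a cusp takes a long time. -/
lemma IsCuspChart.le_dist {g k : SL(2, ℝ)} {τ : ℝ} (hk : IsCuspChart g k τ) {n : ℤ} {N : ℕ}
    (hn : |n| = N) (hN : 1 ≤ N) {z w : ℍ} (hz : chartSq k z ≤ (|τ| / 2) ^ 2)
    (hw : chartSq k w ≤ (|τ| / 2) ^ 2) :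
    1 + 2 * ((N - 1 : ℕ) : ℝ) ^ 2 ≤ cosh (dist z (g ^ n • w)) := by
  have hT := hk.pos
  set T := |τ| / 2 with hTdef
  obtain ⟨h1, h2⟩ := hk.translation n w
  rw [← dist_smul k⁻¹, UpperHalfPlane.cosh_dist', h1, h2]
  have hy := (k⁻¹ • z).im_pos
  have hy' := (k⁻¹ • w).im_pos
  rw [chartSq] at hz hw
  set x := (k⁻¹ • z).re
  set y := (k⁻¹ • z).im
  set x' := (k⁻¹ • w).re
  set y' := (k⁻¹ • w).im
  have hyT : y ≤ T := abs_le_of_sq_le_sq' (by nlinarith [sq_nonneg x]) hT.le |>.2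
  have hyT' : y' ≤ T := abs_le_of_sq_le_sq' (by nlinarith [sq_nonneg x']) hT.le |>.2
  have hxT : |x| ≤ T := abs_le_of_sq_le_sq (by nlinarith [sq_nonneg y]) hT.le
  have hxT' : |x'| ≤ T := abs_le_of_sq_le_sq (by nlinarith [sq_nonneg y']) hT.le
  rw [Nat.cast_sub hN, Nat.cast_one]
  have hN' : (1 : ℝ) ≤ N := by exact_mod_cast hN
  have hnR : |(n : ℝ)| = N := by exact_mod_cast congrArg (Int.cast (R := ℝ)) hn
  have e1 : |(n : ℝ) * τ| = 2 * T * N := by rw [abs_mul, hnR, hTdef]; ring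
  -- The shift is `2 T N` and each real part takes away at most `T`. With both heights at most `T`,
  -- `cosh - 1` is at least `(2 T (N - 1))² / (2 T²)`.
  have hdx : 2 * T * (N - 1) ≤ |x - (x' + n * τ)| := by
    have t1 := abs_sub_abs_le_abs_sub ((n : ℝ) * τ) (x - x')
    have t2 := abs_sub x x'
    rw [show (n : ℝ) * τ - (x - x') = -(x - (x' + n * τ)) by ring, abs_neg] at t1
    rw [e1] at t1
    nlinarith
  have hdx2 : (2 * T * (N - 1)) ^ 2 ≤ (x - (x' + n * τ)) ^ 2 := by
    rw [← sq_abs (x - _)]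
    have : 0 ≤ 2 * T * ((N : ℝ) - 1) := by
      have : 0 ≤ (N : ℝ) - 1 := by linarith
      positivity
    gcongr
  rw [le_div_iff₀ (by positivity)]
  have hyy : y * y' ≤ T ^ 2 := by nlinarith
  have hm : ((N : ℝ) - 1) ^ 2 * (y * y') ≤ ((N : ℝ) - 1) ^ 2 * T ^ 2 := by gcongr
  nlinarith [sq_nonneg (y - y')]

end Charts

/-! ### Half discs at different cusps, and the cost of passing cusps -/

namespace IsFreeFuchsianGroup

variable {u v : ℕ} {G : Subgroup SL(2, ℝ)} {h : Fin u → SL(2, ℝ)} {γ : Fin v → SL(2, ℝ)}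

lemma val_pow_eq_zpow (l : Letter u v) {j : Fin v} (hl : l.1 = Sum.inr j) (N : ℕ) :
    ∃ n : ℤ, |n| = N ∧ l.val h γ ^ N = γ j ^ n := by
  obtain ⟨a, s⟩ := l
  obtain rfl : a = Sum.inr j := hl
  cases s
  · exact ⟨-N, by simp, by simp [Letter.val]⟩
  · exact ⟨N, by simp, by simp [Letter.val]⟩

variable (hG : IsFreeFuchsianGroup G h γ)

/-- The point `z` has not yet entered the region belonging to the letter `l`. -/
def Outside (h : Fin u → SL(2, ℝ)) (γ : Fin v → SL(2, ℝ)) (k : Fin v → SL(2, ℝ)) (τ : Fin v → ℝ)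
    (l : Letter u v) (z : ℍ) : Prop :=
  (¬ l.IsParabolic → 0 ≤ gap (l.val h γ • I) I z) ∧
    ∀ j, l.1 = Sum.inr j → chartSq (k j) z ≤ (|τ j| / 2) ^ 2

section

variable {k : Fin v → SL(2, ℝ)} {τ : Fin v → ℝ} (hk : ∀ j, IsCuspChart (γ j) (k j) (τ j))
include hG hk

lemma strip_of_gap_nonpos {l : Letter u v} {j : Fin v} (hl : l.1 ≠ Sum.inr j) {z : ℍ}
    (hz : gap (l.val h γ • I) I z ≤ 0) : |((k j)⁻¹ • z).re| ≤ |τ j| / 2 := by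
  refine (hk j).abs_re_le ?_ ?_
  · exact (hG.gap_pos_of_gap_nonpos (l' := (Sum.inr j, true)) (fun e => hl (by rw [← e])) hz).le
  · exact (hG.gap_pos_of_gap_nonpos (l' := (Sum.inr j, false)) (fun e => hl (by rw [← e])) hz).le

/-- The half plane of `l` avoids those of `γ j` and its inverse, so it lies in the strip between
them, and `halfplane_in_strip` confines it to the half disc. -/
lemma chartSq_of_gap {l : Letter u v} {j : Fin v} (hl : l.1 ≠ Sum.inr j) {z : ℍ} :
    (gap (l.val h γ • I) I z ≤ 0 → chartSq (k j) z ≤ (|τ j| / 2) ^ 2) ∧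
      (gap (l.val h γ • I) I z < 0 → chartSq (k j) z < (|τ j| / 2) ^ 2) := by
  have e : ∀ w, gap (((k j)⁻¹ * l.val h γ) • I) I w = gap (l.val h γ • I) I (k j • w) :=
    fun w => (gap_chart (hk j).fixes _ _).symm
  have := halfplane_in_strip (hk j).pos (p := ((k j)⁻¹ * l.val h γ) • I) (q := I)
    ⟨(k j)⁻¹ • l.val h γ • I, ?_⟩ (fun w hw => ?_) (z := (k j)⁻¹ • z)
  · rwa [e, smul_inv_smul] at this
  · rw [e, smul_inv_smul, gap_neg_iff, dist_self]
    exact dist_pos.mpr fun h0 => hG.val_ne_one l (hG.eq_one_of_smul_I (hG.val_mem l) h0)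
  · rw [e] at hw
    simpa using hG.strip_of_gap_nonpos hk hl hw.le

/-- The exterior of the half disc of `j'` is a half plane. By `chartSq_of_gap` it avoids the half
planes of `γ j` and its inverse, so it lies in the strip of `j` and hence in the half disc of `j`.
-/
lemma chartSq_le_of_le {j j' : Fin v} (hj : j' ≠ j) {z : ℍ}
    (hz : (|τ j| / 2) ^ 2 ≤ chartSq (k j) z) : chartSq (k j') z ≤ (|τ j'| / 2) ^ 2 := by
  set T := |τ j'| / 2
  have hT : 0 < T := (hk j').pos
  have e : ∀ w, gap ((k j)⁻¹ • chartPt (k j') (2 * T)) ((k j)⁻¹ • chartPt (k j') (T / 2)) w =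
      gap (chartPt (k j') (2 * T)) (chartPt (k j') (T / 2)) (k j • w) := by
    intro w
    rw [← gap_smul (k j), smul_inv_smul, smul_inv_smul]
  have e2 : ∀ z, gap (chartPt (k j') (2 * T)) (chartPt (k j') (T / 2)) z < 0 ↔
      T ^ 2 < chartSq (k j') z := by
    intro z
    rw [← not_le, gap_chartPt_nonneg _ hT, not_le]
  by_contra! hcon
  have := halfplane_in_strip (hk j).pos (p := (k j)⁻¹ • chartPt (k j') (2 * T))
    (q := (k j)⁻¹ • chartPt (k j') (T / 2)) ⟨(k j)⁻¹ • z, ?_⟩ (fun w hw => ?_) (z := (k j)⁻¹ • z)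
  · refine absurd (this.2 ?_) hz.not_gt
    rwa [e, smul_inv_smul, e2]
  · rwa [e, smul_inv_smul, e2]
  · rw [e, e2] at hw
    have main : ∀ s, 0 ≤ gap (Letter.val h γ ((Sum.inr j, s) : Letter u v) • I) I (k j • w) := by
      intro s
      by_contra! hneg
      have := (hG.chartSq_of_gap hk (l := (Sum.inr j, s)) (j := j')
        (fun e => hj (Sum.inr_injective e).symm)).1 hneg.le
      exact absurd hw this.not_gt
    have := (hk j).abs_re_le (main true) (main false)
    simpa using this

/-- The tiles of a word lie in the region of its first letter. -/
lemma outside_of_gap_nonpos {l l' : Letter u v} (hne : l' ≠ l)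
    (hc : ∀ j, l.1 = Sum.inr j → l'.1 ≠ Sum.inr j)
    {z : ℍ} (hz : gap (l.val h γ • I) I z ≤ 0) : Outside h γ k τ l' z := by
  refine ⟨fun _ => (hG.gap_pos_of_gap_nonpos hne hz).le, fun j hj => ?_⟩
  exact (hG.chartSq_of_gap hk (fun e => hc j e hj)).1 hz

lemma outside_of_chartSq_eq {l' : Letter u v} {j : Fin v} (hl : l'.1 ≠ Sum.inr j) {z : ℍ}
    (hz : chartSq (k j) z = (|τ j| / 2) ^ 2) : Outside h γ k τ l' z := by
  refine ⟨fun _ => ?_, fun j' hj' => ?_⟩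
  · by_contra! hneg
    exact ((hG.chartSq_of_gap hk hl).2 hneg).ne hz
  · exact hG.chartSq_le_of_le hk (fun e => hl (by rw [hj', e])) hz.ge

omit hk in
lemma gap_blockElt_nonpos {b : Block u v} {bs : List (Block u v)} (hb : Admissible (b :: bs)) :
    gap (b.1.val h γ • I) I (blockElt h γ (b :: bs) • I) ≤ 0 := by
  obtain ⟨L, hL, hred⟩ := hb.exists_expand
  rw [← wordProd_expand, hL]
  exact hG.gap_wordProd_nonpos hred I_mem_dirichletDomain

omit hG hk in
lemma Adj_ne_cusp {l l' : Letter u v} (hadj : Adj l l') {j : Fin v} (hl : l.1 = Sum.inr j) :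
    l'.1 ≠ Sum.inr j := by
  intro hl'
  have h1 := hadj.1
  have h2 := hadj.2 ⟨j, hl⟩
  obtain ⟨a, s⟩ := l
  obtain ⟨a', s'⟩ := l'
  obtain rfl : a = Sum.inr j := hl
  obtain rfl : a' = Sum.inr j := hl'
  cases s <;> cases s' <;> simp_all [Letter.inv]

/-- Induction on the blocks with a moving starting point. For a parabolic block `g`, the segment to
the target has to cross the `g`-translate of the half circle, at `m`: the part before `m` pays for
the block by `le_dist`, the part after it is the induction hypothesis for `g⁻¹ m`. Hyperbolic blocks
cost nothing. The last block `e` only locates the target and is not counted. -/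
lemma le_dist_of_outside {bs : List (Block u v)} {e : Block u v} (hb : Admissible (bs ++ [e]))
    {z : ℍ} (hz : ∀ b ∈ (bs ++ [e]).head?, Outside h γ k τ b.1 z) :
    windSum bs + Real.log 2 * longCount bs ≤ dist z (blockElt h γ (bs ++ [e]) • I) := by
  induction bs generalizing z with
  | nil => simp
  | cons b bs ih =>
    obtain ⟨b', bs', hbs⟩ : ∃ b' bs', bs ++ [e] = b' :: bs' := by
      cases bs with
      | nil => exact ⟨e, [], rfl⟩
      | cons b' bs => exact ⟨b', bs ++ [e], rfl⟩
    have hzb : Outside h γ k τ b.1 z := hz b (by simp)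
    rw [List.cons_append] at hb ⊢
    have hb' := hb.tail
    have hadj : Adj b.1 b'.1 := by
      rw [hbs, admissible_cons_cons] at hb
      exact hb.2.1
    have hok := hb.1 b (by simp)
    rw [windSum_cons, longCount_cons, blockElt_cons, mul_smul]
    by_cases hpar : b.1.IsParabolic
    · obtain ⟨j, hj⟩ := hpar
      have hT := (hk j).pos
      set T := |τ j| / 2 with hTdef
      obtain ⟨n, hn, hpow⟩ := val_pow_eq_zpow (h := h) (γ := γ) b.1 hj b.2
      rw [hpow]
      set P := chartPt (k j) (2 * T)
      set Q := chartPt (k j) (T / 2)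
      set g := γ j ^ n with hg
      set E := blockElt h γ (bs ++ [e]) • I with hE
      have hne := Adj_ne_cusp hadj hj
      have hzj := hzb.2 j hj
      -- The half disc and its translate have centres at least `2 T` apart, so in the upper half
      -- plane they are disjoint.
      have hdisj : ∀ w, chartSq (k j) w ≤ T ^ 2 → T ^ 2 < chartSq (k j) (g⁻¹ • w) := by
        intro w hw
        by_contra! hcon
        have h1 := (hk j).translation n (g⁻¹ • w)
        rw [smul_inv_smul] at h1
        rw [chartSq] at hw hcon
        rw [h1.1] at hw
        have hy := ((k j)⁻¹ • g⁻¹ • w).im_pos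
        have hy2 := ((k j)⁻¹ • w).im_pos
        have a1 : |((k j)⁻¹ • g⁻¹ • w).re| < T := by
          apply abs_lt_of_sq_lt_sq _ hT.le
          have : 0 < ((k j)⁻¹ • g⁻¹ • w).im ^ 2 := by positivity
          linarith
        have a2 : |((k j)⁻¹ • g⁻¹ • w).re + n * τ j| < T := by
          apply abs_lt_of_sq_lt_sq _ hT.le
          have : 0 < ((k j)⁻¹ • w).im ^ 2 := by positivity
          linarith
        have a3 : 2 * T ≤ |n * τ j| := by
          rw [abs_mul, show |(n : ℝ)| = b.2 by exact_mod_cast congrArg (Int.cast (R := ℝ)) hn]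
          have : (1 : ℝ) ≤ b.2 := by exact_mod_cast hok.1
          rw [hTdef]
          nlinarith [abs_nonneg (τ j)]
        have a4 := abs_sub_abs_le_abs_sub ((n : ℝ) * τ j) (-((k j)⁻¹ • g⁻¹ • w).re)
        rw [abs_neg, sub_neg_eq_add, add_comm] at a4
        linarith
      have hz1 : 0 ≤ gap (g • Q) (g • P) z := by
        rw [← gap_smul g⁻¹, inv_smul_smul, inv_smul_smul, gap_swap, neg_nonneg,
          gap_chartPt_nonpos _ hT]
        exact (hdisj z hzj).le
      have hEsq : chartSq (k j) E ≤ T ^ 2 := by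
        rw [hE, hbs]
        exact (hG.chartSq_of_gap hk hne).1 (hG.gap_blockElt_nonpos (hbs ▸ hb'))
      have hz2 : gap (g • Q) (g • P) (g • E) ≤ 0 := by
        rw [gap_smul, gap_swap, neg_nonpos, gap_chartPt_nonneg _ hT]
        exact hEsq
      obtain ⟨m, hm, hdm⟩ := exists_crossing hz1 hz2
      have hm1 : chartSq (k j) (g⁻¹ • m) = T ^ 2 := by
        rw [← gap_smul g⁻¹, inv_smul_smul, inv_smul_smul] at hm
        have h1 := gap_chartPt_nonneg (k j) hT (g⁻¹ • m)
        have h2 := gap_chartPt_nonpos (k j) hT (g⁻¹ • m)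
        rw [gap_swap] at h1 h2
        change 0 ≤ -gap Q P (g⁻¹ • m) ↔ _ at h1
        change -gap Q P (g⁻¹ • m) ≤ 0 ↔ _ at h2
        rw [hm] at h1 h2
        simp only [neg_zero, le_refl, true_iff] at h1 h2
        exact le_antisymm h1 h2
      have hIH := ih hb' (z := g⁻¹ • m) (by
        rw [hbs]
        intro c hc
        simp only [List.head?_cons, Option.mem_def, Option.some.injEq] at hc
        subst hc
        exact hG.outside_of_chartSq_eq hk hne hm1)
      have hstep := (hk j).le_dist hn hok.1 hzj hm1.le
      rw [smul_inv_smul] at hstep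
      have hdist : dist m (g • E) = dist (g⁻¹ • m) E := by
        rw [← dist_smul g⁻¹, inv_smul_smul]
      rw [hdm, hdist]
      have hφ : 2 * Real.posLog (winding b : ℝ) + Real.log 2 * (if 2 ≤ b.2 then 1 else 0) ≤
          dist z m := by
        split_ifs with h2
        · have h3 : 1 ≤ winding b := by rw [winding]; omega
          have h3' : (1 : ℝ) ≤ winding b := by exact_mod_cast h3
          rw [Real.posLog_eq_log (by rwa [abs_of_pos (by linarith)]), mul_one]
          -- From `1 + 2 a² ≤ cosh ≤ exp`; the factor `2` is the surplus `log 2` counted by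
          -- `longCount`.
          have h4 : Real.log (winding b ^ 2 * 2) ≤ dist z m := by
            rw [Real.log_le_iff_le_exp (by positivity)]
            have := Real.cosh_eq (dist z m)
            have : exp (-dist z m) ≤ exp (dist z m) :=
              Real.exp_le_exp.mpr (by linarith [dist_nonneg (x := z) (y := m)])
            change 1 + 2 * (winding b : ℝ) ^ 2 ≤ _ at hstep
            linarith
          rw [Real.log_mul (by positivity) (by norm_num), Real.log_pow] at h4
          push_cast at h4
          linarith
        · have h3 : winding b = 0 := by rw [winding]; omega
          rw [h3]
          simp
      push_cast
      split_ifs at hφ ⊢ <;> linarith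
    · have hb1 := hok.2 hpar
      have hw : winding b = 0 := by rw [winding, hb1]
      rw [hw, hb1, pow_one]
      have hIH := ih hb' (z := (b.1.val h γ)⁻¹ • z) (by
        rw [hbs]
        intro c hc
        simp only [List.head?_cons, Option.mem_def, Option.some.injEq] at hc
        subst hc
        refine hG.outside_of_gap_nonpos hk hadj.1 (fun j hj => absurd ⟨j, hj⟩ hpar) ?_
        have h1 := gap_smul_letter (h := h) (γ := γ) b.1 ((b.1.val h γ)⁻¹ • z)
        rw [smul_inv_smul] at h1
        have := hzb.1 hpar
        linarith)
      rw [← dist_smul (b.1.val h γ), smul_inv_smul] at hIH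
      simpa using hIH

lemma exists_outside (l : Letter u v) : ∃ z, Outside h γ k τ l z := by
  by_cases hl : l.IsParabolic
  · obtain ⟨j, hj⟩ := hl
    refine ⟨chartPt (k j) (|τ j| / 2), fun hn => absurd ⟨j, hj⟩ hn, fun j' hj' => ?_⟩
    obtain rfl : j = j' := Sum.inr_injective (hj.symm.trans hj')
    rw [chartSq_chartPt _ (hk j).pos]
  · exact ⟨I, fun _ => (hG.gap_I_pos (hG.val_mem l) (hG.val_ne_one l)).le,
      fun j hj => absurd ⟨j, hj⟩ hl⟩

end

end IsFreeFuchsianGroup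

/-! ### Displacement against winding, and displacement of parabolic powers -/

namespace IsFreeFuchsianGroup

variable {u v : ℕ} {G : Subgroup SL(2, ℝ)} {h : Fin u → SL(2, ℝ)} {γ : Fin v → SL(2, ℝ)}
variable (hG : IsFreeFuchsianGroup G h γ)
include hG

omit hG in
lemma admissible_concat {bs : List (Block u v)} {b e : Block u v} (hb : Admissible (bs ++ [b]))
    (he : Block.Ok e) (hadj : Adj b.1 e.1) : Admissible (bs ++ [b] ++ [e]) := by
  refine ⟨fun c hc => ?_, ?_⟩
  · rcases List.mem_append.mp hc with hc | hc
    · exact hb.1 c hc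
    · rw [List.mem_singleton.mp hc]; exact he
  · rw [List.isChain_append]
    refine ⟨hb.2, List.IsChain.singleton _, ?_⟩
    intro x hx y hy
    simp at hx hy
    subst hx hy
    exact hadj

lemma exists_charts : ∃ (k : Fin v → SL(2, ℝ)) (τ : Fin v → ℝ),
    ∀ j, IsCuspChart (γ j) (k j) (τ j) := by
  choose k τ hk using fun j => exists_isCuspChart (hG.parabolic j)
  exact ⟨k, τ, hk⟩

/-- The displacement is at least the sum of the contributions of the cusps. -/
lemma exists_windSum_le : ∃ C : ℝ, 0 ≤ C ∧ ∀ bs : List (Block u v), Admissible bs →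
    windSum bs + Real.log 2 * longCount bs ≤ disp (blockElt h γ bs) + C := by
  obtain ⟨k, τ, hk⟩ := hG.exists_charts
  choose z hz using fun l : Letter u v => hG.exists_outside hk l
  obtain ⟨Z, hZ⟩ : ∃ Z, ∀ l, dist (z l) I ≤ Z := by
    obtain ⟨Z, hZ⟩ := (Set.finite_range fun l => dist (z l) I).bddAbove
    exact ⟨Z, fun l => hZ ⟨l, rfl⟩⟩
  obtain ⟨D, hD⟩ : ∃ D, ∀ l : Letter u v, disp (l.val h γ) ≤ D := by
    obtain ⟨D, hD⟩ := (Set.finite_range fun l : Letter u v => disp (l.val h γ)).bddAbove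
    exact ⟨D, fun l => hD ⟨l, rfl⟩⟩
  refine ⟨max 0 (Z + D), le_max_left _ _, fun bs hb => ?_⟩
  have hmax := le_max_left 0 (Z + D)
  have hmax2 := le_max_right 0 (Z + D)
  rcases List.eq_nil_or_concat bs with h0 | ⟨bs₀, b, h0⟩
  · subst h0
    simp only [windSum_nil, longCount_nil, Nat.cast_zero, mul_zero, add_zero]
    have h1 := disp_nonneg (blockElt h γ ([] : List (Block u v)))
    linarith
  rw [List.concat_eq_append] at h0
  obtain ⟨l', hl'⟩ := exists_adj hG.nonelementary b.1
  obtain ⟨b₁, bs₁, hbs⟩ : ∃ b₁ bs₁, bs = b₁ :: bs₁ := by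
    cases bs with
    | nil => simp at h0
    | cons b₁ bs₁ => exact ⟨b₁, bs₁, rfl⟩
  -- An auxiliary letter is appended because `le_dist_of_outside` does not count the last block; it
  -- changes the displacement by a bounded amount.
  have hadm : Admissible (bs ++ [((l', 1) : Block u v)]) := by
    rw [h0]
    exact admissible_concat (h0 ▸ hb) ⟨le_refl 1, fun _ => rfl⟩ hl'
  have := hG.le_dist_of_outside hk hadm (z := z b₁.1) (by
    intro c hc
    rw [hbs] at hc
    simp only [List.cons_append, List.head?_cons, Option.mem_def, Option.some.injEq] at hc
    rw [← hc]
    exact hz _)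
  have h1 := dist_triangle (z b₁.1) I (blockElt h γ (bs ++ [((l', 1) : Block u v)]) • I)
  rw [dist_comm I] at h1
  have h2 := disp_mul_le (blockElt h γ bs) (l'.val h γ)
  rw [blockElt_append] at h1 this
  simp only [blockElt_cons, pow_one, blockElt_nil, mul_one] at h1 this
  change _ ≤ _ + disp (blockElt h γ bs * l'.val h γ) at h1
  linarith [hZ b₁.1, hD l']

/-- Long words move the base point far. -/
lemma exists_length_lt (D : ℝ) : ∃ R : ℕ, ∀ bs : List (Block u v), Admissible bs →
    disp (blockElt h γ bs) ≤ D → bs.length < R := by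
  have hfin := hG.finite_ball D
  have hfin2 : {L : List (Letter u v) | FreeGroup.IsReduced L ∧
      disp (wordProd h γ L) ≤ D}.Finite := by
    refine Set.Finite.of_finite_image (f := wordProd h γ) (hfin.subset ?_) ?_
    · rintro _ ⟨L, hL, rfl⟩
      exact ⟨hG.wordProd_mem L, hL.2⟩
    · exact fun L hL L' hL' he => hG.wordProd_injOn hL.1 hL'.1 he
  obtain ⟨R, hR⟩ := (hfin2.image List.length).bddAbove
  refine ⟨R + 1, fun bs hb hd => ?_⟩
  have := hR ⟨expand bs, ⟨hb.isReduced, by rwa [wordProd_expand]⟩, rfl⟩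
  have := hb.length_le
  omega

/-- The displacement exceeds the sum of the contributions of the cusps by a linear amount. -/
lemma exists_linear_le_disp : ∃ δ > 0, ∃ C : ℝ, 0 ≤ C ∧ ∀ bs : List (Block u v), Admissible bs →
    windSum bs + δ * bs.length ≤ disp (blockElt h γ bs) + C := by
  obtain ⟨A, hA0, hA⟩ := hG.exists_disp_append_ge
  obtain ⟨C, hC0, hC⟩ := hG.exists_windSum_le
  set a : List (Block u v) → ℝ := fun bs => disp (blockElt h γ bs) - windSum bs with ha
  have hlog : 0 < Real.log 2 := Real.log_pos one_lt_two
  have haC : ∀ bs, Admissible bs → Real.log 2 * longCount bs - C ≤ a bs := by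
    intro bs hb
    have := hC bs hb
    simp only [ha]; linarith
  have haC' : ∀ bs, Admissible bs → - C ≤ a bs := by
    intro bs hb
    have := haC bs hb
    have : 0 ≤ Real.log 2 * longCount bs := by positivity
    linarith
  have haA : ∀ bs bs', Admissible (bs ++ bs') → a bs + a bs' - A ≤ a (bs ++ bs') := by
    intro bs bs' hb
    have := hA bs bs' hb
    simp only [ha, windSum_append]; linarith
  -- `Q` long blocks alone yield a gain of `A + 1`. The next constant is such that a stretch of
  -- short blocks yields `A + 1` too, after paying `A` for each of two cuts and `C` for each of the
  -- two outer pieces.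
  obtain ⟨Q, hQ⟩ := exists_nat_ge ((A + 1 + C) / Real.log 2)
  rw [div_le_iff₀ hlog] at hQ
  obtain ⟨R, hR⟩ := hG.exists_length_lt (A + 1 + 2 * C + 2 * A)
  set M := (Q + 1) * (R + 1) with hM
  have hMpos : 0 < M := by positivity
  -- `a` is superadditive up to `A`, so a gain of `A + 1` on each piece of `M` blocks leaves a net
  -- gain of one per piece.
  have key : ∀ bs, Admissible bs → bs.length = M → A + 1 ≤ a bs := by
    intro bs hb hl
    by_cases hc : longCount bs < Q + 1
    · obtain ⟨l, m, r, he, hm, hs⟩ := exists_short_stretch (R + 1) (Q + 1) bs hl hc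
      rw [he] at hb
      have h1 := haA _ _ hb
      have h2 := haA _ _ hb.left
      have h3 := haC' _ hb.right
      have h4 := haC' _ hb.left.left
      have h5 : a m = disp (blockElt h γ m) := by
        simp only [ha, windSum_eq_zero hs, sub_zero]
      have h6 : A + 1 + 2 * C + 2 * A < disp (blockElt h γ m) := by
        by_contra! hcon
        have := hR m hb.left.right hcon
        omega
      rw [he]; linarith
    · have h1 := haC bs hb
      have h2 : (Q : ℝ) ≤ longCount bs := by
        have : Q ≤ longCount bs := by omega
        exact_mod_cast this
      nlinarith
  have main : ∀ q : ℕ, ∀ bs, Admissible bs → q * M ≤ bs.length → (q : ℝ) - C ≤ a bs := by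
    intro q
    induction q with
    | zero => intro bs hb _; simpa using haC' bs hb
    | succ q ih =>
      intro bs hb hl
      rw [Nat.succ_mul] at hl
      rw [← List.take_append_drop M bs] at hb
      have h1 := haA _ _ hb
      rw [List.take_append_drop] at h1
      have h2 := key _ hb.left (by rw [List.length_take]; omega)
      have h3 := ih _ hb.right (by rw [List.length_drop]; omega)
      push_cast
      linarith
  refine ⟨1 / M, by positivity, C + 1, by linarith, fun bs hb => ?_⟩
  have h1 := main (bs.length / M) bs hb (Nat.div_mul_le_self _ _)
  have h2 : (bs.length : ℝ) / M ≤ (bs.length / M : ℕ) + 1 := by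
    rw [div_le_iff₀ (by positivity)]
    have := Nat.div_add_mod bs.length M
    have h3 := Nat.mod_lt bs.length hMpos
    have h4 : bs.length ≤ (bs.length / M + 1) * M := by nlinarith
    exact_mod_cast h4
  simp only [ha] at h1
  rw [one_div, inv_mul_eq_div]
  linarith

/-- The displacement of powers of parabolic generators. -/
lemma exists_abs_disp_pow_le : ∃ C : ℝ, 0 ≤ C ∧ ∀ l : Letter u v, l.IsParabolic → ∀ N : ℕ, 1 ≤ N →
    |disp (l.val h γ ^ N) - 2 * Real.log N| ≤ C := by
  obtain ⟨k, τ, hk⟩ := hG.exists_charts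
  set c : Fin v → ℝ := fun j => |Real.log (2 + τ j ^ 2)| + |Real.log (τ j ^ 2 / 2)| with hc
  have hc0 : ∀ j, 0 ≤ c j := fun j => by positivity
  refine ⟨∑ j, c j, Finset.sum_nonneg fun j _ => hc0 j, ?_⟩
  rintro l ⟨j, hj⟩ N hN
  obtain ⟨n, hn, hpow⟩ := val_pow_eq_zpow (h := h) (γ := γ) l hj N
  refine le_trans ?_ (Finset.single_le_sum (fun j _ => hc0 j) (Finset.mem_univ j))
  have h1 := (hk j).cosh_disp n
  have hn2 : (n : ℝ) ^ 2 = (N : ℝ) ^ 2 := by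
    rw [← sq_abs]
    congr 1
    exact_mod_cast congrArg (Int.cast (R := ℝ)) hn
  rw [mul_pow, hn2] at h1
  rw [hpow]
  set d := disp (γ j ^ n) with hd
  have hd0 : 0 ≤ d := disp_nonneg _
  have hN' : (1 : ℝ) ≤ N := by exact_mod_cast hN
  have hN2 : (1 : ℝ) ≤ (N : ℝ) ^ 2 := one_le_pow₀ hN'
  have hτ : 0 < τ j ^ 2 := by have := (hk j).ne_zero; positivity
  rw [Real.cosh_eq] at h1
  have e1 := Real.exp_pos (-d)
  have e2 : exp (-d) ≤ exp d := Real.exp_le_exp.mpr (by linarith)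
  have e3 : exp (-d) ≤ 1 := by rw [Real.exp_le_one_iff]; linarith
  have up : d ≤ Real.log ((N : ℝ) ^ 2 * (2 + τ j ^ 2)) := by
    rw [Real.le_log_iff_exp_le (by positivity)]
    nlinarith
  have low : Real.log ((N : ℝ) ^ 2 * (τ j ^ 2 / 2)) ≤ d := by
    rw [Real.log_le_iff_le_exp (by positivity)]
    nlinarith
  rw [Real.log_mul (by positivity) (by positivity), Real.log_pow] at up low
  push_cast at up low
  have a1 := le_abs_self (Real.log (2 + τ j ^ 2))
  have a2 := neg_abs_le (Real.log (τ j ^ 2 / 2))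
  have a3 := abs_nonneg (Real.log (2 + τ j ^ 2))
  have a4 := abs_nonneg (Real.log (τ j ^ 2 / 2))
  rw [abs_le]
  simp only [hc]
  constructor <;> linarith

end IsFreeFuchsianGroup

/-! ### Infinite words and rays -/

section InfiniteWords

variable {u v : ℕ} {G : Subgroup SL(2, ℝ)} {h : Fin u → SL(2, ℝ)} {γ : Fin v → SL(2, ℝ)}

@[simp] lemma prefixProd_zero (ω : ℕ → Letter u v) : prefixProd h γ ω 0 = 1 := by
  simp [prefixProd]

lemma prefixProd_succ (ω : ℕ → Letter u v) (n : ℕ) :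
    prefixProd h γ ω (n + 1) = prefixProd h γ ω n * (ω n).val h γ := by
  rw [prefixProd, List.ofFn_succ_last]
  simp [prefixProd]

/-- The wall between the tiles of consecutive prefixes. -/
def wall (h : Fin u → SL(2, ℝ)) (γ : Fin v → SL(2, ℝ)) (ω : ℕ → Letter u v) (m : ℕ) (z : ℍ) : ℝ :=
  gap (prefixProd h γ ω (m + 1) • I) (prefixProd h γ ω m • I) z

lemma wall_smul (ω : ℕ → Letter u v) (m : ℕ) (z : ℍ) :
    wall h γ ω m (prefixProd h γ ω m • z) = gap ((ω m).val h γ • I) I z := by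
  rw [wall, prefixProd_succ, mul_smul, gap_smul]

lemma wall_smul' (ω : ℕ → Letter u v) (m : ℕ) (z : ℍ) :
    wall h γ ω m (prefixProd h γ ω (m + 1) • z) = - gap ((ω m).inv.val h γ • I) I z := by
  rw [prefixProd_succ, mul_smul, wall_smul, IsFreeFuchsianGroup.gap_smul_letter]

/-- An infinite word of blocks. -/
structure IsBlockStream (B : ℕ → Block u v) : Prop where
  ok : ∀ k, Block.Ok (B k)
  adj : ∀ k, Adj (B k).1 (B (k + 1)).1

lemma IsBlockStream.admissible {B : ℕ → Block u v} (hB : IsBlockStream B) (a n : ℕ) :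
    Admissible (List.ofFn fun i : Fin n => B (a + i)) := by
  refine ⟨?_, ?_⟩
  · intro b hb
    obtain ⟨i, rfl⟩ := List.mem_ofFn.mp hb
    exact hB.ok _
  · rw [List.isChain_ofFn]
    exact fun i _ => hB.adj (a + i)

/-- Admissible words extend to infinite words. -/
lemma Admissible.exists_stream (huv : 1 < u + v) {b : Block u v} {bs : List (Block u v)}
    (hb : Admissible (b :: bs)) :
    ∃ B, IsBlockStream B ∧ B 0 = b ∧
      ∀ k (hk : k < (b :: bs).length), B k = (b :: bs)[k] := by
  induction bs generalizing b with
  | nil =>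
    choose nxt hnxt using fun l : Letter u v => exists_adj huv l
    have hok := hb.1 b (by simp)
    refine ⟨fun k => if k = 0 then b else (nxt^[k] b.1, 1), ⟨fun k => ?_, fun k => ?_⟩, rfl, ?_⟩
    · by_cases hk : k = 0
      · simp [hk, hok]
      · simp only [hk, if_false]
        exact ⟨le_rfl, fun _ => rfl⟩
    · by_cases hk : k = 0
      · simp [hk, hnxt]
      · simp only [hk, if_false, Nat.add_eq_zero_iff, one_ne_zero, and_false,
          Function.iterate_succ_apply']
        exact hnxt _
    · intro k hk
      simp only [List.length_singleton, Nat.lt_one_iff] at hk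
      subst hk
      rfl
  | cons b' bs ih =>
    rw [admissible_cons_cons] at hb
    obtain ⟨B, hB, hB0, hBk⟩ := ih hb.2.2
    refine ⟨fun k => k.casesOn b B, ⟨fun k => ?_, fun k => ?_⟩, rfl, fun k hk => ?_⟩
    · cases k with
      | zero => exact hb.1
      | succ k => exact hB.ok k
    · cases k with
      | zero =>
        change Adj b.1 (B 0).1
        rw [hB0]; exact hb.2.1
      | succ k => exact hB.adj k
    · cases k with
      | zero => rfl
      | succ k => exact hBk k (by simpa using hk)

/-- The word in the letters of an infinite word of blocks. -/
lemma IsBlockStream.exists_word {B : ℕ → Block u v} (hB : IsBlockStream B) :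
    ∃ (ω : ℕ → Letter u v) (e : ℕ → ℕ), e 0 = 0 ∧ StrictMono e ∧
      (∀ k, e (k + 1) = e k + (B k).2) ∧
      (∀ k j, e k ≤ j → j < e (k + 1) → ω j = (B k).1) ∧
      (∀ m, ω (m + 1) ≠ (ω m).inv) := by
  set e : ℕ → ℕ := fun k => ∑ i ∈ Finset.range k, (B i).2 with he
  have hsucc : ∀ k, e (k + 1) = e k + (B k).2 := fun k => Finset.sum_range_succ _ _
  have hmono : StrictMono e := strictMono_nat_of_lt_succ fun k => by
    have := (hB.ok k).1
    rw [hsucc]; omega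
  have hex : ∀ m, ∃ k, m < e (k + 1) := fun m => ⟨m, (Nat.lt_succ_self m).trans_le hmono.le_apply⟩
  -- `κ m` is the index of the block that contains position `m`.
  set κ : ℕ → ℕ := fun m => Nat.find (hex m) with hκ
  have hκeq : ∀ k j, e k ≤ j → j < e (k + 1) → κ j = k := by
    intro k j h1 h2
    rw [hκ, Nat.find_eq_iff]
    refine ⟨h2, fun n hn => ?_⟩
    have : e (n + 1) ≤ e k := hmono.monotone hn
    omega
  have hω : ∀ k j, e k ≤ j → j < e (k + 1) → (B (κ j)).1 = (B k).1 := fun k j h1 h2 => by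
    rw [hκeq k j h1 h2]
  refine ⟨fun m => (B (κ m)).1, e, rfl, hmono, hsucc, hω, fun m => ?_⟩
  have h1 : m < e (κ m + 1) := Nat.find_spec (hex m)
  have h2 : e (κ m) ≤ m := by
    rcases Nat.eq_zero_or_pos (κ m) with h0 | h0
    · rw [h0]; exact Nat.zero_le m
    · have := Nat.find_min (hex m) (m := κ m - 1) (by change κ m - 1 < κ m; omega)
      rw [Nat.sub_add_cancel h0] at this
      omega
  rcases Nat.lt_or_ge (m + 1) (e (κ m + 1)) with h3 | h3
  · change (B (κ (m + 1))).1 ≠ (B (κ m)).1.inv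
    rw [hκeq (κ m) (m + 1) (by omega) h3]
    exact (Letter.inv_ne _).symm
  · have h4 : κ (m + 1) = κ m + 1 := hκeq (κ m + 1) (m + 1) (by omega) (by
      have : e (κ m + 1) < e (κ m + 1 + 1) := hmono (Nat.lt_succ_self _)
      omega)
    change (B (κ (m + 1))).1 ≠ (B (κ m)).1.inv
    rw [h4]
    exact (hB.adj _).1

lemma prefixProd_add_of_const {ω : ℕ → Letter u v} {a n : ℕ} {l : Letter u v}
    (hω : ∀ j, a ≤ j → j < a + n → ω j = l) :
    prefixProd h γ ω (a + n) = prefixProd h γ ω a * l.val h γ ^ n := by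
  induction n with
  | zero => simp
  | succ n ih =>
    rw [← add_assoc, prefixProd_succ, ih fun j h1 h2 => hω j h1 (by omega), hω _ (by omega)
      (by omega), pow_succ, mul_assoc]

lemma prefixProd_eq_blockElt {B : ℕ → Block u v} {ω : ℕ → Letter u v} {e : ℕ → ℕ}
    (hsucc : ∀ k, e (k + 1) = e k + (B k).2)
    (hω : ∀ k j, e k ≤ j → j < e (k + 1) → ω j = (B k).1) (a n : ℕ) :
    prefixProd h γ ω (e (a + n)) =
      prefixProd h γ ω (e a) * blockElt h γ (List.ofFn fun i : Fin n => B (a + i)) := by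
  induction n with
  | zero => simp
  | succ n ih =>
    rw [List.ofFn_succ_last, ← add_assoc, hsucc, prefixProd_add_of_const (l := (B (a + n)).1)
      (fun j h1 h2 => hω _ j h1 (by rwa [hsucc])), ih, blockElt_append]
    simp [mul_assoc]

lemma cosh_dist_geo_nonneg (k : SL(2, ℝ)) (o : ℍ) :
    ∃ a b : ℝ, 0 ≤ a ∧ 0 ≤ b ∧ ∀ s, cosh (dist (geo k s) o) = a * exp s + b * exp (-s) := by
  have := (k⁻¹ • o).im_pos
  refine ⟨1 / (2 * (k⁻¹ • o).im), ((k⁻¹ • o).re ^ 2 + (k⁻¹ • o).im ^ 2) / (2 * (k⁻¹ • o).im),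
    by positivity, by positivity, fun s => ?_⟩
  rw [geo, ← dist_smul k⁻¹, inv_smul_smul, cosh_dist_vert s (k⁻¹ • o)]
  ring

lemma cosh_le_exp {x : ℝ} (hx : 0 ≤ x) : cosh x ≤ exp x := by
  have : exp (-x) ≤ exp x := Real.exp_le_exp.mpr (by linarith)
  rw [Real.cosh_eq]
  linarith

/-- A quasi-aligned point is close to the geodesic. -/
lemma cosh_dist_geo_le_of_aligned {k : SL(2, ℝ)} {L C : ℝ} {x : ℍ}
    (hx : dist (geo k 0) x + dist x (geo k L) ≤ L + C) :
    cosh (dist (geo k (dist (geo k 0) x)) x) ≤ exp C + 1 := by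
  obtain ⟨a, b, ha, hb, hab⟩ := cosh_dist_geo_nonneg k x
  have h0 := hab 0
  have hL := hab L
  set t := dist (geo k 0) x with ht
  have ht0 : 0 ≤ t := dist_nonneg
  rw [hab]
  simp only [Real.exp_zero, neg_zero, mul_one] at h0
  -- The decreasing part of `a e^s + b e^(-s)` is controlled from the starting point, the increasing
  -- part from the end point `geo k L`.
  have e1 : b * exp (-t) ≤ 1 := by
    have h1 := cosh_le_exp ht0
    rw [h0] at h1
    rw [Real.exp_neg, ← div_eq_mul_inv, div_le_one (Real.exp_pos t)]
    linarith
  have e2 : a * exp L ≤ exp (L + C - t) := by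
    have h1 := cosh_le_exp (dist_nonneg (x := geo k L) (y := x))
    rw [hL] at h1
    have h2 : exp (dist (geo k L) x) ≤ exp (L + C - t) := by
      apply Real.exp_le_exp.mpr
      rw [dist_comm]; linarith
    have : 0 ≤ b * exp (-L) := mul_nonneg hb (Real.exp_pos _).le
    linarith
  have e3 : a * exp t ≤ exp C := by
    have h1 : exp (L + C - t) = exp L * exp C / exp t := by
      rw [Real.exp_sub, Real.exp_add]
    rw [h1, le_div_iff₀ (Real.exp_pos t)] at e2
    have := Real.exp_pos L
    have h3 : exp L * (a * exp t) ≤ exp L * exp C := by linarith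
    exact le_of_mul_le_mul_left h3 this
  linarith

end InfiniteWords

/-! ### Admissible words are exactly the words of rays -/

namespace IsFreeFuchsianGroup

variable {u v : ℕ} {G : Subgroup SL(2, ℝ)} {h : Fin u → SL(2, ℝ)} {γ : Fin v → SL(2, ℝ)}
variable (hG : IsFreeFuchsianGroup G h γ)
include hG

lemma prefixProd_mem (ω : ℕ → Letter u v) (n : ℕ) : prefixProd h γ ω n ∈ G := by
  induction n with
  | zero => simp
  | succ n ih => rw [prefixProd_succ]; exact mul_mem ih (hG.val_mem _)

/-- A wall is contained in both of the tiles that it separates. -/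
lemma mem_tiles_of_wall_eq_zero {ω : ℕ → Letter u v} {m : ℕ} {z : ℍ} (hz : wall h γ ω m z = 0) :
    z ∈ prefixProd h γ ω m • dirichletDomain G ∧
      z ∈ prefixProd h γ ω (m + 1) • dirichletDomain G := by
  set P := prefixProd h γ ω m with hP
  have hz' : gap ((ω m).val h γ • I) I (P⁻¹ • z) = 0 := by
    rw [← wall_smul, ← hP, smul_inv_smul, hz]
  have hF : P⁻¹ • z ∈ dirichletDomain G := hG.mem_dirichletDomain_of_letters fun l => by
    by_cases hl : l = ω m
    · rw [hl, hz']
    · exact (hG.gap_pos_of_gap_nonpos hl hz'.le).le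
  refine ⟨Set.mem_smul_set_iff_inv_smul_mem.mpr hF, ?_⟩
  rw [prefixProd_succ, mul_smul, Set.mem_smul_set_iff_inv_smul_mem]
  exact mem_smul_dirichletDomain_of_eq (hG.val_mem _) hF hz'

/-- The half planes behind the walls of a reduced word are nested. -/
lemma wall_neg_of_nonpos {ω : ℕ → Letter u v} {m : ℕ} (hω : ω (m + 1) ≠ (ω m).inv) {z : ℍ}
    (hz : wall h γ ω (m + 1) z ≤ 0) : wall h γ ω m z < 0 := by
  set P := prefixProd h γ ω (m + 1) with hP
  have h1 := wall_smul (h := h) (γ := γ) ω (m + 1) (P⁻¹ • z)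
  have h2 := wall_smul' (h := h) (γ := γ) ω m (P⁻¹ • z)
  rw [← hP, smul_inv_smul] at h1 h2
  rw [h1] at hz
  have := hG.gap_pos_of_gap_nonpos hω.symm hz
  linarith

omit hG in
lemma mem_tile {P : SL(2, ℝ)} (hP : P ∈ G) {z : ℍ} (hz : z ∈ P • dirichletDomain G)
    {g : SL(2, ℝ)} (hg : g ∈ G) : 0 ≤ gap (g • I) (P • I) z := by
  rw [gap_nonneg_iff]
  exact (mem_smul_dirichletDomain hP).mp hz g hg

omit hG in
/-- Tiles are convex. -/
lemma tile_convex {P : SL(2, ℝ)} (hP : P ∈ G) {k : SL(2, ℝ)} {s t m : ℝ} (hs : s ≤ m) (ht : m ≤ t)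
    (h1 : geo k s ∈ P • dirichletDomain G) (h2 : geo k t ∈ P • dirichletDomain G) :
    geo k m ∈ P • dirichletDomain G := by
  rw [mem_smul_dirichletDomain hP]
  intro g hg
  rw [← gap_nonneg_iff]
  exact gap_geo_between k _ _ hs ht (mem_tile hP h1 hg) (mem_tile hP h2 hg)

/-- The word of a ray is reduced. -/
lemma IsExpansion.ne_inv {r : ℝ≥0 → ℍ} {ω : ℕ → Letter u v} (hr : IsRay r)
    (hω : IsExpansion G h γ r ω) (m : ℕ) : ω (m + 1) ≠ (ω m).inv := by
  intro heq
  obtain ⟨s, -, hmono, -, htile⟩ := hω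
  obtain ⟨θ, hθ⟩ := hr.exists_geo
  set P := prefixProd h γ ω m with hP
  set Q := prefixProd h γ ω (m + 1) with hQ
  have hPG : P ∈ G := hG.prefixProd_mem _ _
  have hQG : Q ∈ G := hG.prefixProd_mem _ _
  have hP2 : prefixProd h γ ω (m + 2) = P := by
    rw [prefixProd_succ, prefixProd_succ, heq, Letter.val_inv, mul_inv_cancel_right]
  have l1 : s m ≤ s (m + 1) := (hmono (Nat.lt_succ_self _)).le
  have l2 : s (m + 1) < s (m + 2) := hmono (Nat.lt_succ_self _)
  have l3 : s (m + 2) ≤ s (m + 3) := (hmono (Nat.lt_succ_self _)).le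
  have a1 := htile m ⟨l1, le_rfl⟩
  have a2 := htile (m + 1) ⟨le_rfl, l2.le⟩
  have a3 := htile (m + 1) ⟨l2.le, le_rfl⟩
  have a4 := htile (m + 2) ⟨le_rfl, l3⟩
  rw [hP2] at a4
  have hzero : ∀ z, z ∈ P • dirichletDomain G → z ∈ Q • dirichletDomain G →
      wall h γ ω m z = 0 := by
    intro z z1 z2
    refine le_antisymm ?_ (mem_tile hPG z1 hQG)
    have := mem_tile hQG z2 hPG
    rw [gap_swap] at this
    exact neg_nonneg.mp this
  have b1 := hzero _ a1 a2
  have b2 := hzero _ a4 a3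
  rw [hθ] at b1 b2
  -- A ray that returns to the tile it came from is on the same wall at two different times, so the
  -- wall contains the whole geodesic and hence `i`. But `i` lies in no tile other than the domain
  -- itself.
  have b0 := gap_geo_eq_zero (rot θ) _ _ (fun e => l2.ne (NNReal.coe_injective e)) b1 b2 0
  rw [geo_zero, rot_smul_I] at b0
  obtain ⟨c1, c2⟩ := hG.mem_tiles_of_wall_eq_zero b0
  have key : ∀ g ∈ G, I ∈ g • dirichletDomain G → g = 1 := by
    intro g hg hI
    have := (mem_smul_dirichletDomain hg).mp hI 1 (one_mem _)
    rw [one_smul, dist_self] at this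
    exact hG.eq_one_of_smul_I hg (dist_le_zero.mp this).symm
  have e1 := key _ hPG c1
  have e2 := key _ hQG c2
  rw [hQ, prefixProd_succ, ← hP, e1, one_mul] at e2
  exact hG.val_ne_one _ e2

lemma admissible_of_mem_blockWords {n : ℕ} {b : Fin n → Block u v}
    (hb : b ∈ blockWords G h γ n) : Admissible (List.ofFn b) := by
  obtain ⟨r, ω, B, hr, hω, ⟨e, he0, he⟩, rfl⟩ := hb
  have hB : IsBlockStream B := by
    refine ⟨fun k => ⟨(he k).1, (he k).2.2.2.1⟩, fun k => ?_⟩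
    obtain ⟨h1, h2, h3, h4, h5⟩ := he k
    obtain ⟨g1, g2, g3, g4, g5⟩ := he (k + 1)
    have e1 : ω (e (k + 1)) = (B (k + 1)).1 := g3 _ le_rfl (by omega)
    have e2 : ω (e (k + 1) - 1) = (B k).1 := h3 _ (by omega) (by omega)
    refine ⟨?_, fun hp => ?_⟩
    · have := IsExpansion.ne_inv hG hr.1 hω (e (k + 1) - 1)
      rwa [Nat.sub_add_cancel (by omega), e1, e2] at this
    · rw [← e1]; exact h5 hp
  simpa using hB.admissible 0 n

section Realize

variable {ω : ℕ → Letter u v} (hω : ∀ m, ω (m + 1) ≠ (ω m).inv)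
include hω

lemma wall_neg_of_lt {z : ℍ} {m n : ℕ} (hmn : m < n) (hz : wall h γ ω n z ≤ 0) :
    wall h γ ω m z < 0 := by
  induction n, hmn using Nat.le_induction with
  | base => exact hG.wall_neg_of_nonpos (hω m) hz
  | succ n _ ih => exact ih (hG.wall_neg_of_nonpos (hω n) hz).le

lemma wall_prefixProd_neg {m n : ℕ} (hmn : m < n) :
    wall h γ ω m (prefixProd h γ ω n • I) < 0 := by
  obtain ⟨n, rfl⟩ := Nat.exists_eq_add_of_lt hmn
  have h1 : wall h γ ω (m + n) (prefixProd h γ ω (m + n + 1) • I) < 0 := by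
    rw [wall_smul', neg_lt_zero]
    exact hG.gap_I_pos (hG.val_mem _) (hG.val_ne_one _)
  rcases Nat.eq_zero_or_pos n with rfl | hn
  · exact h1
  · exact hG.wall_neg_of_lt hω (by omega) h1.le

lemma wall_I_pos (m : ℕ) : 0 < wall h γ ω m I := by
  by_contra! hcon
  have h0 : wall h γ ω 0 I ≤ 0 := by
    rcases Nat.eq_zero_or_pos m with rfl | hm
    · exact hcon
    · exact (hG.wall_neg_of_lt hω hm hcon).le
  have h1 := wall_smul (h := h) (γ := γ) ω 0 I
  rw [prefixProd_zero, one_smul] at h1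
  rw [h1] at h0
  exact (hG.gap_I_pos (hG.val_mem _) (hG.val_ne_one _)).not_ge h0

lemma prefixProd_injective : Function.Injective (prefixProd h γ ω) := by
  have key : ∀ m n, m < n → prefixProd h γ ω m ≠ prefixProd h γ ω n := by
    intro m n hmn heq
    have h1 := hG.wall_prefixProd_neg hω hmn
    rw [← heq, wall_smul] at h1
    exact (hG.gap_I_pos (hG.val_mem _) (hG.val_ne_one _)).not_gt h1
  intro m n heq
  rcases lt_trichotomy m n with hlt | he | hlt
  · exact absurd heq (key _ _ hlt)
  · exact he
  · exact absurd heq.symm (key _ _ hlt)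

lemma exists_lt_dist (z : ℍ) (R : ℝ) : ∃ N, ∀ n ≥ N, R < dist (prefixProd h γ ω n • I) z := by
  have hfin := (hG.finite_ball (R + dist z I)).preimage
    (hG.prefixProd_injective hω).injOn
  obtain ⟨N, hN⟩ := hfin.bddAbove
  refine ⟨N + 1, fun n hn => ?_⟩
  by_contra! hcon
  have : n ∈ prefixProd h γ ω ⁻¹' {g | g ∈ G ∧ dist (g • I) I ≤ R + dist z I} := by
    refine ⟨hG.prefixProd_mem _ _, ?_⟩
    have := dist_triangle (prefixProd h γ ω n • I) z I
    linarith
  have := hN this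
  omega

/-- A ray that passes infinitely many tiles of a word at bounded distance has this word as
its expansion. -/
lemma isExpansion_of_close {θ D : ℝ} {t : ℕ → ℝ} {e : ℕ → ℕ} (he : Tendsto e atTop atTop)
    (ht : ∀ K, 0 ≤ t K)
    (hclose : ∀ K, dist (geo (rot θ) (t K)) (prefixProd h γ ω (e K) • I) ≤ D) :
    IsExpansion G h γ (fun s : ℝ≥0 => geo (rot θ) s) ω := by
  have hwall0 : ∀ m, 0 < wall h γ ω m (geo (rot θ) 0) := fun m => by
    rw [geo_zero, rot_smul_I]; exact hG.wall_I_pos hω m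
  have hcont : ∀ m, Continuous fun s => wall h γ ω m (geo (rot θ) s) := fun m =>
    (continuous_gap _ _).comp (continuous_geo _)
  have hcross : ∀ m, ∃ s : ℝ, 0 < s ∧ wall h γ ω m (geo (rot θ) s) = 0 := by
    intro m
    obtain ⟨N, hN⟩ := hG.exists_lt_dist hω (prefixProd h γ ω m • I) (2 * D)
    obtain ⟨K, hK⟩ := (he.eventually_ge_atTop (max N (m + 1))).exists
    -- Otherwise the segment from the ray to the orbit point behind the wall crosses it at some `q`.
    -- Being in the tile `m`, `q` is at least as close to that tile's centre, so the two centres are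
    -- within `2 D`; this fails for large `K`.
    have hneg : wall h γ ω m (geo (rot θ) (t K)) < 0 := by
      by_contra! hcon
      have hle := hG.wall_prefixProd_neg hω (m := m) (n := e K)
        (by have := le_max_right N (m + 1); omega)
      obtain ⟨q, hq, hd⟩ := exists_crossing hcon hle.le
      have h1 := hN (e K) ((le_max_left _ _).trans hK)
      have h2 := (mem_smul_dirichletDomain (hG.prefixProd_mem ω m)).mp
        (hG.mem_tiles_of_wall_eq_zero hq).1 _ (hG.prefixProd_mem ω (e K))
      have h3 := hclose K
      rw [hd] at h3
      have h4 := dist_triangle_right (prefixProd h γ ω (e K) • I) (prefixProd h γ ω m • I) q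
      rw [dist_comm _ q, dist_comm _ q] at h4
      have h5 := dist_nonneg (x := geo (rot θ) (t K)) (y := q)
      linarith
    obtain ⟨s, hs, hs0⟩ := intermediate_value_Icc' (ht K) (hcont m).continuousOn
      ⟨hneg.le, (hwall0 m).le⟩
    refine ⟨s, lt_of_le_of_ne hs.1 ?_, hs0⟩
    rintro rfl
    exact (hwall0 m).ne' hs0
  choose σ hσ0 hσ using hcross
  have hσmono : ∀ m, σ m < σ (m + 1) := by
    intro m
    by_contra! hcon
    have h1 := hG.wall_neg_of_nonpos (hω m) (hσ (m + 1)).le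
    have h2 := gap_geo_between (rot θ) (prefixProd h γ ω (m + 1) • I) (prefixProd h γ ω m • I)
      (hσ0 (m + 1)).le hcon (hwall0 m).le (hσ m).ge
    exact h2.not_gt h1
  have hpos : ∀ m, 0 ≤ σ m := fun m => (hσ0 m).le
  set s : ℕ → ℝ≥0 := fun n => n.casesOn 0 fun m => ⟨σ m, hpos m⟩ with hs
  have hs_succ : ∀ m, ((s (m + 1) : ℝ≥0) : ℝ) = σ m := fun m => rfl
  have hs_mono : StrictMono s := strictMono_nat_of_lt_succ fun n => by
    cases n with
    | zero => exact hσ0 0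
    | succ n => exact hσmono n
  have htile : ∀ n, geo (rot θ) (s n) ∈ prefixProd h γ ω n • dirichletDomain G ∧
      geo (rot θ) (s (n + 1)) ∈ prefixProd h γ ω n • dirichletDomain G := by
    intro n
    refine ⟨?_, (hG.mem_tiles_of_wall_eq_zero (hσ n)).1⟩
    cases n with
    | zero =>
      rw [prefixProd_zero, one_smul]
      change geo (rot θ) 0 ∈ _
      rw [geo_zero, rot_smul_I]
      exact I_mem_dirichletDomain
    | succ n => exact (hG.mem_tiles_of_wall_eq_zero (hσ n)).2
  refine ⟨s, rfl, hs_mono, ?_, fun n x hx => ?_⟩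
  · rw [tendsto_atTop_atTop]
    intro b
    -- A point of the `n`-th tile at distance `s n` from `i` is no further from the centre of that
    -- tile, whose distance from `i` is therefore at most `2 s n`; the centres escape to infinity.
    obtain ⟨N, hN⟩ := hG.exists_lt_dist hω I (2 * b)
    refine ⟨N, fun n hn => ?_⟩
    by_contra! hlt
    have h1 := hN n hn
    have h2 := (mem_smul_dirichletDomain (hG.prefixProd_mem ω n)).mp (htile n).1 1 (one_mem _)
    have h3 : dist (geo (rot θ) (s n)) I = s n := by
      have := dist_geo (rot θ) (s n) 0
      rwa [geo_zero, rot_smul_I, sub_zero, abs_of_nonneg (NNReal.coe_nonneg _)] at this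
    rw [one_smul, h3] at h2
    have h4 := dist_triangle_right (prefixProd h γ ω n • I) I (geo (rot θ) (s n))
    rw [dist_comm _ (geo _ _), dist_comm I, h3] at h4
    have h5 : ((s n : ℝ≥0) : ℝ) < b := hlt
    linarith
  · exact tile_convex (hG.prefixProd_mem ω n) (NNReal.coe_le_coe.mpr hx.1)
      (NNReal.coe_le_coe.mpr hx.2) (htile n).1 (htile n).2

end Realize

omit hG in
lemma rot_toIcoMod (θ : ℝ) : ∃ θ' ∈ Icc 0 (2 * Real.pi), rot θ' = rot θ := by
  have hp := Real.two_pi_pos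
  refine ⟨toIcoMod hp 0 θ, ?_, ?_⟩
  · have := toIcoMod_mem_Ico hp 0 θ
    rw [zero_add] at this
    exact Ico_subset_Icc_self this
  · have h1 : toIcoMod hp 0 θ = θ - (toIcoDiv hp 0 θ : ℤ) * (2 * Real.pi) := by
      rw [toIcoMod, zsmul_eq_mul]
    rw [h1]
    simp only [rot, Real.cos_sub_int_mul_two_pi, Real.sin_sub_int_mul_two_pi]
    rfl

/-- Infinite words of blocks come from radial limit points. -/
lemma exists_ray_of_stream {B : ℕ → Block u v} (hB : IsBlockStream B) :
    ∃ r ω, IsRadial G r ∧ IsExpansion G h γ r ω ∧ IsBlockSequence ω B := by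
  obtain ⟨ω, e, he0, hemono, hsucc, hωB, hred⟩ := hB.exists_word (u := u) (v := v)
  obtain ⟨C, hC0, hC⟩ := hG.exists_disp_append_ge
  set o : ℕ → ℍ := fun K => prefixProd h γ ω (e K) • I with ho
  set t : ℕ → ℝ := fun K => dist I (o K) with ht
  have hθ : ∀ N, ∃ θ ∈ Icc 0 (2 * Real.pi), geo (rot θ) (t N) = o N := by
    intro N
    obtain ⟨θ, hθ⟩ := exists_rot_geo (o N)
    obtain ⟨θ', h1, h2⟩ := rot_toIcoMod θ
    exact ⟨θ', h1, by rw [h2, hθ]⟩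
  choose θ hθI hθ using hθ
  -- By quasi-additivity `o K` is almost on the segment from `i` to `o N`, uniformly in `N`. A limit
  -- of the directions `θ N` then gives a ray close to every `o K`.
  have halign : ∀ K N, K ≤ N → cosh (dist (geo (rot (θ N)) (t K)) (o K)) ≤ exp C + 1 := by
    intro K N hKN
    have hI : ∀ φ, geo (rot φ) 0 = I := fun φ => by rw [geo_zero, rot_smul_I]
    have h1 := cosh_dist_geo_le_of_aligned (k := rot (θ N)) (L := t N) (C := C) (x := o K) (by
      rw [hI, hθ]
      obtain ⟨n, rfl⟩ := Nat.exists_eq_add_of_le hKN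
      have hK := prefixProd_eq_blockElt (h := h) (γ := γ) hsucc hωB 0 K
      have hN := prefixProd_eq_blockElt (h := h) (γ := γ) hsucc hωB 0 (K + n)
      have hn := prefixProd_eq_blockElt (h := h) (γ := γ) hsucc hωB K n
      simp only [zero_add, he0, prefixProd_zero, one_mul] at hK hN
      have hsplit : (List.ofFn fun i : Fin (K + n) => B i) =
          (List.ofFn fun i : Fin K => B i) ++ List.ofFn fun i : Fin n => B (K + i) := by
        rw [List.ofFn_add]
        simp
      have hadm := hB.admissible 0 (K + n)
      simp only [zero_add] at hadm
      rw [hsplit] at hadm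
      have := hC _ _ hadm
      rw [← hsplit, ← hK, ← hN] at this
      have e1 : disp (prefixProd h γ ω (e K)) = dist I (o K) := dist_comm _ _
      have e2 : disp (prefixProd h γ ω (e (K + n))) = t (K + n) := dist_comm _ _
      have e3 : disp (blockElt h γ (List.ofFn fun i : Fin n => B (K + i))) =
          dist (o K) (o (K + n)) := by
        simp only [ho]
        rw [hn, mul_smul, dist_smul, dist_comm]
        rfl
      rw [e1, e2, e3] at this
      exact this)
    rw [hI] at h1
    exact h1
  obtain ⟨θ₀, -, φ, hφ, hlim⟩ := isCompact_Icc.tendsto_subseq hθI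
  have hlimK : ∀ K, cosh (dist (geo (rot θ₀) (t K)) (o K)) ≤ exp C + 1 := by
    intro K
    have hc : Continuous fun θ => cosh (dist (geo (rot θ) (t K)) (o K)) :=
      Real.continuous_cosh.comp
        ((((continuous_geo_left (t K)).comp continuous_rot)).dist continuous_const)
    refine le_of_tendsto ((hc.tendsto θ₀).comp hlim) ?_
    filter_upwards [eventually_ge_atTop K] with n hn
    exact halign K (φ n) (hn.trans hφ.le_apply)
  set D := Real.log (2 * (exp C + 1)) with hD
  have hclose : ∀ K, dist (geo (rot θ₀) (t K)) (o K) ≤ D := by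
    intro K
    have h1 := hlimK K
    rw [Real.cosh_eq] at h1
    have h2 := Real.exp_pos (-dist (geo (rot θ₀) (t K)) (o K))
    have h3 := Real.exp_pos C
    rw [hD, Real.le_log_iff_exp_le (by positivity)]
    linarith
  have ht0 : ∀ K, 0 ≤ t K := fun K => dist_nonneg
  refine ⟨fun s : ℝ≥0 => geo (rot θ₀) s, ω, ⟨isRay_geo θ₀, D, ?_⟩,
    hG.isExpansion_of_close hred hemono.tendsto_atTop ht0 hclose, e, he0, fun k => ?_⟩
  · rw [frequently_atTop]
    intro a
    obtain ⟨N, hN⟩ := hG.exists_lt_dist hred I a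
    have hle : a ≤ t N := by
      have := hN (e N) hemono.le_apply
      rw [dist_comm] at this
      exact this.le
    exact ⟨⟨t N, ht0 N⟩, hle, _, hG.prefixProd_mem _ _, hclose N⟩
  · have hk := (hB.ok k).1
    refine ⟨hk, hsucc k, fun j => hωB k j, (hB.ok k).2, fun hp => ?_⟩
    have := (hB.ok (k + 1)).1
    rw [hωB (k + 1) (e (k + 1)) le_rfl (by rw [hsucc (k + 1)]; omega)]
    exact (hB.adj k).2 hp

/-- The block words of radial limit points are the admissible words. -/
lemma mem_blockWords_iff {n : ℕ} {b : Fin n → Block u v} :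
    b ∈ blockWords G h γ n ↔ Admissible (List.ofFn b) := by
  refine ⟨hG.admissible_of_mem_blockWords, fun hb => ?_⟩
  obtain ⟨B, hB, hBk⟩ : ∃ B, IsBlockStream B ∧ ∀ k : Fin n, B k = b k := by
    cases n with
    | zero =>
      obtain ⟨j⟩ : Nonempty (Fin v) := ⟨⟨0, hG.one_le_cusps⟩⟩
      obtain ⟨B, hB, -⟩ := Admissible.exists_stream hG.nonelementary
        (b := ((Sum.inr j, true), 1)) (bs := []) (admissible_singleton.mpr ⟨le_rfl, fun _ => rfl⟩)
      exact ⟨B, hB, fun k => k.elim0⟩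
    | succ n =>
      rw [List.ofFn_succ] at hb
      obtain ⟨B, hB, -, hBk⟩ := hb.exists_stream hG.nonelementary
      refine ⟨B, hB, fun k => ?_⟩
      have := hBk k (by simp [Nat.lt_succ_iff.mp k.2])
      rw [this]
      simp only [← List.ofFn_succ, List.getElem_ofFn]
  obtain ⟨r, ω, hr, hω, hBω⟩ := hG.exists_ray_of_stream hB
  exact ⟨r, ω, B, hr, hω, hBω, funext fun k => (hBk k).symm⟩

end IsFreeFuchsianGroup

/-! ### Exponential sums over block words -/

section ExpSum

variable {u v : ℕ}

/-- The sum of `exp (E w)` over a set of words `w`. -/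
def expSum (S : Set (List (Block u v))) (E : List (Block u v) → ℝ) : ℝ≥0∞ :=
  ∑' bs : S, ENNReal.ofReal (exp (E bs))

/-- The admissible words of `n` blocks. -/
def words (u v n : ℕ) : Set (List (Block u v)) := {bs | Admissible bs ∧ bs.length = n}

variable {S : Set (List (Block u v))} {E E' : List (Block u v) → ℝ} {c : ℝ}

lemma expSum_le_mul (hE : ∀ bs ∈ S, E' bs ≤ E bs + c) :
    expSum S E' ≤ ENNReal.ofReal (exp c) * expSum S E := by
  rw [expSum, expSum, ← ENNReal.tsum_mul_left]
  refine ENNReal.tsum_le_tsum fun bs => ?_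
  rw [← ENNReal.ofReal_mul (Real.exp_pos _).le, ← Real.exp_add]
  exact ENNReal.ofReal_le_ofReal (Real.exp_le_exp.mpr (by linarith [hE bs bs.2]))

lemma le_expSum {bs : List (Block u v)} (hbs : bs ∈ S) : ENNReal.ofReal (exp (E bs)) ≤ expSum S E :=
  ENNReal.le_tsum (f := fun bs : S => ENNReal.ofReal (exp (E bs))) ⟨bs, hbs⟩

/-- Cutting a word after `n` blocks is injective. Only an upper bound results, since not all pairs
can be concatenated. -/
lemma expSum_add_le (n m : ℕ)
    (hE : ∀ bs bs', Admissible (bs ++ bs') → E (bs ++ bs') ≤ E bs + E bs' + c) :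
    expSum (words u v (n + m)) E ≤
      ENNReal.ofReal (exp c) * (expSum (words u v n) E * expSum (words u v m) E) := by
  have hsplit : ∀ bs : words u v (n + m), Admissible (bs.1.take n ++ bs.1.drop n) := fun bs => by
    rw [List.take_append_drop]; exact bs.2.1
  have h1 : ∀ bs : words u v (n + m), bs.1.take n ∈ words u v n := fun bs =>
    ⟨(hsplit bs).left, by rw [List.length_take, bs.2.2]; omega⟩
  have h2 : ∀ bs : words u v (n + m), bs.1.drop n ∈ words u v m := fun bs =>
    ⟨(hsplit bs).right, by rw [List.length_drop, bs.2.2]; omega⟩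
  set f : words u v (n + m) → words u v n × words u v m := fun bs =>
    (⟨_, h1 bs⟩, ⟨_, h2 bs⟩) with hf
  have hinj : Function.Injective f := by
    intro bs bs' heq
    have e1 : bs.1.take n = bs'.1.take n := congrArg (fun p => p.1.1) heq
    have e2 : bs.1.drop n = bs'.1.drop n := congrArg (fun p => p.2.1) heq
    apply Subtype.ext
    rw [← List.take_append_drop n bs.1, e1, e2, List.take_append_drop]
  set g : words u v n × words u v m → ℝ≥0∞ := fun p => ENNReal.ofReal (exp c) *
    (ENNReal.ofReal (exp (E p.1)) * ENNReal.ofReal (exp (E p.2))) with hg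
  calc expSum (words u v (n + m)) E ≤ ∑' bs : words u v (n + m), g (f bs) := by
        refine ENNReal.tsum_le_tsum fun bs => ?_
        have := hE _ _ (hsplit bs)
        rw [List.take_append_drop] at this
        simp only [hg, hf]
        rw [← ENNReal.ofReal_mul (Real.exp_pos _).le, ← ENNReal.ofReal_mul (Real.exp_pos _).le,
          ← Real.exp_add, ← Real.exp_add]
        exact ENNReal.ofReal_le_ofReal (Real.exp_le_exp.mpr (by linarith))
    _ ≤ ∑' p, g p := ENNReal.tsum_comp_le_tsum_of_injective hinj g
    _ = _ := by
        simp only [hg]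
        rw [ENNReal.tsum_mul_left]
        congr 1
        rw [ENNReal.tsum_prod (f := fun (a : words u v n) (b : words u v m) =>
          ENNReal.ofReal (exp (E a)) * ENNReal.ofReal (exp (E b)))]
        simp only [ENNReal.tsum_mul_left, ENNReal.tsum_mul_right]
        rfl

lemma log_toReal_le {Z Z' : ℝ≥0∞} (h0 : Z ≠ 0) (hZ' : Z' ≠ ⊤)
    (hle : Z ≤ ENNReal.ofReal (exp c) * Z') :
    Real.log Z.toReal ≤ c + Real.log Z'.toReal := by
  have hpos : 0 < Z' := by
    rw [pos_iff_ne_zero]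
    rintro rfl
    rw [mul_zero, nonpos_iff_eq_zero] at hle
    exact h0 hle
  have h1 := ENNReal.toReal_mono (ENNReal.mul_ne_top ENNReal.ofReal_ne_top hZ') hle
  rw [ENNReal.toReal_mul, ENNReal.toReal_ofReal (Real.exp_pos _).le] at h1
  have hZ'pos : 0 < Z'.toReal := ENNReal.toReal_pos hpos.ne' hZ'
  have hZtop : Z ≠ ⊤ := ne_top_of_le_ne_top (ENNReal.mul_ne_top ENNReal.ofReal_ne_top hZ') hle
  have := Real.log_le_log (ENNReal.toReal_pos h0 hZtop) h1
  rwa [Real.log_mul (Real.exp_pos _).ne' hZ'pos.ne', Real.log_exp] at this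

/-- Hölder's inequality for exponential sums. -/
lemma log_expSum_convex {a b : ℝ} (ha : 0 ≤ a) (hb : 0 ≤ b) (hab : a + b = 1)
    (h1 : expSum S E ≠ ⊤) (h2 : expSum S E' ≠ ⊤) (hne : S.Nonempty) :
    Real.log (expSum S fun bs => a * E bs + b * E' bs).toReal ≤
      a * Real.log (expSum S E).toReal + b * Real.log (expSum S E').toReal := by
  obtain ⟨w, hw⟩ := hne
  have hpos : ∀ F : List (Block u v) → ℝ, expSum S F ≠ 0 := fun F h0 => by
    have := le_expSum (E := F) hw
    rw [h0, nonpos_iff_eq_zero, ENNReal.ofReal_eq_zero] at this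
    exact (Real.exp_pos _).not_ge this
  set A := (expSum S E).toReal with hA
  set A' := (expSum S E').toReal with hA'
  have hA0 : 0 < A := ENNReal.toReal_pos (hpos _) h1
  have hA0' : 0 < A' := ENNReal.toReal_pos (hpos _) h2
  have eA : expSum S E = ENNReal.ofReal A := (ENNReal.ofReal_toReal h1).symm
  have eA' : expSum S E' = ENNReal.ofReal A' := (ENNReal.ofReal_toReal h2).symm
  set c := a * Real.log A + b * Real.log A' with hc
  -- Convexity of `exp`, applied termwise after both sums are normalised to one.
  have key : ∀ bs, exp (a * E bs + b * E' bs) ≤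
      exp c * (a / A) * exp (E bs) + exp c * (b / A') * exp (E' bs) := by
    intro bs
    have := convexOn_exp.2 (Set.mem_univ (E bs - Real.log A)) (Set.mem_univ (E' bs - Real.log A'))
      ha hb hab
    simp only [smul_eq_mul] at this
    rw [Real.exp_sub, Real.exp_sub, Real.exp_log hA0, Real.exp_log hA0'] at this
    have e : a * E bs + b * E' bs =
        c + (a * (E bs - Real.log A) + b * (E' bs - Real.log A')) := by rw [hc]; ring
    rw [e, Real.exp_add]
    calc _ ≤ exp c * (a * (exp (E bs) / A) + b * (exp (E' bs) / A')) := by gcongr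
      _ = _ := by ring
  have hle : expSum S (fun bs => a * E bs + b * E' bs) ≤ ENNReal.ofReal (exp c) * 1 := by
    calc expSum S (fun bs => a * E bs + b * E' bs)
        ≤ ∑' bs : S, (ENNReal.ofReal (exp c * (a / A)) * ENNReal.ofReal (exp (E bs)) +
            ENNReal.ofReal (exp c * (b / A')) * ENNReal.ofReal (exp (E' bs))) := by
          refine ENNReal.tsum_le_tsum fun bs => ?_
          rw [← ENNReal.ofReal_mul (by positivity), ← ENNReal.ofReal_mul (by positivity),
            ← ENNReal.ofReal_add (by positivity) (by positivity)]
          exact ENNReal.ofReal_le_ofReal (key bs)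
      _ = ENNReal.ofReal (exp c * (a / A)) * expSum S E +
            ENNReal.ofReal (exp c * (b / A')) * expSum S E' := by
          rw [ENNReal.tsum_add, ENNReal.tsum_mul_left, ENNReal.tsum_mul_left]; rfl
      _ = ENNReal.ofReal (exp c) * 1 := by
          rw [eA, eA', ← ENNReal.ofReal_mul (by positivity), ← ENNReal.ofReal_mul (by positivity),
            ← ENNReal.ofReal_add (by positivity) (by positivity), mul_one]
          congr 1
          field_simp
          linarith
  have := log_toReal_le (hpos _) ENNReal.one_ne_top hle
  simpa using this

lemma tsum_rpow_ne_top {p : ℝ} (hp : p < -1) : ∑' n : ℕ, ENNReal.ofReal ((n : ℝ) ^ p) ≠ ⊤ :=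
  (Real.summable_nat_rpow.mpr hp).tsum_ofReal_ne_top

lemma tsum_rpow_eq_top {p : ℝ} (hp : -1 ≤ p) : ∑' n : ℕ, ENNReal.ofReal ((n : ℝ) ^ p) = ⊤ := by
  by_contra hne
  have := ENNReal.summable_toReal hne
  have h2 : Summable fun n : ℕ => (n : ℝ) ^ p := by
    refine this.congr fun n => ENNReal.toReal_ofReal (Real.rpow_nonneg (Nat.cast_nonneg n) p)
  exact (Real.summable_nat_rpow.mp h2).not_ge hp

/-- The sums of `n ^ p` blow up as `p` tends to `-1`. -/
lemma exists_le_tsum_rpow (K : ℝ) : ∃ η₀ > 0, ∀ η, 0 < η → η ≤ η₀ →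
    ENNReal.ofReal K ≤ ∑' n : ℕ, ENNReal.ofReal (((n + 1 : ℕ) : ℝ) ^ ((-1 : ℝ) - η)) := by
  obtain ⟨M, hM⟩ := (Real.tendsto_sum_range_one_div_nat_succ_atTop.eventually_gt_atTop K).exists
  have hcont : Continuous fun η : ℝ =>
      ∑ i ∈ Finset.range M, (((i + 1 : ℕ) : ℝ) ^ ((-1 : ℝ) - η)) := by
    refine continuous_finsetSum _ fun i _ => ?_
    exact Real.continuous_const_rpow (by positivity) |>.comp (continuous_const.sub continuous_id)
  have h0 : K < ∑ i ∈ Finset.range M, (((i + 1 : ℕ) : ℝ) ^ ((-1 : ℝ) - 0)) := by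
    refine hM.trans_eq (Finset.sum_congr rfl fun i _ => ?_)
    rw [sub_zero, Real.rpow_neg_one, one_div]
    push_cast
    rfl
  obtain ⟨ε, hε, hball⟩ := Metric.eventually_nhds_iff.mp
    ((hcont.tendsto 0).eventually_const_lt h0)
  refine ⟨ε / 2, by positivity, fun η h1 h2 => ?_⟩
  have h3 := hball (y := η) (by rw [Real.dist_eq, sub_zero, abs_of_pos h1]; linarith)
  calc ENNReal.ofReal K ≤ ENNReal.ofReal (∑ i ∈ Finset.range M, (((i + 1 : ℕ) : ℝ) ^ ((-1 : ℝ) - η))) :=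
        ENNReal.ofReal_le_ofReal h3.le
    _ = ∑ i ∈ Finset.range M, ENNReal.ofReal (((i + 1 : ℕ) : ℝ) ^ ((-1 : ℝ) - η)) :=
        ENNReal.ofReal_sum_of_nonneg fun i _ => by positivity
    _ ≤ _ := ENNReal.sum_le_tsum _

lemma abs_posLog_sub_log_le {N : ℕ} (hN : 1 ≤ N) :
    |Real.posLog ((N - 1 : ℕ) : ℝ) - Real.log N| ≤ Real.log 2 := by
  have hlog : 0 < Real.log 2 := Real.log_pos one_lt_two
  rcases hN.eq_or_lt with rfl | h2
  · simp [hlog.le]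
  · have h3 : (1 : ℝ) ≤ ((N - 1 : ℕ) : ℝ) := by exact_mod_cast (by omega : 1 ≤ N - 1)
    rw [Real.posLog_eq_log (by rwa [abs_of_pos (by linarith)])]
    have h4 : (N : ℝ) = ((N - 1 : ℕ) : ℝ) + 1 := by
      rw [Nat.cast_sub hN]; push_cast; ring
    set x := ((N - 1 : ℕ) : ℝ)
    have h5 : Real.log x ≤ Real.log N := Real.log_le_log (by linarith) (by linarith)
    have h6 : Real.log N ≤ Real.log (2 * x) := Real.log_le_log (by linarith) (by linarith)
    rw [Real.log_mul (by norm_num) (by linarith)] at h6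
    rw [abs_le]
    constructor <;> linarith

end ExpSum

/-! ### The partition functions -/

section Exponent

variable {u v : ℕ} {h : Fin u → SL(2, ℝ)} {γ : Fin v → SL(2, ℝ)}

/-- The exponent with which a word enters the partition function. -/
def expo (h : Fin u → SL(2, ℝ)) (γ : Fin v → SL(2, ℝ)) (t β : ℝ) (bs : List (Block u v)) : ℝ :=
  -t * disp (blockElt h γ bs) - β * windSum bs

lemma admissible_cons {b : Block u v} {bs : List (Block u v)} :
    Admissible (b :: bs) ↔ Block.Ok b ∧ (∀ b' ∈ bs.head?, Adj b.1 b'.1) ∧ Admissible bs := by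
  cases bs with
  | nil => simp [admissible_singleton, admissible_nil]
  | cons b' bs => simp [admissible_cons_cons]

lemma expo_nil (t β : ℝ) : expo h γ t β [] = 0 := by simp [expo]

lemma logPartition_eq {G : Subgroup SL(2, ℝ)} (hG : IsFreeFuchsianGroup G h γ) (t β : ℝ) (n : ℕ) :
    logPartition G h γ t β n = ENNReal.log (expSum (words u v n) (expo h γ t β)) := by
  rw [logPartition, expSum]
  congr 1
  set f : blockWords G h γ n → words u v n := fun b =>
    ⟨List.ofFn b.1, hG.mem_blockWords_iff.mp b.2, List.length_ofFn⟩ with hf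
  have hbij : Function.Bijective f := by
    constructor
    · intro b b' heq
      exact Subtype.ext (List.ofFn_injective (congrArg Subtype.val heq))
    · rintro ⟨bs, hbs, rfl⟩
      refine ⟨⟨bs.get, hG.mem_blockWords_iff.mpr (by rwa [List.ofFn_get])⟩, ?_⟩
      exact Subtype.ext (List.ofFn_get bs)
  rw [← (Equiv.ofBijective f hbij).tsum_eq]
  refine tsum_congr fun b => ?_
  have e1 : blockProd h γ b.1 = blockElt h γ (List.ofFn b.1) := by
    rw [blockProd, blockElt, List.map_ofFn]; rfl
  have e2 : windSum (List.ofFn b.1) = 2 * ∑ k, Real.posLog (winding (b.1 k) : ℝ) := by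
    rw [windSum, List.map_ofFn, List.sum_ofFn, Finset.mul_sum]; rfl
  change _ = ENNReal.ofReal (exp (expo h γ t β (List.ofFn b.1)))
  rw [expo, e1, e2, disp]
  congr 2
  ring

lemma expo_append_sub (t β : ℝ) (bs bs' : List (Block u v)) :
    expo h γ t β (bs ++ bs') - (expo h γ t β bs + expo h γ t β bs') =
      t * (disp (blockElt h γ bs) + disp (blockElt h γ bs') - disp (blockElt h γ (bs ++ bs'))) := by
  rw [expo, expo, expo, windSum_append]
  ring

end Exponent

namespace IsFreeFuchsianGroup

variable {u v : ℕ} {G : Subgroup SL(2, ℝ)} {h : Fin u → SL(2, ℝ)} {γ : Fin v → SL(2, ℝ)}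
variable (hG : IsFreeFuchsianGroup G h γ)
include hG

/-- Winding is exactly additive, so only the displacement contributes an error, independent of `β`.
-/
lemma exists_abs_expo_append_le : ∃ C : ℝ, 0 ≤ C ∧ ∀ (t β : ℝ) (bs bs' : List (Block u v)),
    Admissible (bs ++ bs') →
      |expo h γ t β (bs ++ bs') - (expo h γ t β bs + expo h γ t β bs')| ≤ |t| * C := by
  obtain ⟨C, hC0, hC⟩ := hG.exists_disp_append_ge
  refine ⟨C, hC0, fun t β bs bs' hb => ?_⟩
  rw [expo_append_sub, abs_mul]
  refine mul_le_mul_of_nonneg_left ?_ (abs_nonneg t)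
  have h1 := hC bs bs' hb
  have h2 := disp_mul_le (blockElt h γ bs) (blockElt h γ bs')
  rw [← blockElt_append] at h2
  rw [abs_le]
  constructor <;> linarith

/-- A block of length `N` has weight `N ^ (-2 (t + β))` up to a bounded factor, which is the origin
of the critical line `t + β = 1/2`. -/
lemma exists_abs_expo_singleton_le : ∃ C : ℝ, 0 ≤ C ∧ ∀ (t β : ℝ) (b : Block u v), Block.Ok b →
    |expo h γ t β [b] + 2 * (t + β) * Real.log b.2| ≤ |t| * C + |β| * (2 * Real.log 2) := by
  obtain ⟨C, hC0, hC⟩ := hG.exists_abs_disp_pow_le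
  obtain ⟨D, hD⟩ : ∃ D, ∀ l : Letter u v, disp (l.val h γ) ≤ D := by
    obtain ⟨D, hD⟩ := (Set.finite_range fun l : Letter u v => disp (l.val h γ)).bddAbove
    exact ⟨D, fun l => hD ⟨l, rfl⟩⟩
  refine ⟨max C D, le_max_of_le_left hC0, fun t β b hb => ?_⟩
  have key : |disp (b.1.val h γ ^ b.2) - 2 * Real.log b.2| ≤ max C D := by
    by_cases hp : b.1.IsParabolic
    · exact (hC _ hp _ hb.1).trans (le_max_left _ _)
    · rw [hb.2 hp, pow_one, Nat.cast_one, Real.log_one, mul_zero, sub_zero,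
        abs_of_nonneg (disp_nonneg _)]
      exact (hD _).trans (le_max_right _ _)
  have e : expo h γ t β [b] + 2 * (t + β) * Real.log b.2 =
      -t * (disp (b.1.val h γ ^ b.2) - 2 * Real.log b.2) +
        -β * (2 * (Real.posLog ((b.2 - 1 : ℕ) : ℝ) - Real.log b.2)) := by
    simp only [expo, blockElt_cons, blockElt_nil, mul_one, windSum_cons, windSum_nil, add_zero,
      winding]
    ring
  rw [e]
  refine (abs_add_le _ _).trans ?_
  rw [abs_mul, abs_mul (-β), abs_mul 2, abs_neg, abs_neg, abs_two]
  gcongr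
  exact abs_posLog_sub_log_le hb.1

/-- There are words of every length without winding and of linear displacement. -/
lemma exists_short_words : ∃ D : ℝ, ∀ n, ∃ bs ∈ words u v n, windSum bs = 0 ∧
    disp (blockElt h γ bs) ≤ n * D := by
  choose nxt hnxt using fun l : Letter u v => exists_adj hG.nonelementary l
  obtain ⟨j⟩ : Nonempty (Fin v) := ⟨⟨0, hG.one_le_cusps⟩⟩
  set B : ℕ → Block u v := fun k => (nxt^[k] (Sum.inr j, true), 1) with hBdef
  have hB : IsBlockStream B := by
    refine ⟨fun k => ⟨le_rfl, fun _ => rfl⟩, fun k => ?_⟩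
    simp only [hBdef, Function.iterate_succ_apply']
    exact hnxt _
  obtain ⟨D, hD⟩ : ∃ D, ∀ l : Letter u v, disp (l.val h γ) ≤ D := by
    obtain ⟨D, hD⟩ := (Set.finite_range fun l : Letter u v => disp (l.val h γ)).bddAbove
    exact ⟨D, fun l => hD ⟨l, rfl⟩⟩
  refine ⟨D, fun n => ⟨_, ⟨hB.admissible 0 n, List.length_ofFn⟩, windSum_eq_zero ?_, ?_⟩⟩
  · intro b hb
    obtain ⟨i, rfl⟩ := List.mem_ofFn.mp hb
    simp [hBdef]
  · induction n with
    | zero => simp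
    | succ n ih =>
      rw [List.ofFn_succ_last, blockElt_append]
      refine (disp_mul_le _ _).trans ?_
      push_cast
      rw [add_mul, one_mul]
      refine add_le_add ih ?_
      simpa [hBdef] using hD _

lemma words_nonempty (n : ℕ) : (words u v n).Nonempty := by
  obtain ⟨D, hD⟩ := hG.exists_short_words
  obtain ⟨bs, hbs, -⟩ := hD n
  exact ⟨bs, hbs⟩

lemma expSum_words_ne_zero (n : ℕ) (E : List (Block u v) → ℝ) : expSum (words u v n) E ≠ 0 := by
  obtain ⟨bs, hbs⟩ := hG.words_nonempty n
  intro h0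
  have := le_expSum (E := E) hbs
  rw [h0, nonpos_iff_eq_zero, ENNReal.ofReal_eq_zero] at this
  exact (Real.exp_pos _).not_ge this

/-- For one block the sum is dominated by finitely many copies of the convergent series `∑ N ^ (-2
(t + β))`; submultiplicativity does the rest. -/
lemma expSum_words_ne_top {t β : ℝ} (ht : 1 / 2 < t + β) (n : ℕ) :
    expSum (words u v n) (expo h γ t β) ≠ ⊤ := by
  obtain ⟨C, -, hC⟩ := hG.exists_abs_expo_append_le
  obtain ⟨C₁, -, hC₁⟩ := hG.exists_abs_expo_singleton_le
  have hadd : ∀ bs bs', Admissible (bs ++ bs') →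
      expo h γ t β (bs ++ bs') ≤ expo h γ t β bs + expo h γ t β bs' + |t| * C := by
    intro bs bs' hb
    have := (abs_le.mp (hC t β bs bs' hb)).2
    linarith
  have hone : expSum (words u v 1) (expo h γ t β) ≠ ⊤ := by
    set K := |t| * C₁ + |β| * (2 * Real.log 2) with hK
    set g : Block u v → ℝ≥0∞ := fun b =>
      ENNReal.ofReal (exp K) * ENNReal.ofReal ((b.2 : ℝ) ^ (-(2 * (t + β)))) with hg
    have hex : ∀ bs : words u v 1, ∃ b, bs.1 = [b] := fun bs =>
      List.length_eq_one_iff.mp bs.2.2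
    choose f hf using hex
    have hinj : Function.Injective f := fun bs bs' heq => Subtype.ext (by rw [hf, hf, heq])
    have hle : expSum (words u v 1) (expo h γ t β) ≤ ∑' b, g b := by
      refine le_trans (ENNReal.tsum_le_tsum fun bs => ?_)
        (ENNReal.tsum_comp_le_tsum_of_injective hinj g)
      have hok : Block.Ok (f bs) := by
        have := bs.2.1
        rw [hf, admissible_singleton] at this
        exact this
      have h1 := (abs_le.mp (hC₁ t β _ hok)).2
      have hN : (0 : ℝ) < (f bs).2 := by exact_mod_cast hok.1
      simp only [hg]
      rw [hf bs, ← ENNReal.ofReal_mul (Real.exp_pos _).le, Real.rpow_def_of_pos hN, ← Real.exp_add]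
      exact ENNReal.ofReal_le_ofReal (Real.exp_le_exp.mpr (by linarith))
    refine ne_top_of_le_ne_top ?_ hle
    simp only [hg]
    rw [ENNReal.tsum_prod (f := fun (_ : Letter u v) (N : ℕ) =>
      ENNReal.ofReal (exp K) * ENNReal.ofReal ((N : ℝ) ^ (-(2 * (t + β))))), tsum_fintype]
    refine ENNReal.sum_ne_top.mpr fun l _ => ?_
    rw [ENNReal.tsum_mul_left]
    exact ENNReal.mul_ne_top ENNReal.ofReal_ne_top (tsum_rpow_ne_top (by linarith))
  have hzero : expSum (words u v 0) (expo h γ t β) ≠ ⊤ := by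
    have : words u v 0 = {[]} := by
      ext bs
      simp only [words, Set.mem_ofPred_eq, List.length_eq_zero_iff, Set.mem_singleton_iff]
      exact ⟨fun hb => hb.2, fun hb => ⟨hb ▸ admissible_nil, hb⟩⟩
    rw [this, expSum]
    simp
  induction n with
  | zero => exact hzero
  | succ n ih =>
    exact ne_top_of_le_ne_top (ENNReal.mul_ne_top ENNReal.ofReal_ne_top (ENNReal.mul_ne_top ih hone))
      (expSum_add_le n 1 hadd)

lemma exists_letter_ne_cusp (j : Fin v) : ∃ l : Letter u v, l.1 ≠ Sum.inr j := by
  have hcard : 1 < Fintype.card (Fin u ⊕ Fin v) := by simpa using hG.nonelementary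
  obtain ⟨a, ha⟩ := Fintype.exists_ne_of_one_lt_card hcard (Sum.inr j)
  exact ⟨(a, true), ha⟩

omit hG in
lemma adj_of_ne {l l' : Letter u v} (hne : l'.1 ≠ l.1) : Adj l l' :=
  ⟨fun e => hne (by rw [e]; rfl), fun _ e => hne (by rw [e])⟩

/-- Varying only the length of a first parabolic block before a fixed tail already gives a divergent
series. -/
lemma expSum_words_eq_top {t β : ℝ} (ht : t + β ≤ 1 / 2) (n : ℕ) :
    expSum (words u v (n + 1)) (expo h γ t β) = ⊤ := by
  obtain ⟨C, -, hC⟩ := hG.exists_abs_expo_append_le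
  obtain ⟨C₁, -, hC₁⟩ := hG.exists_abs_expo_singleton_le
  obtain ⟨j⟩ : Nonempty (Fin v) := ⟨⟨0, hG.one_le_cusps⟩⟩
  set l : Letter u v := (Sum.inr j, true) with hl
  obtain ⟨B, hB, hB0, -⟩ := Admissible.exists_stream hG.nonelementary (b := (l, 1)) (bs := [])
    (admissible_singleton.mpr ⟨le_rfl, fun _ => rfl⟩)
  set rest : List (Block u v) := List.ofFn fun i : Fin n => B (1 + i) with hrest
  have hadm : ∀ N : ℕ, Admissible ((l, N + 1) :: rest) := by
    intro N
    have h1 := hB.admissible 0 (n + 1)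
    rw [List.ofFn_succ] at h1
    simp only [Fin.val_zero, add_zero, zero_add, hB0, Fin.val_succ] at h1
    simp only [add_comm _ 1] at h1
    rw [admissible_cons] at h1 ⊢
    exact ⟨⟨by simp, fun hn => absurd ⟨j, rfl⟩ hn⟩, h1.2⟩
  set K := |t| * C + (|t| * C₁ + |β| * (2 * Real.log 2)) - expo h γ t β rest with hK
  set f : ℕ → words u v (n + 1) := fun N =>
    ⟨(l, N + 1) :: rest, hadm N, by simp [hrest]⟩ with hf
  have hinj : Function.Injective f := by
    intro N N' heq
    have := congrArg Subtype.val heq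
    simp only [hf, List.cons.injEq, Prod.mk.injEq] at this
    omega
  have hterm : ∀ N : ℕ, ENNReal.ofReal (exp (-K)) *
      ENNReal.ofReal (((N + 1 : ℕ) : ℝ) ^ (-(2 * (t + β)))) ≤
        ENNReal.ofReal (exp (expo h γ t β (f N))) := by
    intro N
    have hN : (0 : ℝ) < ((N + 1 : ℕ) : ℝ) := by positivity
    have hN' := hadm N
    have h1 := (abs_le.mp (hC t β [(l, N + 1)] rest hN')).1
    have h2 := (abs_le.mp (hC₁ t β (l, N + 1) (hN'.1 _ (by simp)))).1
    rw [← ENNReal.ofReal_mul (Real.exp_pos _).le, Real.rpow_def_of_pos hN, ← Real.exp_add]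
    refine ENNReal.ofReal_le_ofReal (Real.exp_le_exp.mpr ?_)
    simp only [hf]
    simp only [List.singleton_append] at h1 h2
    rw [hK]
    linarith
  have hdiv : ∑' N : ℕ, ENNReal.ofReal (((N + 1 : ℕ) : ℝ) ^ (-(2 * (t + β)))) = ⊤ := by
    have h1 := tsum_rpow_eq_top (p := -(2 * (t + β))) (by linarith)
    rw [tsum_eq_zero_add' ENNReal.summable] at h1
    exact (ENNReal.add_eq_top.mp h1).resolve_left ENNReal.ofReal_ne_top
  refine top_le_iff.mp ?_
  calc ⊤ = ENNReal.ofReal (exp (-K)) *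
        ∑' N : ℕ, ENNReal.ofReal (((N + 1 : ℕ) : ℝ) ^ (-(2 * (t + β)))) := by
        rw [hdiv, ENNReal.mul_top]
        simpa using Real.exp_pos _
    _ ≤ ∑' N, ENNReal.ofReal (exp (expo h γ t β (f N))) := by
        rw [← ENNReal.tsum_mul_left]
        exact ENNReal.tsum_le_tsum hterm
    _ ≤ _ := ENNReal.tsum_comp_le_tsum_of_injective hinj
        (fun bs : words u v (n + 1) => ENNReal.ofReal (exp (expo h γ t β bs)))

/-- Near the critical exponent the partition functions grow exponentially. -/
lemma exists_expSum_ge (β : ℝ) : ∃ η₀ > 0, ∀ η, 0 < η → η ≤ η₀ → ∀ m : ℕ,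
    ENNReal.ofReal (exp m) ≤ expSum (words u v (2 * m)) (expo h γ (1 / 2 - β + η) β) := by
  obtain ⟨C, hC0, hC⟩ := hG.exists_abs_expo_append_le
  obtain ⟨C₁, hC₁0, hC₁⟩ := hG.exists_abs_expo_singleton_le
  obtain ⟨j⟩ : Nonempty (Fin v) := ⟨⟨0, hG.one_le_cusps⟩⟩
  obtain ⟨y, hy⟩ := hG.exists_letter_ne_cusp j
  set l : Letter u v := (Sum.inr j, true) with hl
  -- `T` bounds `|t|` for all `η ≤ 1`. `K` collects the errors of two concatenations and two single
  -- blocks, so `η₀` can be chosen independently of the words.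
  set T := |1 / 2 - β| + 1 with hT
  set K := 2 * (T * C) + 2 * (T * C₁ + |β| * (2 * Real.log 2)) with hK
  obtain ⟨η₀, hη₀, hη⟩ := exists_le_tsum_rpow (exp (K + 1))
  refine ⟨min 1 (η₀ / 2), by positivity, fun η h1 h2 => ?_⟩
  have hη1 : η ≤ 1 := h2.trans (min_le_left _ _)
  have hη2 : 2 * η ≤ η₀ := by have := h2.trans (min_le_right _ _); linarith
  set t := 1 / 2 - β + η with ht
  have htT : |t| ≤ T := by
    rw [ht, hT]
    refine (abs_add_le _ _).trans ?_
    rw [abs_of_pos h1]; linarith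
  -- Words that any block of the letter `l` may precede. Prepending such a block and then the letter
  -- `y`, off this cusp, stays in the class; summing over the length of the block multiplies the sum
  -- by at least `e`.
  set V : ℕ → Set (List (Block u v)) := fun n =>
    {bs | bs ∈ words u v n ∧ ∀ b ∈ bs.head?, b.1.1 ≠ Sum.inr j} with hV
  have hadm : ∀ n (N : ℕ), ∀ bs ∈ V n, Admissible ((l, N + 1) :: bs) ∧
      Admissible ((y, 1) :: (l, N + 1) :: bs) := by
    intro n N bs hbs
    have h3 : Admissible ((l, N + 1) :: bs) := by
      rw [admissible_cons]
      refine ⟨⟨by simp, fun hn => absurd ⟨j, rfl⟩ hn⟩, fun b hb => ?_, hbs.1.1⟩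
      exact adj_of_ne (hbs.2 b hb)
    refine ⟨h3, ?_⟩
    rw [admissible_cons]
    refine ⟨⟨le_rfl, fun _ => rfl⟩, fun b hb => ?_, h3⟩
    simp only [List.head?_cons, Option.mem_def, Option.some.injEq] at hb
    subst hb
    exact adj_of_ne hy.symm
  have hstep : ∀ n, ENNReal.ofReal (exp 1) * expSum (V n) (expo h γ t β) ≤
      expSum (V (n + 2)) (expo h γ t β) := by
    intro n
    set f : ℕ × V n → V (n + 2) := fun p =>
      ⟨(y, 1) :: (l, p.1 + 1) :: p.2.1, ⟨(hadm n p.1 p.2.1 p.2.2).2, by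
        simp [p.2.2.1.2]⟩, by simpa using hy⟩ with hf
    have hinj : Function.Injective f := by
      intro p p' heq
      have := congrArg Subtype.val heq
      simp only [hf, List.cons.injEq, Prod.mk.injEq, true_and, add_left_inj] at this
      exact Prod.ext this.1 (Subtype.ext this.2)
    have hterm : ∀ p : ℕ × V n, ENNReal.ofReal (exp (-K)) *
        ENNReal.ofReal (((p.1 + 1 : ℕ) : ℝ) ^ ((-1 : ℝ) - 2 * η)) *
          ENNReal.ofReal (exp (expo h γ t β p.2)) ≤
        ENNReal.ofReal (exp (expo h γ t β (f p))) := by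
      rintro ⟨N, bs, hbs⟩
      have hN : (0 : ℝ) < ((N + 1 : ℕ) : ℝ) := by positivity
      obtain ⟨a1, a2⟩ := hadm n N bs hbs
      have b1 := (abs_le.mp (hC t β [(l, N + 1)] bs a1)).1
      have b2 := (abs_le.mp (hC t β [(y, 1)] ((l, N + 1) :: bs) a2)).1
      have b3 := (abs_le.mp (hC₁ t β (l, N + 1) (a1.1 _ (by simp)))).1
      have b4 := (abs_le.mp (hC₁ t β (y, 1) (a2.1 _ (by simp)))).1
      have c1 : |t| * C ≤ T * C := by gcongr
      have c2 : |t| * C₁ ≤ T * C₁ := by gcongr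
      rw [← ENNReal.ofReal_mul (Real.exp_pos _).le, Real.rpow_def_of_pos hN, ← Real.exp_add,
        ← ENNReal.ofReal_mul (Real.exp_pos _).le, ← Real.exp_add]
      refine ENNReal.ofReal_le_ofReal (Real.exp_le_exp.mpr ?_)
      simp only [hf]
      simp only [List.singleton_append, Nat.cast_one, Real.log_one, mul_zero, add_zero]
        at b1 b2 b3 b4
      have e : Real.log ((N + 1 : ℕ) : ℝ) * ((-1 : ℝ) - 2 * η) =
          -(2 * (t + β) * Real.log ((N + 1 : ℕ) : ℝ)) := by rw [ht]; ring
      rw [e, hK]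
      linarith
    calc ENNReal.ofReal (exp 1) * expSum (V n) (expo h γ t β)
        ≤ (ENNReal.ofReal (exp (-K)) *
            ∑' N : ℕ, ENNReal.ofReal (((N + 1 : ℕ) : ℝ) ^ ((-1 : ℝ) - 2 * η))) *
            expSum (V n) (expo h γ t β) := by
          gcongr
          have := hη (2 * η) (by linarith) hη2
          calc ENNReal.ofReal (exp 1)
              = ENNReal.ofReal (exp (-K)) * ENNReal.ofReal (exp (K + 1)) := by
                rw [← ENNReal.ofReal_mul (Real.exp_pos _).le, ← Real.exp_add]
                congr 2
                ring
            _ ≤ _ := by gcongr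
      _ = ∑' p : ℕ × V n, ENNReal.ofReal (exp (-K)) *
        ENNReal.ofReal (((p.1 + 1 : ℕ) : ℝ) ^ ((-1 : ℝ) - 2 * η)) *
          ENNReal.ofReal (exp (expo h γ t β p.2)) := by
          rw [ENNReal.tsum_prod (f := fun (N : ℕ) (bs : V n) => ENNReal.ofReal (exp (-K)) *
            ENNReal.ofReal (((N + 1 : ℕ) : ℝ) ^ ((-1 : ℝ) - 2 * η)) *
            ENNReal.ofReal (exp (expo h γ t β bs)))]
          simp only [ENNReal.tsum_mul_left, ENNReal.tsum_mul_right]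
          rfl
      _ ≤ ∑' p, ENNReal.ofReal (exp (expo h γ t β (f p))) := ENNReal.tsum_le_tsum hterm
      _ ≤ _ := ENNReal.tsum_comp_le_tsum_of_injective hinj
        (fun bs : V (n + 2) => ENNReal.ofReal (exp (expo h γ t β bs)))
  have hVm : ∀ m : ℕ, ENNReal.ofReal (exp m) ≤ expSum (V (2 * m)) (expo h γ t β) := by
    intro m
    induction m with
    | zero =>
      have hmem : ([] : List (Block u v)) ∈ V (2 * 0) := ⟨⟨admissible_nil, rfl⟩, by simp⟩
      have := le_expSum (E := expo h γ t β) hmem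
      rw [Nat.cast_zero]
      rwa [expo_nil] at this
    | succ m ih =>
      calc ENNReal.ofReal (exp (m + 1 : ℕ)) = ENNReal.ofReal (exp 1) * ENNReal.ofReal (exp m) := by
            rw [← ENNReal.ofReal_mul (Real.exp_pos _).le, ← Real.exp_add]
            congr 2
            push_cast; ring
        _ ≤ ENNReal.ofReal (exp 1) * expSum (V (2 * m)) (expo h γ t β) := by gcongr
        _ ≤ _ := hstep (2 * m)
  intro m
  refine (hVm m).trans ?_
  exact ENNReal.tsum_mono_subtype (fun bs => ENNReal.ofReal (exp (expo h γ t β bs)))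
    (fun bs hbs => hbs.1)

end IsFreeFuchsianGroup

/-! ### The pressure -/

section Pressure

variable {u v : ℕ}

/-- The logarithm of the partition function. -/
def logSum (h : Fin u → SL(2, ℝ)) (γ : Fin v → SL(2, ℝ)) (t β : ℝ) (n : ℕ) : ℝ :=
  Real.log (expSum (words u v n) (expo h γ t β)).toReal

/-- The pressure, where it is finite. -/
def pressure (h : Fin u → SL(2, ℝ)) (γ : Fin v → SL(2, ℝ)) (t β : ℝ) : ℝ :=
  limUnder atTop fun n : ℕ => logSum h γ t β n / n

end Pressure

namespace IsFreeFuchsianGroup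

variable {u v : ℕ} {G : Subgroup SL(2, ℝ)} {h : Fin u → SL(2, ℝ)} {γ : Fin v → SL(2, ℝ)}
variable (hG : IsFreeFuchsianGroup G h γ)
include hG

/-- Fekete's lemma for `logSum` shifted by the quasi-additivity constant. Words without winding
provide the linear lower bound. -/
lemma tendsto_pressure {t β : ℝ} (ht : 1 / 2 < t + β) :
    Tendsto (fun n : ℕ => logSum h γ t β n / n) atTop (𝓝 (pressure h γ t β)) := by
  refine tendsto_nhds_limUnder ?_
  obtain ⟨C, -, hC⟩ := hG.exists_abs_expo_append_le
  obtain ⟨D, hD⟩ := hG.exists_short_words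
  set κ := |t| * C with hκ
  have hsub : Subadditive fun n => logSum h γ t β n + κ := by
    intro m n
    have h1 := expSum_add_le (E := expo h γ t β) (c := κ) m n fun bs bs' hb => by
      have := (abs_le.mp (hC t β bs bs' hb)).2
      linarith
    have h2 := log_toReal_le (hG.expSum_words_ne_zero _ _)
      (ENNReal.mul_ne_top (hG.expSum_words_ne_top ht m) (hG.expSum_words_ne_top ht n)) h1
    have p : ∀ n, 0 < (expSum (words u v n) (expo h γ t β)).toReal := fun n =>
      ENNReal.toReal_pos (hG.expSum_words_ne_zero _ _) (hG.expSum_words_ne_top ht n)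
    rw [ENNReal.toReal_mul, Real.log_mul (p m).ne' (p n).ne'] at h2
    simp only [logSum]
    linarith
  have hlow : ∀ n, -(|t| * (n * D)) ≤ logSum h γ t β n := by
    intro n
    obtain ⟨bs, hbs, hw, hd⟩ := hD n
    have h1 := le_expSum (E := expo h γ t β) hbs
    have h2 := ENNReal.toReal_mono (hG.expSum_words_ne_top ht n) h1
    rw [ENNReal.toReal_ofReal (Real.exp_pos _).le] at h2
    have h3 := Real.log_le_log (Real.exp_pos _) h2
    rw [Real.log_exp, expo, hw, mul_zero, sub_zero] at h3
    refine le_trans ?_ h3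
    have h4 : t * disp (blockElt h γ bs) ≤ |t| * (n * D) := by
      have := disp_nonneg (blockElt h γ bs)
      exact mul_le_mul (le_abs_self t) hd this (abs_nonneg t)
    linarith
  have hbdd : BddBelow (Set.range fun n : ℕ => (logSum h γ t β n + κ) / n) := by
    refine ⟨-(|t| * |D|) - |κ|, ?_⟩
    rintro _ ⟨n, rfl⟩
    rcases Nat.eq_zero_or_pos n with rfl | hn
    · simp only [Nat.cast_zero, div_zero]
      have : 0 ≤ |t| * |D| := by positivity
      linarith [abs_nonneg κ]
    · have hn' : (1 : ℝ) ≤ n := by exact_mod_cast hn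
      change _ ≤ (logSum h γ t β n + κ) / n
      rw [le_div_iff₀ (by linarith)]
      have h1 := hlow n
      have h2 : |t| * (n * D) ≤ |t| * |D| * n := by
        have : |t| * (n * D) = |t| * D * n := by ring
        rw [this]
        gcongr
        exact le_abs_self D
      have h3 : |κ| ≤ |κ| * n := le_mul_of_one_le_right (abs_nonneg _) hn'
      have h4 := neg_abs_le κ
      linarith
  refine ⟨hsub.lim, ?_⟩
  have h1 := hsub.tendsto_lim hbdd
  have h2 : Tendsto (fun n : ℕ => κ / (n : ℝ)) atTop (𝓝 0) := tendsto_const_div_atTop_nhds_zero_nat κ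
  have := h1.sub h2
  rw [sub_zero] at this
  refine this.congr fun n => ?_
  rw [add_div, add_sub_cancel_right]

lemma hasPressure {t β : ℝ} (ht : 1 / 2 < t + β) :
    HasPressure G h γ t β (pressure h γ t β : ℝ) := by
  refine (continuous_coe_real_ereal.tendsto _ |>.comp (hG.tendsto_pressure ht)).congr fun n => ?_
  rw [logPartition_eq hG, ENNReal.log_pos_real (hG.expSum_words_ne_zero _ _)
    (hG.expSum_words_ne_top ht n), Function.comp, EReal.coe_div]
  rfl

lemma hasPressure_top {t β : ℝ} (ht : t + β ≤ 1 / 2) : HasPressure G h γ t β ⊤ := by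
  refine (tendsto_const_nhds (x := (⊤ : EReal))).congr' ?_
  filter_upwards [eventually_ge_atTop 1] with n hn
  obtain ⟨m, rfl⟩ := Nat.exists_eq_add_of_le' hn
  rw [logPartition_eq hG, hG.expSum_words_eq_top ht, ENNReal.log_top,
    EReal.top_div_of_pos_ne_top _ (EReal.coe_ne_top _)]
  exact EReal.coe_pos.mpr (by positivity)

/-- Comparison of pressures. -/
lemma pressure_le_sub {t β t' β' a b : ℝ} (ht : 1 / 2 < t + β) (ht' : 1 / 2 < t' + β')
    (hle : ∀ bs : List (Block u v), Admissible bs →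
      expo h γ t' β' bs ≤ expo h γ t β bs + (b - a * bs.length)) :
    pressure h γ t' β' ≤ pressure h γ t β - a := by
  have h2 : Tendsto (fun n : ℕ => b / (n : ℝ)) atTop (𝓝 0) := tendsto_const_div_atTop_nhds_zero_nat b
  have h3 := ((hG.tendsto_pressure ht).sub_const a).add h2
  rw [add_zero] at h3
  refine le_of_tendsto_of_tendsto (hG.tendsto_pressure ht') h3 ?_
  filter_upwards [eventually_gt_atTop 0] with n hn
  have hn' : (0 : ℝ) < n := by exact_mod_cast hn
  have h4 := log_toReal_le (hG.expSum_words_ne_zero _ _) (hG.expSum_words_ne_top ht n)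
    (expSum_le_mul (S := words u v n) (E := expo h γ t β) (E' := expo h γ t' β') (c := b - a * n)
      fun bs hbs => by
        have := hle bs hbs.1
        rwa [hbs.2] at this)
  have h5 : logSum h γ t' β' n / n ≤ (b - a * n + logSum h γ t β n) / n := by
    gcongr
    exact h4
  refine h5.trans_eq ?_
  field_simp
  ring

lemma exists_linear_le : ∃ δ > 0, ∃ C : ℝ, ∀ bs : List (Block u v), Admissible bs →
    δ * bs.length - C ≤ disp (blockElt h γ bs) - windSum bs ∧
      δ * bs.length - C ≤ disp (blockElt h γ bs) := by
  obtain ⟨δ, hδ, C, -, hC⟩ := hG.exists_linear_le_disp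
  refine ⟨δ, hδ, C, fun bs hb => ?_⟩
  have := hC bs hb
  have := windSum_nonneg bs
  constructor <;> linarith

/-- Displacement grows at least like `δ` per block, so raising `t` shrinks every term at a definite
exponential rate. -/
lemma exists_pressure_decay : ∃ δ > 0, ∀ t t' β : ℝ, 1 / 2 < t + β → t ≤ t' →
    pressure h γ t' β ≤ pressure h γ t β - (t' - t) * δ := by
  obtain ⟨δ, hδ, C, hC⟩ := hG.exists_linear_le
  refine ⟨δ, hδ, fun t t' β ht htt => ?_⟩
  refine hG.pressure_le_sub (b := (t' - t) * C) ht (by linarith) fun bs hb => ?_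
  have h1 := mul_le_mul_of_nonneg_left (hC bs hb).2 (sub_nonneg.mpr htt)
  rw [expo, expo]
  linarith

/-- The exponent is affine in `t`, so Hölder's inequality makes each `logSum` convex, and this
passes to the limit. It serves to give continuity. -/
lemma pressure_convex (β : ℝ) : ConvexOn ℝ (Ioi (1 / 2 - β)) fun t => pressure h γ t β := by
  refine ⟨convex_Ioi _, fun t ht t' ht' a b ha hb hab => ?_⟩
  have hmem := (convex_Ioi (1 / 2 - β)) ht ht' ha hb hab
  simp only [smul_eq_mul, Set.mem_Ioi] at *
  refine le_of_tendsto_of_tendsto' (hG.tendsto_pressure (by linarith))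
    (((hG.tendsto_pressure (β := β) (t := t) (by linarith)).const_mul a).add
      ((hG.tendsto_pressure (β := β) (t := t') (by linarith)).const_mul b)) fun n => ?_
  have h1 := log_expSum_convex ha hb hab (hG.expSum_words_ne_top (t := t) (β := β) (by linarith) n)
    (hG.expSum_words_ne_top (t := t') (β := β) (by linarith) n) (hG.words_nonempty n)
  have h2 : (fun bs : List (Block u v) => a * expo h γ t β bs + b * expo h γ t' β bs) =
      expo h γ (a * t + b * t') β := by
    funext bs
    rw [expo, expo, expo]
    linear_combination (-β * windSum bs) * hab
  rw [h2] at h1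
  rw [mul_div_assoc', mul_div_assoc', ← add_div]
  gcongr
  exact h1

lemma exists_pressure_pos (β : ℝ) : ∃ t, 1 / 2 - β < t ∧ 0 < pressure h γ t β := by
  obtain ⟨η, hη, hge⟩ := hG.exists_expSum_ge β
  have ht : 1 / 2 < (1 / 2 - β + η) + β := by linarith
  refine ⟨1 / 2 - β + η, by linarith, ?_⟩
  have h1 : Tendsto (fun m : ℕ => 2 * m) atTop atTop := tendsto_id.const_mul_atTop' two_pos
  have h2 := (hG.tendsto_pressure ht).comp h1
  refine lt_of_lt_of_le (show (0 : ℝ) < 1 / 2 by norm_num) (ge_of_tendsto h2 ?_)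
  filter_upwards [eventually_gt_atTop 0] with m hm
  have hm' : (0 : ℝ) < m := by exact_mod_cast hm
  have h3 := ENNReal.toReal_mono (hG.expSum_words_ne_top ht (2 * m)) (hge η hη le_rfl m)
  rw [ENNReal.toReal_ofReal (Real.exp_pos _).le] at h3
  have h4 := Real.log_le_log (Real.exp_pos _) h3
  rw [Real.log_exp] at h4
  simp only [Function.comp]
  rw [le_div_iff₀ (by positivity)]
  push_cast
  change _ ≤ Real.log _
  linarith

/-- The pressure has a unique zero. -/
lemma exists_zero (β : ℝ) : ∃ t, 1 / 2 - β < t ∧ pressure h γ t β = 0 := by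
  obtain ⟨t₁, ht₁, hp⟩ := hG.exists_pressure_pos β
  obtain ⟨δ, hδ, hdec⟩ := hG.exists_pressure_decay
  -- The point by which decay at rate `δ` has used up the positive value at `t₁`.
  set t₂ := t₁ + pressure h γ t₁ β / δ with ht₂
  have hle : t₁ ≤ t₂ := by
    have : 0 < pressure h γ t₁ β / δ := by positivity
    linarith
  have hneg : pressure h γ t₂ β ≤ 0 := by
    have := hdec t₁ t₂ β (by linarith) hle
    rw [ht₂, add_sub_cancel_left, div_mul_cancel₀ _ hδ.ne', sub_self] at this
    exact this
  have hcont : ContinuousOn (fun t => pressure h γ t β) (Icc t₁ t₂) :=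
    ((hG.pressure_convex β).continuousOn isOpen_Ioi).mono fun t ht => ht₁.trans_le ht.1
  obtain ⟨t, ht, h0⟩ := intermediate_value_Icc' hle hcont ⟨hneg, hp.le⟩
  exact ⟨t, ht₁.trans_le ht.1, h0⟩

/-- The pressure is negative at a given distance to the right of the critical exponent,
if `β` is negative enough. -/
lemma exists_pressure_neg {η : ℝ} (hη : 0 < η) : ∃ β₀ : ℝ, ∀ β < β₀,
    pressure h γ (1 / 2 - β + η) β < 0 := by
  obtain ⟨δ, hδ, C, hC⟩ := hG.exists_linear_le
  set p := pressure h γ (1 / 2 + η) 0 with hp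
  refine ⟨min 0 (-p / δ), fun β hβ => ?_⟩
  have hβ0 : β < 0 := hβ.trans_le (min_le_left _ _)
  have hβ1 : β < -p / δ := hβ.trans_le (min_le_right _ _)
  rw [lt_div_iff₀ hδ] at hβ1
  -- Both parameters lie on the line `t + β = 1/2 + η`, where the exponents differ by `β (disp -
  -- windSum)`; the lower bound for `disp - windSum` turns this into a loss of `-β δ` per block.
  have h1 := hG.pressure_le_sub (t := 1 / 2 + η) (β := 0) (t' := 1 / 2 - β + η) (β' := β)
    (a := -β * δ) (b := -β * C) (by linarith) (by linarith) fun bs hb => by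
      have h2 := mul_le_mul_of_nonneg_left (hC bs hb).1 (neg_nonneg.mpr hβ0.le)
      rw [expo, expo]
      linarith
  linarith

/-- The cusp-winding free energy function. -/
lemma exists_freeEnergy : ∃ t : ℝ → ℝ, IsFreeEnergy G h γ t ∧
    ∀ β, 1 / 2 - β < t β ∧ pressure h γ (t β) β = 0 := by
  choose t ht using hG.exists_zero
  obtain ⟨δ, hδ, hdec⟩ := hG.exists_pressure_decay
  refine ⟨t, fun β s => ?_, ht⟩
  obtain ⟨h1, h2⟩ := ht β
  constructor
  · intro hs
    -- To the left of the critical value the pressure is infinite; to the right two zeros would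
    -- contradict the decay at rate `δ`.
    rcases le_or_gt (s + β) (1 / 2) with hsβ | hsβ
    · exact absurd (tendsto_nhds_unique hs (hG.hasPressure_top hsβ)) EReal.zero_ne_top
    · have h3 := tendsto_nhds_unique hs (hG.hasPressure hsβ)
      have h4 : pressure h γ s β = 0 := by exact_mod_cast h3.symm
      rcases le_total s (t β) with hle | hle
      · have := hdec s (t β) β hsβ hle
        rw [h2, h4] at this
        nlinarith
      · have := hdec (t β) s β (by linarith) hle
        rw [h2, h4] at this
        nlinarith
  · rintro rfl
    have := hG.hasPressure (t := t β) (β := β) (by linarith)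
    rwa [h2] at this

end IsFreeFuchsianGroup

end CuspWinding

end

/-! ### The asymptotics of the free energy -/

theorem mainTheorem6 {u v : ℕ} (G : Subgroup SL(2, ℝ)) (h : Fin u → SL(2, ℝ))
    (γ : Fin v → SL(2, ℝ)) (hG : CuspWinding.IsFreeFuchsianGroup G h γ) :
    ∃ t : ℝ → ℝ, CuspWinding.IsFreeEnergy G h γ t ∧
      (∀ ε ∈ Ioo (0 : ℝ) (1 / 2), ∃ β₀ : ℝ, ∀ β < β₀,
        1 / 2 - β < t β ∧ t β < 1 / 2 - β + ε / 2) ∧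
      Tendsto (fun β => t β - (1 / 2 - β)) atBot (𝓝 0) := by
  obtain ⟨t, ht, hprop⟩ := hG.exists_freeEnergy
  obtain ⟨δ, hδ, hdec⟩ := hG.exists_pressure_decay
  have hbound : ∀ η : ℝ, 0 < η → ∃ β₀ : ℝ, ∀ β < β₀,
      1 / 2 - β < t β ∧ t β < 1 / 2 - β + η := by
    intro η hη
    obtain ⟨β₀, hβ₀⟩ := hG.exists_pressure_neg hη
    refine ⟨β₀, fun β hβ => ⟨(hprop β).1, ?_⟩⟩
    -- The pressure is already negative at `1/2 - β + η` and decreases from there, so it cannot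
    -- vanish further to the right.
    by_contra! hcon
    have h1 := hdec _ _ β (by linarith) hcon
    rw [(hprop β).2] at h1
    have h2 := hβ₀ β hβ
    have h3 : 0 ≤ (t β - (1 / 2 - β + η)) * δ := mul_nonneg (by linarith) hδ.le
    linarith
  refine ⟨t, ht, fun ε hε => hbound (ε / 2) (half_pos hε.1), ?_⟩
  rw [Metric.tendsto_nhds]
  intro η hη
  obtain ⟨β₀, hβ₀⟩ := hbound η hη
  filter_upwards [Iio_mem_atBot β₀] with β hβ
  obtain ⟨h1, h2⟩ := hβ₀ β hβ
  rw [Real.dist_eq, sub_zero, abs_of_pos (by linarith)]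
  linarith
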